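/- Let $V$ be a finite dimensional complex vector space with a nondegenerate hermitian form $(\ ,\ )$ of signature $(p,q)$; let $G=U(V)\cong U(p,q)$ be its unitary group and $\mathfrak g=u(V)\cong u(p,q)$ the Lie algebra of skew-hermitian endomorphisms. **Signed tableaux.** A signed tableau is a finite multiset of non-empty rows of boxes filled with signs $+,-$ that alternate along each row. The signed tableau of a nilpotent $E\in\mathfrak g$ has, for each $r\ge 0$ and each sign $\varepsilon$, as many rows of length $r+1$ with first sign $\varepsilon$ as the $\varepsilon$-index of inertia of the hermitian form $(v,(iE)^r w)$ on $\ker E^{r+1}$. (The signs $+$ and $-$ then occur $p$ and $q$ times.) Nilpotent $\mathrm{Ad}\,G$-orbits in $\mathfrak g$ are parametrized by their signed tableaux. **The parabolic subalgebra.** Let $V=V_1\oplus V_0\oplus V_1^*$, where $V_1$ and $V_1^*$ are isotropic and $V_0$ is orthogonal to $V_1\oplus V_1^*$. Let $\mathfrak p=\mathfrak m+\mathfrak n\subset\mathfrak g$ be the real parabolic subalgebra stabilizing the flag $(0)\subset V_1\subset V_1+V_0\subset V$, where $\mathfrak m\cong gl(V_1,\mathbb C)\times u(V_0)$ is the stabilizer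 in $\mathfrak g$ of the three summands and $\mathfrak n$ is the nilradical of $\mathfrak p$. Let $M\cong GL(V_1)\times U(V_0)$ be the stabilizer in $G$ of the three summands. Let $e\in u(V_0)$ be nilpotent, regarded as an element of $\mathfrak m$ acting by $0$ on $V_1$ and $V_1^*$, and let $\mathfrak c=\mathrm{Ad}\,M\cdot e$. **$\rho$-induction.** The $\rho$-induced set $ind_{\mathfrak p}^{\mathfrak g}(\mathfrak c)$ is the union of the finite collection of orbits $\mathfrak C_i=\mathrm{Ad}\,G\cdot E_i$ in $\mathfrak g$ such that each $\mathfrak C_i\cap(\mathfrak c+\mathfrak n)$ is non-empty and open in $\mathfrak c+\mathfrak n$ and the union of these intersections is dense in $\mathfrak c+\mathfrak n$. **Theorem 8.13.** This collection exists and is unique. It consists exactly of the orbits of the nilpotent $E\in\mathfrak g$ whose signed tableau is obtained from the signed tableau of $e\in u(V_0)$ as follows: add two boxes to the end of each of $\dim V_1$ of the largest rows such that the result is still a signed tableau. Here empty rows (which become rows of length $2$ with either first sign) are used when $e$ has fewer than $\dim V_1$ rows, and any choice among rows of equal length is allowed. Moreover, each signed tableau obtained in this way is the tableau of exactly one orbit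 in the collection. -/

import Mathlib

noncomputable section

/-! ### Signed tableaux -/

/-- A signed tableau: a finite multiset of non-empty rows of signs (so that rows are only
considered up to permutation), such that the signs alternate along each row. -/
@[ext]
structure SignedTableau where
  rows : Multiset (List ℤˣ)
  ne_nil : ∀ r ∈ rows, r ≠ []
  alternating : ∀ r ∈ rows, r.IsChain (fun a b => b = -a)

/-- The row `ε, -ε, ε, …` with `ℓ` boxes. -/
def alternatingRow (ε : ℤˣ) (ℓ : ℕ) : List ℤˣ := List.iterate Neg.neg ε ℓ

theorem alternatingRow_isChain (ε : ℤˣ) (ℓ : ℕ) :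
    (alternatingRow ε ℓ).IsChain (fun a b => b = -a) := by
  rw [List.isChain_iff_getElem]
  intro i hi
  simp only [alternatingRow, List.getElem_iterate, Function.iterate_succ_apply']

/-- `T'` is obtained from `T` by adding two boxes to the end of each of `n` of the largest rows.
The rows of `T` are first completed by `n` empty rows; then they are split into a multiset `S`
of `n` rows and a multiset `R` of remaining rows, none of which is longer than a row in `S`
(if several rows have the same length, any choice among them is allowed);
the rows in `S` are lengthened by two boxes, and the empty rows left over are dropped.
That `T'` is a signed tableau restricts the signs in the new boxes. -/
def AddTwoBoxes (n : ℕ) (T T' : SignedTableau) : Prop :=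
  ∃ S R S' : Multiset (List ℤˣ),
    T.rows + Multiset.replicate n [] = S + R ∧
    S.card = n ∧
    (∀ s ∈ S, ∀ r ∈ R, r.length ≤ s.length) ∧
    Multiset.Rel (fun s s' => ∃ a b : ℤˣ, s' = s ++ [a, b]) S S' ∧
    T'.rows = S' + R.filter (fun r => r ≠ [])

/-! ### The signed tableau of a nilpotent skew-hermitian endomorphism -/

section Tableau

variable {V : Type*} [AddCommGroup V] [Module ℂ V]

/-- Let `B` be a hermitian form (conjugate linear in the first variable) and let `E` be
skew-hermitian with respect to `B`, so that `i E` is hermitian. On `ker E ^ (r + 1)` the form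
`(v, w) ↦ B v ((i E) ^ r w)` is hermitian, and it descends to a nondegenerate form on the
multiplicity space `ker E ^ (r + 1) / (ker E ^ r + E (ker E ^ (r + 2)))` of the Jordan blocks
of size `r + 1`. For `ε = 1` (`ε = -1`) this is the positive (negative) index of inertia of that
form, that is the largest dimension of a subspace on which it is positive (negative) definite. -/
def rowCount (B : V →ₗ⋆[ℂ] V →ₗ[ℂ] ℂ) (E : Module.End ℂ V) (r : ℕ) (ε : ℤˣ) : ℕ :=
  sSup {d : ℕ | ∃ W : Submodule ℂ V, W ≤ LinearMap.ker (E ^ (r + 1)) ∧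
    (∀ w ∈ W, w ≠ 0 → 0 < (((ε : ℤ) : ℝ)) * (B w (((Complex.I • E) ^ r) w)).re) ∧
    Module.finrank ℂ W = d}

/-- The signed tableau of a nilpotent skew-hermitian endomorphism `E`: it has
`rowCount B E r ε` rows of `r + 1` boxes with first sign `ε`. Such a row comes from a Jordan string
`v, E v, …, E ^ r v` spanning a nondegenerate `E`-stable subspace, with
`B v ((i E) ^ r v)` of sign `ε`; the numbers of boxes `+` and `-` in the row are the signature of
`B` on this subspace if `B` is normalised in this way. -/
def signedTableau (B : V →ₗ⋆[ℂ] V →ₗ[ℂ] ℂ) (E : Module.End ℂ V) : SignedTableau where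
  rows := ∑ r ∈ Finset.range (Module.finrank ℂ V), ∑ ε : ℤˣ,
    Multiset.replicate (rowCount B E r ε) (alternatingRow ε (r + 1))
  ne_nil := by
    intro l hl
    simp only [Multiset.mem_sum, Multiset.mem_replicate] at hl
    obtain ⟨r, -, ε, -, -, rfl⟩ := hl
    simp [alternatingRow]
  alternating := by
    intro l hl
    simp only [Multiset.mem_sum, Multiset.mem_replicate] at hl
    obtain ⟨r, -, ε, -, -, rfl⟩ := hl
    exact alternatingRow_isChain ε (r + 1)

end Tableau

/-! ### Unitary groups, their Lie algebras, and real parabolic subalgebras -/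

section Unitary

variable {V : Type*} [NormedAddCommGroup V] [NormedSpace ℂ V]

/-- The group `U(V, B)` of the complex linear automorphisms preserving the form `B`. -/
def unitaryGroupOf (B : V →ₗ⋆[ℂ] V →ₗ[ℂ] ℂ) : Subgroup (V ≃L[ℂ] V) where
  carrier := {g | ∀ x y, B (g x) (g y) = B x y}
  one_mem' := fun _ _ => rfl
  mul_mem' := by
    intro g h hg hh x y
    exact (hg (h x) (h y)).trans (hh x y)
  inv_mem' := by
    intro g hg x y
    have h := hg (g.symm x) (g.symm y)
    rw [g.apply_symm_apply, g.apply_symm_apply] at h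
    exact h.symm

/-- The Lie algebra `u(V, B)` of the endomorphisms that are skew-hermitian with respect to `B`. -/
def skewHermitian (B : V →ₗ⋆[ℂ] V →ₗ[ℂ] ℂ) : Set (V →L[ℂ] V) :=
  {X | ∀ x y, B (X x) y + B x (X y) = 0}

/-- The orbit `Ad H · X` of an endomorphism under conjugation by a group of automorphisms. -/
def adOrbit (H : Subgroup (V ≃L[ℂ] V)) (X : V →L[ℂ] V) : Set (V →L[ℂ] V) :=
  {Y | ∃ g ∈ H, Y = (g : V →L[ℂ] V).comp (X.comp (g.symm : V →L[ℂ] V))}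

/-- A flag `0 ⊆ V₁ ⊆ V₁ + V₀ ⊆ V₁ + V₀ + V₁' = V` with `V₁` isotropic, together with a choice of
complements `V₀` and `V₁'` that is compatible with the form: `V₁'` is isotropic and
`V₀` is orthogonal to `V₁ + V₁'`. If `B` is hermitian and nondegenerate, it identifies `V₁'` with
the conjugate dual of `V₁`, and `V₁ + V₀` is the orthogonal complement of `V₁`. -/
structure RealFlag (B : V →ₗ⋆[ℂ] V →ₗ[ℂ] ℂ) where
  V₁ : Submodule ℂ V
  V₀ : Submodule ℂ V
  V₁' : Submodule ℂ V
  disjoint : Disjoint V₁ V₁'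
  isCompl : IsCompl V₀ (V₁ ⊔ V₁')
  isotropic : ∀ x ∈ V₁, ∀ y ∈ V₁, B x y = 0
  isotropic' : ∀ x ∈ V₁', ∀ y ∈ V₁', B x y = 0
  orthogonal : ∀ x ∈ V₀, ∀ y ∈ V₁ ⊔ V₁', B x y = 0

namespace RealFlag

variable {B : V →ₗ⋆[ℂ] V →ₗ[ℂ] ℂ}

/-- The Levi subgroup `M ≅ GL(V₁) × U(V₀)` of `U(V, B)`: the elements that stabilise each of
`V₁`, `V₀`, `V₁'`. -/
def levi (D : RealFlag B) : Subgroup (V ≃L[ℂ] V) where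
  carrier := {g | g ∈ unitaryGroupOf B ∧
    (∀ x, g x ∈ D.V₁ ↔ x ∈ D.V₁) ∧ (∀ x, g x ∈ D.V₀ ↔ x ∈ D.V₀) ∧
    (∀ x, g x ∈ D.V₁' ↔ x ∈ D.V₁')}
  one_mem' := ⟨one_mem _, fun _ => Iff.rfl, fun _ => Iff.rfl, fun _ => Iff.rfl⟩
  mul_mem' := by
    rintro g h ⟨hg, g1, g2, g3⟩ ⟨hh, h1, h2, h3⟩
    exact ⟨mul_mem hg hh, fun x => (g1 (h x)).trans (h1 x), fun x => (g2 (h x)).trans (h2 x),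
      fun x => (g3 (h x)).trans (h3 x)⟩
  inv_mem' := by
    rintro g ⟨hg, g1, g2, g3⟩
    refine ⟨inv_mem hg, fun x => ?_, fun x => ?_, fun x => ?_⟩
    · have h := g1 (g.symm x)
      rw [g.apply_symm_apply] at h
      exact h.symm
    · have h := g2 (g.symm x)
      rw [g.apply_symm_apply] at h
      exact h.symm
    · have h := g3 (g.symm x)
      rw [g.apply_symm_apply] at h
      exact h.symm

/-- The nilradical `n` of the real parabolic subalgebra of `u(V, B)` stabilising the flag
`0 ⊆ V₁ ⊆ V₁ + V₀ ⊆ V`: the elements of `u(V, B)` that map each step of the flag to the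
previous one. -/
def nilradical (D : RealFlag B) : Set (V →L[ℂ] V) :=
  {X | X ∈ skewHermitian B ∧ (∀ x ∈ D.V₁, X x = 0) ∧ (∀ x ∈ D.V₁ ⊔ D.V₀, X x ∈ D.V₁) ∧
    (∀ x, X x ∈ D.V₁ ⊔ D.V₀)}

/-- The set `c + n`, where `c = Ad M · e`. -/
def orbitAddNilradical (D : RealFlag B) (e : V →L[ℂ] V) : Set (V →L[ℂ] V) :=
  {Y | ∃ a ∈ adOrbit D.levi e, ∃ b ∈ D.nilradical, Y = a + b}

/-- `𝒪` is the collection of the orbits that make up the `ρ`-induced set from `c = Ad M · e` to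
`u(V, B)`: it is a finite collection of adjoint orbits in `u(V, B)`, each of which meets `c + n` in
a non-empty relatively open subset of `c + n`, and the union of these intersections is dense in
`c + n`. -/
def IsRhoInduced (D : RealFlag B) (e : V →L[ℂ] V) (𝒪 : Set (Set (V →L[ℂ] V))) : Prop :=
  𝒪.Finite ∧
  (∀ O ∈ 𝒪, (∃ E ∈ skewHermitian B, O = adOrbit (unitaryGroupOf B) E) ∧
    (O ∩ D.orbitAddNilradical e).Nonempty ∧
    ∃ U : Set (V →L[ℂ] V), IsOpen U ∧
      O ∩ D.orbitAddNilradical e = U ∩ D.orbitAddNilradical e) ∧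
  D.orbitAddNilradical e ⊆ closure (⋃ O ∈ 𝒪, O ∩ D.orbitAddNilradical e)

end RealFlag

end Unitary

end

/-! For a nilpotent skew-hermitian `E` let p(k,δ) be the δ-index of inertia of the form (v,(iE)^k w)
on all of V (`powInertia`). Splitting V into mutually orthogonal signed Jordan strings
(`exists_jordanFamily`) gives p(k,1) + p(k,-1) = rank E^k. It also shows that the p(k,δ) determine
the signed tableau (`signedTableau_eq_of_powInertia_eq`) and that the tableau determines the orbit
(`adOrbit_unitaryGroupOf_eq`).

Put d = dim V₁. The Levi group normalizes the nilradical, so c + n consists of conjugates of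
elements F of e + n, the lifts of e. On V₁ + V₀ the form has V₁ in its radical and F induces e on
the quotient. Hence p_F(k,δ) ≤ p_e(k,δ) + d, p_F(k+2,δ) ≤ p_e(k,δ) and rank F^(k+1) ≤ d + rank e^k.
Together these bound rank F^k by its value for a tableau with d largest rows lengthened by two
(`RealFlag.IsLift.finrank_range_pow_le`). Explicit lifts realize all these tableaux
(`RealFlag.exists_jordanFamily_liftOf`), so the bounds are attained. Conversely, if the ranks of F
are maximal, the index inequalities become equalities at every level k but one. The exceptional
level records only which signs are chosen among the rows of critical length
(`exists_isLargestRows_of_index_bounds`).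

It remains to pass to topology. Lifts form a real affine space, and on a line through a lift of
maximal ranks the ranks are maximal near any point, except possibly at that point
(`eventually_rank_line_ge`). This gives density. Indices of inertia can only grow under small
perturbation, but at a point of maximal ranks their sum cannot grow, so the tableau is locally
constant there (`eventually_signedTableau_eq`). This gives openness. Uniqueness of the collection is
formal: a relatively open orbit must meet the dense union of any other collection
(`RealFlag.IsRhoInduced.subset`). -/

open Module Filter Topology

noncomputable section

/-! ### Indices of inertia -/

section Inertia

variable {V : Type*} [AddCommGroup V] [Module ℂ V]

/-- The largest dimension of a subspace of `K` on which `ε H` is positive definite. -/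
def inertia (K : Submodule ℂ V) (H : V →ₗ⋆[ℂ] V →ₗ[ℂ] ℂ) (ε : ℤˣ) : ℕ :=
  sSup {d : ℕ | ∃ W : Submodule ℂ V, W ≤ K ∧
    (∀ w ∈ W, w ≠ 0 → 0 < (((ε : ℤ) : ℝ)) * (H w w).re) ∧ finrank ℂ W = d}

theorem rowCount_eq_inertia (B : V →ₗ⋆[ℂ] V →ₗ[ℂ] ℂ) (E : Module.End ℂ V) (r : ℕ) (ε : ℤˣ) :
    rowCount B E r ε =
      inertia (LinearMap.ker (E ^ (r + 1))) (B.compl₂ ((Complex.I • E) ^ r)) ε := rfl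

theorem form_sum_self {X : Type*} [Fintype X] (H : V →ₗ⋆[ℂ] V →ₗ[ℂ] ℂ) (u : X → V)
    (h0 : ∀ x y, x ≠ y → H (u x) (u y) = 0) (c : X → ℂ) :
    H (∑ x, c x • u x) (∑ x, c x • u x) = ∑ x, (Complex.normSq (c x) : ℂ) * H (u x) (u x) := by
  simp only [map_sum, LinearMap.sum_apply, map_smul, LinearMap.map_smulₛₗ, LinearMap.smul_apply,
    smul_eq_mul]
  refine Finset.sum_congr rfl fun x _ => ?_
  rw [Finset.sum_eq_single x]
  · rw [Complex.normSq_eq_conj_mul_self]; ring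
  · intro y _ hy
    rw [h0 y x hy]; simp
  · simp

variable [FiniteDimensional ℂ V]

theorem bddAbove_inertia (K : Submodule ℂ V) (H : V →ₗ⋆[ℂ] V →ₗ[ℂ] ℂ) (ε : ℤˣ) :
    BddAbove {d : ℕ | ∃ W : Submodule ℂ V, W ≤ K ∧
      (∀ w ∈ W, w ≠ 0 → 0 < (((ε : ℤ) : ℝ)) * (H w w).re) ∧ finrank ℂ W = d} :=
  ⟨finrank ℂ V, by rintro d ⟨W, -, -, rfl⟩; exact W.finrank_le⟩

theorem finrank_le_inertia {K W : Submodule ℂ V} {H : V →ₗ⋆[ℂ] V →ₗ[ℂ] ℂ} {ε : ℤˣ} (hW : W ≤ K)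
    (h : ∀ w ∈ W, w ≠ 0 → 0 < (((ε : ℤ) : ℝ)) * (H w w).re) : finrank ℂ W ≤ inertia K H ε :=
  le_csSup (bddAbove_inertia K H ε) ⟨W, hW, h, rfl⟩

theorem exists_finrank_eq_inertia (K : Submodule ℂ V) (H : V →ₗ⋆[ℂ] V →ₗ[ℂ] ℂ) (ε : ℤˣ) :
    ∃ W : Submodule ℂ V, W ≤ K ∧ (∀ w ∈ W, w ≠ 0 → 0 < (((ε : ℤ) : ℝ)) * (H w w).re) ∧
      finrank ℂ W = inertia K H ε :=
  Nat.sSup_mem (s := {d : ℕ | ∃ W : Submodule ℂ V, W ≤ K ∧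
      (∀ w ∈ W, w ≠ 0 → 0 < (((ε : ℤ) : ℝ)) * (H w w).re) ∧ finrank ℂ W = d})
    ⟨0, ⊥, bot_le, fun w hw h => absurd ((Submodule.mem_bot ℂ).1 hw) h, by simp⟩
    (bddAbove_inertia K H ε)

/-- Orthogonal vectors of sign ε span a definite subspace. Their independence is automatic, since a
nontrivial combination has a nonzero value. -/
theorem card_le_inertia {X : Type*} [Fintype X] {K : Submodule ℂ V}
    {H : V →ₗ⋆[ℂ] V →ₗ[ℂ] ℂ} {ε : ℤˣ} (u : X → V) (hK : ∀ x, u x ∈ K)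
    (h0 : ∀ x y, x ≠ y → H (u x) (u y) = 0) (hpos : ∀ x, 0 < (((ε : ℤ) : ℝ)) * (H (u x) (u x)).re) :
    Fintype.card X ≤ inertia K H ε := by
  have key : ∀ c : X → ℂ, c ≠ 0 →
      0 < (((ε : ℤ) : ℝ)) * (H (∑ x, c x • u x) (∑ x, c x • u x)).re := by
    intro c hc
    obtain ⟨x, hx⟩ := Function.ne_iff.1 hc
    rw [form_sum_self H u h0, Complex.re_sum, Finset.mul_sum]
    have hre : ∀ y, (((ε : ℤ) : ℝ)) * ((Complex.normSq (c y) : ℂ) * H (u y) (u y)).re =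
        Complex.normSq (c y) * ((((ε : ℤ) : ℝ)) * (H (u y) (u y)).re) := by
      intro y
      rw [Complex.re_ofReal_mul]; ring
    refine Finset.sum_pos' (fun y _ => ?_) ⟨x, Finset.mem_univ x, ?_⟩
    · rw [hre]; exact mul_nonneg (Complex.normSq_nonneg _) (hpos y).le
    · rw [hre]; exact mul_pos (Complex.normSq_pos.2 hx) (hpos x)
  have hli : LinearIndependent ℂ u := by
    rw [Fintype.linearIndependent_iff]
    intro c hc
    by_contra! hne
    have := key c (Function.ne_iff.2 hne)
    rw [hc] at this
    simp at this
  rw [← finrank_span_eq_card hli]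
  refine finrank_le_inertia (Submodule.span_le.2 (by rintro _ ⟨x, rfl⟩; exact hK x)) ?_
  intro w hw hw0
  obtain ⟨c, rfl⟩ := (Submodule.mem_span_range_iff_exists_fun ℂ).1 hw
  refine key c ?_
  rintro rfl
  simp at hw0

/-- A positive definite subspace, a subspace Z of the radical and a negative definite subspace are
independent: adding an element of Z does not change values, so no nonzero vector can lie in (W + Z)
∩ W'. -/
theorem inertia_add_inertia_add_finrank_le {K Z : Submodule ℂ V} {H : V →ₗ⋆[ℂ] V →ₗ[ℂ] ℂ}
    (hZ : Z ≤ K) (hl : ∀ z ∈ Z, ∀ w ∈ K, H z w = 0) (hr : ∀ z ∈ Z, ∀ w ∈ K, H w z = 0) :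
    inertia K H 1 + inertia K H (-1) + finrank ℂ Z ≤ finrank ℂ K := by
  obtain ⟨W, hWK, hW, hWd⟩ := exists_finrank_eq_inertia K H 1
  obtain ⟨W', hWK', hW', hWd'⟩ := exists_finrank_eq_inertia K H (-1)
  rw [← hWd, ← hWd']
  have h1 : Disjoint W Z := by
    rw [Submodule.disjoint_def]
    intro x hx hxz
    by_contra h
    have := hW x hx h
    rw [hl x hxz x (hZ hxz)] at this
    simp at this
  have h2 : Disjoint (W ⊔ Z) W' := by
    rw [Submodule.disjoint_def]
    intro x hx hx'
    by_contra h
    have h' := hW' x hx' h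
    obtain ⟨w, hw, z, hz, rfl⟩ := Submodule.mem_sup.1 hx
    have e : H (w + z) (w + z) = H w w := by
      simp [hl z hz w (hWK hw), hr z hz w (hWK hw), hl z hz z (hZ hz)]
    rw [e] at h'
    by_cases hw0 : w = 0
    · simp [hw0] at h'
    · have := hW w hw hw0
      simp at this h'
      linarith
  have e1 := Submodule.finrank_sup_add_finrank_inf_eq W Z
  have e2 := Submodule.finrank_sup_add_finrank_inf_eq (W ⊔ Z) W'
  rw [h1.eq_bot, finrank_bot] at e1
  rw [h2.eq_bot, finrank_bot] at e2
  have e3 : finrank ℂ ↥(W ⊔ Z ⊔ W') ≤ finrank ℂ K :=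
    Submodule.finrank_mono (sup_le (sup_le hWK hZ) hWK')
  omega

/-- Intersecting a definite subspace with U costs at most the codimension of U. On the intersection
φ is injective, because a vector killed by φ has value 0. -/
theorem inertia_top_add_finrank_le {V' : Type*} [AddCommGroup V'] [Module ℂ V']
    [FiniteDimensional ℂ V'] {H : V →ₗ⋆[ℂ] V →ₗ[ℂ] ℂ} {H' : V' →ₗ⋆[ℂ] V' →ₗ[ℂ] ℂ}
    (U : Submodule ℂ V) (φ : V →ₗ[ℂ] V') (h : ∀ x ∈ U, H x x = H' (φ x) (φ x)) (ε : ℤˣ) :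
    inertia ⊤ H ε + finrank ℂ U ≤ inertia ⊤ H' ε + finrank ℂ V := by
  obtain ⟨W, -, hW, hWd⟩ := exists_finrank_eq_inertia ⊤ H ε
  have e := Submodule.finrank_sup_add_finrank_inf_eq W U
  have e' : finrank ℂ ↥(W ⊔ U) ≤ finrank ℂ V := Submodule.finrank_le _
  have hinj : ∀ x ∈ W ⊓ U, φ x = 0 → x = 0 := by
    intro x hx h0
    by_contra hne
    have := hW x hx.1 hne
    rw [h x hx.2, h0] at this
    simp at this
  have e2 : finrank ℂ ↥((W ⊓ U).map φ) = finrank ℂ ↥(W ⊓ U) := by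
    have hi : Function.Injective (φ.domRestrict (W ⊓ U)) := by
      rw [← LinearMap.ker_eq_bot, LinearMap.ker_eq_bot']
      intro x hx
      exact Subtype.ext (hinj x x.2 hx)
    rw [← LinearMap.finrank_range_of_inj hi, LinearMap.range_domRestrict]
  have e3 : finrank ℂ ↥((W ⊓ U).map φ) ≤ inertia ⊤ H' ε := by
    refine finrank_le_inertia le_top ?_
    rintro _ ⟨x, hx, rfl⟩ hne
    rw [← h x hx.2]
    exact hW x hx.1 (by rintro rfl; simp at hne)
  omega

theorem inertia_congr {V' : Type*} [AddCommGroup V'] [Module ℂ V'] [FiniteDimensional ℂ V']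
    {H : V →ₗ⋆[ℂ] V →ₗ[ℂ] ℂ} {H' : V' →ₗ⋆[ℂ] V' →ₗ[ℂ] ℂ} (g : V ≃ₗ[ℂ] V')
    (h : ∀ x, H x x = H' (g x) (g x)) (ε : ℤˣ) : inertia ⊤ H ε = inertia ⊤ H' ε := by
  have e := g.finrank_eq
  have h1 := inertia_top_add_finrank_le (H := H) (H' := H') ⊤ g.toLinearMap (fun x _ => h x) ε
  have h2 := inertia_top_add_finrank_le (H := H') (H' := H) ⊤ g.symm.toLinearMap
    (fun x _ => by simp [h]) ε
  rw [finrank_top] at h1 h2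
  omega

end Inertia

/-! ### Jordan families of nilpotent self-adjoint endomorphisms -/

section Jordan

variable {V : Type*} [AddCommGroup V] [Module ℂ V]

/-- A family of generators of mutually orthogonal Jordan strings for `N`, each spanning a
nondegenerate subspace; the string of `vec i` has length `len i` and sign `sgn i`. -/
structure JordanFamily (B : V →ₗ⋆[ℂ] V →ₗ[ℂ] ℂ) (N : Module.End ℂ V) (ι : Type*) where
  len : ι → ℕ
  sgn : ι → ℤˣ
  vec : ι → V
  len_pos : ∀ i, 0 < len i
  pairing_self : ∀ i a, B (vec i) ((N ^ a) (vec i)) = if a + 1 = len i then ((sgn i : ℤ) : ℂ) else 0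
  pairing_ne : ∀ i j, i ≠ j → ∀ a, B (vec i) ((N ^ a) (vec j)) = 0

theorem form_pow_apply {B : V →ₗ⋆[ℂ] V →ₗ[ℂ] ℂ} {N : Module.End ℂ V}
    (hN : ∀ x y, B (N x) y = B x (N y)) (a : ℕ) (x y : V) :
    B ((N ^ a) x) y = B x ((N ^ a) y) := by
  induction a generalizing x y with
  | zero => simp
  | succ a ih => rw [pow_succ, Module.End.mul_apply, ih, hN, ← Module.End.mul_apply, ← pow_succ']; rfl

theorem card_le_finrank_of_mem [FiniteDimensional ℂ V] {X : Type*} [Fintype X] {u : X → V}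
    (hu : LinearIndependent ℂ u) {U : Submodule ℂ V} (hU : ∀ x, u x ∈ U) :
    Fintype.card X ≤ finrank ℂ U := by
  rw [← finrank_span_eq_card hu]
  exact Submodule.finrank_mono (Submodule.span_le.2 (by rintro _ ⟨x, rfl⟩; exact hU x))

theorem unit_mul_self_complex (ε : ℤˣ) : ((ε : ℤ) : ℂ) * ((ε : ℤ) : ℂ) = 1 := by
  rcases Int.units_eq_one_or ε with rfl | rfl <;> simp

theorem unit_mul_self_real (ε : ℤˣ) : ((ε : ℤ) : ℝ) * ((ε : ℤ) : ℝ) = 1 := by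
  rcases Int.units_eq_one_or ε with rfl | rfl <;> simp

/-- The kernel of N^k lies in the radical of the k-th power form, so only the rank is left for the
two indices. -/
theorem inertia_add_inertia_le_finrank_range [FiniteDimensional ℂ V]
    {B : V →ₗ⋆[ℂ] V →ₗ[ℂ] ℂ} {N : Module.End ℂ V} (hN : ∀ x y, B (N x) y = B x (N y)) (k : ℕ) :
    inertia ⊤ (B.compl₂ (N ^ k)) 1 + inertia ⊤ (B.compl₂ (N ^ k)) (-1) ≤
      finrank ℂ (LinearMap.range (N ^ k)) := by
  have h := inertia_add_inertia_add_finrank_le (K := ⊤) (Z := LinearMap.ker (N ^ k))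
    (H := B.compl₂ (N ^ k)) le_top
    (fun z hz w _ => by
      rw [LinearMap.compl₂_apply, ← form_pow_apply hN, LinearMap.mem_ker.1 hz]; simp)
    (fun z hz w _ => by rw [LinearMap.compl₂_apply, LinearMap.mem_ker.1 hz]; simp)
  have h3 := LinearMap.finrank_range_add_finrank_ker (N ^ k)
  rw [finrank_top] at h
  omega

/-- The multiplicity with which a Jordan string of length `l` and sign `ε` contributes to the
`δ`-index of inertia of the `k`-th power form: the number of signs `δ` in a row of length `l - k`
with first sign `ε`. -/
def stringIndex (l : ℕ) (ε δ : ℤˣ) (k : ℕ) : ℕ := ((l - k) + if ε = δ then 1 else 0) / 2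

theorem stringIndex_one_add_neg_one (l : ℕ) (ε : ℤˣ) (k : ℕ) :
    stringIndex l ε 1 k + stringIndex l ε (-1) k = l - k := by
  rcases Int.units_eq_one_or ε with rfl | rfl <;> simp [stringIndex] <;> omega

/-- Inversion formula: summed over a Jordan family, the differences `l - (k + 1)` and `l - (k + 2)`
become ranks of powers and the last term becomes a row count, so indices of inertia recover the
tableau. -/
theorem stringIndex_recovers (l : ℕ) (ε δ : ℤˣ) (k : ℕ) :
    stringIndex l ε δ k + (l - (k + 2)) =
      stringIndex l ε δ (k + 2) + (l - (k + 1)) + if l = k + 1 ∧ ε = δ then 1 else 0 := by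
  unfold stringIndex
  split_ifs <;> first | omega | (simp_all; done) | (simp_all; omega)

namespace JordanFamily

variable {B : V →ₗ⋆[ℂ] V →ₗ[ℂ] ℂ} {N : Module.End ℂ V} {ι : Type*} (J : JordanFamily B N ι)

/-- The union of the Jordan strings. -/
def string (x : Σ i, Fin (J.len i)) : V := (N ^ (x.2 : ℕ)) (J.vec x.1)

variable (hN : ∀ x y, B (N x) y = B x (N y))
include hN

theorem pairing_pow_self (i : ι) (a b : ℕ) :
    B ((N ^ a) (J.vec i)) ((N ^ b) (J.vec i)) =
      if a + b + 1 = J.len i then ((J.sgn i : ℤ) : ℂ) else 0 := by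
  rw [form_pow_apply hN, ← Module.End.mul_apply, ← pow_add, J.pairing_self]

theorem pairing_pow_ne {i j : ι} (h : i ≠ j) (a b : ℕ) :
    B ((N ^ a) (J.vec i)) ((N ^ b) (J.vec j)) = 0 := by
  rw [form_pow_apply hN, ← Module.End.mul_apply, ← pow_add, J.pairing_ne i j h]

/-- Up to the sign of the string, pairing with N^(len - 1 - a) v is the functional dual to N^a v. -/
theorem linearIndependent_string : LinearIndependent ℂ J.string := by
  refine LinearIndependent.of_pairwise_dual_eq_zero_one _
    (fun x => ((J.sgn x.1 : ℤ) : ℂ) • B ((N ^ (J.len x.1 - 1 - (x.2 : ℕ))) (J.vec x.1))) ?_ ?_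
  · rintro ⟨i, a⟩ ⟨j, b⟩ h
    simp only [string, LinearMap.smul_apply, smul_eq_mul]
    by_cases hij : i = j
    · subst hij
      rw [J.pairing_pow_self hN, if_neg, mul_zero]
      intro h'
      have ha := a.2
      exact h (by rw [show a = b from Fin.ext (by omega)])
    · rw [J.pairing_pow_ne hN hij, mul_zero]
  · rintro ⟨i, a⟩
    simp only [string, LinearMap.smul_apply, smul_eq_mul]
    rw [J.pairing_pow_self hN, if_pos, unit_mul_self_complex]
    have ha := a.2
    omega

variable [FiniteDimensional ℂ V] [Fintype ι]

theorem sum_len_le : ∑ i, J.len i ≤ finrank ℂ V := by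
  have := (J.linearIndependent_string hN).fintype_card_le_finrank
  simpa using this

/-- On a string of length l generated by v, the k-th power form pairs N^a v with N^(l-1-k-a) v only.
Each such hyperbolic pair supplies one vector of each sign; a self-paired middle vector has the sign
of the string. -/
theorem sum_stringIndex_le_inertia (δ : ℤˣ) (k : ℕ) :
    ∑ i, stringIndex (J.len i) (J.sgn i) δ k ≤ inertia ⊤ (B.compl₂ (N ^ k)) δ := by
  -- The coefficient δ · sgn makes the value of the pair 2δ. For a middle vector sgn = δ, both
  -- summands agree and the value is 4δ.
  let u : (Σ i, Fin (stringIndex (J.len i) (J.sgn i) δ k)) → V := fun x =>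
    (N ^ (x.2 : ℕ)) (J.vec x.1) +
      (((δ * J.sgn x.1 : ℤˣ) : ℤ) : ℂ) • (N ^ (J.len x.1 - 1 - k - (x.2 : ℕ))) (J.vec x.1)
  have hbound : ∀ i (a : Fin (stringIndex (J.len i) (J.sgn i) δ k)),
      2 * (a : ℕ) + k + 1 ≤ J.len i ∧ (2 * (a : ℕ) + k + 1 = J.len i → J.sgn i = δ) := by
    rintro i ⟨a, ha⟩
    change 2 * a + k + 1 ≤ J.len i ∧ (2 * a + k + 1 = J.len i → J.sgn i = δ)
    unfold stringIndex at ha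
    split_ifs at ha with hs
    · exact ⟨by omega, fun _ => hs⟩
    · exact ⟨by omega, fun h => by omega⟩
  have h := card_le_inertia (K := ⊤) (H := B.compl₂ (N ^ k)) (ε := δ) u (fun _ => trivial) ?_ ?_
  · simpa using h
  · rintro ⟨i, a⟩ ⟨j, b⟩ h
    by_cases hij : i = j
    · subst hij
      have ha := (hbound i a).1
      have hb := (hbound i b).1
      have hab : (a : ℕ) ≠ b := fun hab => h (by rw [Fin.ext hab])
      simp only [u, LinearMap.compl₂_apply, map_add, map_smul, LinearMap.add_apply,
        LinearMap.map_smulₛₗ, LinearMap.smul_apply, smul_eq_mul]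
      simp only [← Module.End.mul_apply, ← pow_add]
      rw [J.pairing_pow_self hN, J.pairing_pow_self hN, J.pairing_pow_self hN,
        J.pairing_pow_self hN, if_neg, if_neg, if_neg, if_neg]
      · simp
      all_goals omega
    · simp only [u, LinearMap.compl₂_apply, map_add, map_smul, LinearMap.add_apply,
        LinearMap.map_smulₛₗ, LinearMap.smul_apply, smul_eq_mul]
      simp only [← Module.End.mul_apply, ← pow_add]
      simp only [J.pairing_pow_ne hN hij]
      simp
  · rintro ⟨i, a⟩
    obtain ⟨ha, hs⟩ := hbound i a
    simp only [u, LinearMap.compl₂_apply, map_add, map_smul, LinearMap.add_apply,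
      LinearMap.map_smulₛₗ, LinearMap.smul_apply, smul_eq_mul]
    simp only [← Module.End.mul_apply, ← pow_add]
    rw [J.pairing_pow_self hN, J.pairing_pow_self hN, J.pairing_pow_self hN,
      J.pairing_pow_self hN]
    by_cases h2 : 2 * (a : ℕ) + k + 1 = J.len i
    · rw [if_pos (by omega), if_pos (by omega), if_pos (by omega), if_pos (by omega), hs h2]
      rcases Int.units_eq_one_or δ with rfl | rfl <;> norm_num
    · rw [if_neg (by omega), if_pos (by omega), if_pos (by omega), if_neg (by omega)]
      rcases Int.units_eq_one_or δ with rfl | rfl <;>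
        rcases Int.units_eq_one_or (J.sgn i) with h | h <;> rw [h] <;> norm_num

variable (hJ : ∑ i, J.len i = finrank ℂ V)
include hJ

/-- The basis given by the union of the Jordan strings. -/
def basis : Basis (Σ i, Fin (J.len i)) ℂ V :=
  basisOfLinearIndependentOfCardEqFinrank' J.string (J.linearIndependent_string hN)
    (by simpa using hJ)

theorem basis_apply (x : Σ i, Fin (J.len i)) :
    J.basis hN hJ x = (N ^ (x.2 : ℕ)) (J.vec x.1) := by
  simp [basis, string]

variable (hB : B.Nondegenerate)
include hB

theorem eq_zero_of_pairing {y : V} (h : ∀ i a, B ((N ^ a) (J.vec i)) y = 0) : y = 0 := by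
  refine hB.2 y fun x => ?_
  have : B.flip y = 0 := (J.basis hN hJ).ext fun x => by
    rw [basis_apply]; exact h _ _
  exact LinearMap.congr_fun this x

/-- The strings span V, and N^a v has zero pairing with all of them once a reaches the length;
nondegeneracy then gives the vanishing. -/
theorem pow_vec_eq_zero (i : ι) {a : ℕ} (h : J.len i ≤ a) : (N ^ a) (J.vec i) = 0 := by
  refine J.eq_zero_of_pairing hN hJ hB fun j b => ?_
  by_cases hij : j = i
  · subst hij
    rw [J.pairing_pow_self hN, if_neg]
    omega
  · exact J.pairing_pow_ne hN hij b a

/-- The string basis puts enough independent vectors into the range and into the kernel that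
rank-nullity forces equality in both counts. -/
theorem finrank_range_pow (k : ℕ) :
    finrank ℂ (LinearMap.range (N ^ k)) = ∑ i, (J.len i - k) := by
  have h1 : ∑ i, (J.len i - k) ≤ finrank ℂ (LinearMap.range (N ^ k)) := by
    let φ : (Σ i, Fin (J.len i - k)) → Σ i, Fin (J.len i) := fun x => ⟨x.1, k + x.2, by omega⟩
    have hφ : Function.Injective φ := by
      rintro ⟨i, a⟩ ⟨j, b⟩ h
      simp only [φ, Sigma.mk.injEq] at h
      obtain ⟨rfl, h⟩ := h
      simp only [heq_eq_eq, Fin.mk.injEq] at h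
      rw [show a = b from Fin.ext (by omega)]
    have := card_le_finrank_of_mem ((J.linearIndependent_string hN).comp φ hφ)
      (U := LinearMap.range (N ^ k)) (by
        rintro ⟨i, a⟩
        exact ⟨(N ^ (a : ℕ)) (J.vec i), by simp [φ, string, pow_add]⟩)
    simpa using this
  have h2 : ∑ i, min k (J.len i) ≤ finrank ℂ (LinearMap.ker (N ^ k)) := by
    let φ : (Σ i, Fin (min k (J.len i))) → Σ i, Fin (J.len i) :=
      fun x => ⟨x.1, J.len x.1 - 1 - x.2, by have := x.2.2; omega⟩
    have hφ : Function.Injective φ := by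
      rintro ⟨i, a⟩ ⟨j, b⟩ h
      simp only [φ, Sigma.mk.injEq] at h
      obtain ⟨rfl, h⟩ := h
      simp only [heq_eq_eq, Fin.mk.injEq] at h
      have := a.2
      have := b.2
      rw [show a = b from Fin.ext (by omega)]
    have := card_le_finrank_of_mem ((J.linearIndependent_string hN).comp φ hφ)
      (U := LinearMap.ker (N ^ k)) (by
        rintro ⟨i, a⟩
        simp only [φ, string, Function.comp_apply, LinearMap.mem_ker]
        rw [← Module.End.mul_apply, ← pow_add]
        exact J.pow_vec_eq_zero hN hJ hB i (by have := a.2; omega))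
    simpa using this
  have h3 := LinearMap.finrank_range_add_finrank_ker (N ^ k)
  have h4 : ∑ i, (J.len i - k) + ∑ i, min k (J.len i) = ∑ i, J.len i := by
    rw [← Finset.sum_add_distrib]
    exact Finset.sum_congr rfl fun i _ => by omega
  omega

/-- The lower bounds for the two signs already add up to the rank, which bounds the sum of the
indices from above. -/
theorem inertia_pow (δ : ℤˣ) (k : ℕ) :
    inertia ⊤ (B.compl₂ (N ^ k)) δ = ∑ i, stringIndex (J.len i) (J.sgn i) δ k := by
  have h1 := J.sum_stringIndex_le_inertia hN 1 k
  have h2 := J.sum_stringIndex_le_inertia hN (-1) k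
  have h3 := inertia_add_inertia_le_finrank_range hN k
  have h4 : ∑ i, stringIndex (J.len i) (J.sgn i) 1 k + ∑ i, stringIndex (J.len i) (J.sgn i) (-1) k =
      ∑ i, (J.len i - k) := by
    rw [← Finset.sum_add_distrib]
    exact Finset.sum_congr rfl fun i _ => stringIndex_one_add_neg_one _ _ _
  rw [J.finrank_range_pow hN hJ hB] at h3
  rcases Int.units_eq_one_or δ with rfl | rfl <;> omega

theorem inertia_add_inertia_pow (k : ℕ) :
    inertia ⊤ (B.compl₂ (N ^ k)) 1 + inertia ⊤ (B.compl₂ (N ^ k)) (-1) =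
      finrank ℂ (LinearMap.range (N ^ k)) := by
  rw [J.inertia_pow hN hJ hB, J.inertia_pow hN hJ hB, J.finrank_range_pow hN hJ hB,
    ← Finset.sum_add_distrib]
  exact Finset.sum_congr rfl fun i _ => stringIndex_one_add_neg_one _ _ _

/-- Another squeeze: generators of length r + 1 bound each index from below, and the radical ker N^r
+ (ker N^(r+1) ∩ range N) leaves no room for more. -/
theorem inertia_ker_pow (δ : ℤˣ) (r : ℕ) :
    inertia (LinearMap.ker (N ^ (r + 1))) (B.compl₂ (N ^ r)) δ =
      ∑ i, if J.len i = r + 1 ∧ J.sgn i = δ then 1 else 0 := by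
  classical
  have low : ∀ δ : ℤˣ, ∑ i, (if J.len i = r + 1 ∧ J.sgn i = δ then 1 else 0) ≤
      inertia (LinearMap.ker (N ^ (r + 1))) (B.compl₂ (N ^ r)) δ := by
    intro δ
    have h := card_le_inertia (K := LinearMap.ker (N ^ (r + 1))) (H := B.compl₂ (N ^ r)) (ε := δ)
      (fun i : {i // J.len i = r + 1 ∧ J.sgn i = δ} => J.vec i)
      (fun i => J.pow_vec_eq_zero hN hJ hB _ i.2.1.le)
      (fun i j hij => J.pairing_ne _ _ (fun h => hij (Subtype.ext h)) _)
      (fun i => by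
        rw [LinearMap.compl₂_apply, J.pairing_self, if_pos i.2.1.symm, i.2.2]
        have := unit_mul_self_real δ
        simp [this])
    rw [Fintype.card_subtype] at h
    simpa using h
  -- The last min(len, r + 1) vectors of a string lie in ker N^(r+1); all of them are in the radical
  -- except the generator of a string of length exactly r + 1.
  have h2 : ∑ i, (min (J.len i) (r + 1) - if J.len i = r + 1 then 1 else 0) ≤
      finrank ℂ ↥((LinearMap.ker (N ^ r)) ⊔ (LinearMap.ker (N ^ (r + 1)) ⊓ LinearMap.range N)) := by
    let φ : (Σ i, Fin (min (J.len i) (r + 1) - if J.len i = r + 1 then 1 else 0)) →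
        Σ i, Fin (J.len i) :=
      fun x => ⟨x.1, J.len x.1 - 1 - x.2, by have := x.2.2; omega⟩
    have hφ : Function.Injective φ := by
      rintro ⟨i, a⟩ ⟨j, b⟩ h
      simp only [φ, Sigma.mk.injEq] at h
      obtain ⟨rfl, h⟩ := h
      simp only [heq_eq_eq, Fin.mk.injEq] at h
      have := a.2
      have := b.2
      rw [show a = b from Fin.ext (by omega)]
    have := card_le_finrank_of_mem ((J.linearIndependent_string hN).comp φ hφ)
      (U := (LinearMap.ker (N ^ r)) ⊔ (LinearMap.ker (N ^ (r + 1)) ⊓ LinearMap.range N)) (by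
        rintro ⟨i, a, ha⟩
        simp only [φ, string, Function.comp_apply]
        by_cases hl : J.len i ≤ r
        · refine Submodule.mem_sup_left (LinearMap.mem_ker.2 ?_)
          rw [← Module.End.mul_apply, ← pow_add]
          exact J.pow_vec_eq_zero hN hJ hB i (by omega)
        · have : a + 1 < J.len i ∧ J.len i ≤ r + 1 + (J.len i - 1 - a) := by
            split_ifs at ha <;> omega
          refine Submodule.mem_sup_right ⟨LinearMap.mem_ker.2 ?_, ?_⟩
          · rw [← Module.End.mul_apply, ← pow_add]
            exact J.pow_vec_eq_zero hN hJ hB i (by omega)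
          · refine ⟨(N ^ (J.len i - 1 - a - 1)) (J.vec i), ?_⟩
            rw [← Module.End.mul_apply, ← pow_succ']
            congr 2
            omega)
    simpa using this
  have hker : LinearMap.ker (N ^ r) ≤ LinearMap.ker (N ^ (r + 1)) := fun x hx => by
    rw [LinearMap.mem_ker, pow_succ', Module.End.mul_apply, LinearMap.mem_ker.1 hx, map_zero]
  have hrad : ∀ z ∈ (LinearMap.ker (N ^ r)) ⊔ (LinearMap.ker (N ^ (r + 1)) ⊓ LinearMap.range N),
      ∀ w ∈ LinearMap.ker (N ^ (r + 1)), B z ((N ^ r) w) = 0 := by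
    intro z hz w hw
    obtain ⟨x, hx, _, ⟨-, y, rfl⟩, rfl⟩ := Submodule.mem_sup.1 hz
    rw [map_add, LinearMap.add_apply, ← form_pow_apply hN, LinearMap.mem_ker.1 hx, hN,
      ← Module.End.mul_apply, ← pow_succ', LinearMap.mem_ker.1 hw]
    simp
  have hrad' : ∀ z ∈ (LinearMap.ker (N ^ r)) ⊔ (LinearMap.ker (N ^ (r + 1)) ⊓ LinearMap.range N),
      ∀ w ∈ LinearMap.ker (N ^ (r + 1)), B w ((N ^ r) z) = 0 := by
    intro z hz w hw
    obtain ⟨x, hx, _, ⟨-, y, rfl⟩, rfl⟩ := Submodule.mem_sup.1 hz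
    rw [map_add, map_add, LinearMap.mem_ker.1 hx, ← Module.End.mul_apply, ← pow_succ,
      ← form_pow_apply hN, LinearMap.mem_ker.1 hw]
    simp
  have up := inertia_add_inertia_add_finrank_le (H := B.compl₂ (N ^ r))
    (sup_le hker inf_le_left) hrad hrad'
  have h3 := LinearMap.finrank_range_add_finrank_ker (N ^ (r + 1))
  rw [J.finrank_range_pow hN hJ hB, ← hJ] at h3
  have h4 : ∑ i, (J.len i - (r + 1)) +
      (∑ i, (min (J.len i) (r + 1) - if J.len i = r + 1 then 1 else 0) +
        (∑ i, (if J.len i = r + 1 ∧ J.sgn i = 1 then 1 else 0) +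
          ∑ i, (if J.len i = r + 1 ∧ J.sgn i = -1 then 1 else 0))) = ∑ i, J.len i := by
    simp only [← Finset.sum_add_distrib]
    refine Finset.sum_congr rfl fun i _ => ?_
    rcases Int.units_eq_one_or (J.sgn i) with h | h <;> by_cases hl : J.len i = r + 1 <;>
      simp [h, hl]
  have l1 := low 1
  have l2 := low (-1)
  rcases Int.units_eq_one_or δ with rfl | rfl <;> omega

end JordanFamily
end Jordan

/-! ### Existence of orthogonal Jordan decompositions -/

section JordanExistence

variable {V : Type*} [AddCommGroup V] [Module ℂ V] {B : V →ₗ⋆[ℂ] V →ₗ[ℂ] ℂ} {N : Module.End ℂ V}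

theorem exists_self_pairing_ne_zero (hS : B.IsSymm) (hN : ∀ x y, B (N x) y = B x (N y))
    {U : Submodule ℂ V} {m : ℕ} {x y : V} (hx : x ∈ U) (hy : y ∈ U)
    (hxy : B y ((N ^ m) x) ≠ 0) :
    ∃ u ∈ U, ∃ ε : ℤˣ, B u ((N ^ m) u) = ((ε : ℤ) : ℂ) := by
  obtain ⟨u, hu, hne⟩ : ∃ u ∈ U, B u ((N ^ m) u) ≠ 0 := by
    by_contra! h
    -- Polarization: the values at y + x and y + ix recover the pairing of y with N^m x.
    have h1 := h _ (U.add_mem hy hx)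
    have h2 := h _ (U.add_mem hy (U.smul_mem Complex.I hx))
    simp only [map_add, map_smul, LinearMap.add_apply, LinearMap.map_smulₛₗ,
      LinearMap.smul_apply, smul_eq_mul, Complex.conj_I, h x hx, h y hy] at h1 h2
    apply hxy
    linear_combination (1 / 2 : ℂ) * h1 + (-Complex.I / 2) * h2 +
      (B y ((N ^ m) x) - B x ((N ^ m) y)) / 2 * Complex.I_sq
  -- The value is real because N^m is self-adjoint, so scaling u by |r|^(-1/2) makes it ±1.
  have hreal : (starRingEnd ℂ) (B u ((N ^ m) u)) = B u ((N ^ m) u) := by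
    have := hS.eq u ((N ^ m) u)
    rw [form_pow_apply hN] at this
    exact this
  obtain ⟨r, hr⟩ := Complex.conj_eq_iff_real.1 hreal
  have hr0 : r ≠ 0 := by rintro rfl; simp [hr] at hne
  have hs : 0 < √|r| := Real.sqrt_pos.2 (abs_pos.2 hr0)
  have hss : √|r| * √|r| = |r| := Real.mul_self_sqrt (abs_nonneg r)
  refine ⟨((√|r|)⁻¹ : ℂ) • u, U.smul_mem _ hu, if 0 < r then 1 else -1, ?_⟩
  simp only [map_smul, LinearMap.map_smulₛₗ, LinearMap.smul_apply, smul_eq_mul, hr, map_inv₀,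
    Complex.conj_ofReal]
  split_ifs with h
  · rw [abs_of_pos h] at hs hss ⊢
    have : ((√r : ℝ) : ℂ) ≠ 0 := by exact_mod_cast hs.ne'
    field_simp
    norm_cast
    rw [sq, hss]; simp
  · have h' : r < 0 := lt_of_le_of_ne (not_lt.1 h) hr0
    rw [abs_of_neg h'] at hs hss ⊢
    have : ((√(-r) : ℝ) : ℂ) ≠ 0 := by exact_mod_cast hs.ne'
    field_simp
    norm_cast
    rw [sq, hss]; simp

/-- The lower pairings B(v, N^a v) are removed from a = m - 1 downwards by replacing v with v + t
N^(s+1) v. As N^(m+1) = 0 on U, this leaves the top pairing and those already removed unchanged. -/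
theorem exists_normalized_generator (hS : B.IsSymm) (hN : ∀ x y, B (N x) y = B x (N y))
    {U : Submodule ℂ V} (hUN : ∀ x ∈ U, N x ∈ U) {m : ℕ} (hm : ∀ x ∈ U, (N ^ (m + 1)) x = 0)
    {u : V} (hu : u ∈ U) {ε : ℤˣ} (hε : B u ((N ^ m) u) = ((ε : ℤ) : ℂ)) :
    ∃ v ∈ U, ∀ a, B v ((N ^ a) v) = if a + 1 = m + 1 then ((ε : ℤ) : ℂ) else 0 := by
  have hUN' : ∀ a, ∀ x ∈ U, (N ^ a) x ∈ U := by
    intro a x hx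
    induction a with
    | zero => simpa
    | succ a ih => rw [pow_succ', Module.End.mul_apply]; exact hUN _ ih
  have hz : ∀ a, m < a → ∀ x ∈ U, (N ^ a) x = 0 := by
    intro a ha x hx
    obtain ⟨c, rfl⟩ := Nat.exists_eq_add_of_le ha
    rw [show m.succ + c = m + 1 + c from rfl, pow_add, Module.End.mul_apply, hm _ (hUN' c x hx)]
  have main : ∀ s, s ≤ m → ∃ v ∈ U, B v ((N ^ m) v) = ((ε : ℤ) : ℂ) ∧
      ∀ a, a < m → m - s ≤ a → B v ((N ^ a) v) = 0 := by
    intro s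
    induction s with
    | zero => exact fun _ => ⟨u, hu, hε, fun a h h' => by omega⟩
    | succ s ih =>
      intro hs
      obtain ⟨v, hv, h1, h2⟩ := ih (by omega)
      have hreal : (starRingEnd ℂ) (B v ((N ^ (m - s - 1)) v)) = B v ((N ^ (m - s - 1)) v) := by
        have := hS.eq v ((N ^ (m - s - 1)) v)
        rwa [form_pow_apply hN] at this
      obtain ⟨c, hc⟩ := Complex.conj_eq_iff_real.1 hreal
      -- The new pairing at level m - s - 1 is c + 2tε, which vanishes for t = -cε/2.
      let t : ℂ := ((-(c * ((ε : ℤ) : ℝ) / 2) : ℝ) : ℂ)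
      have ht : (starRingEnd ℂ) t = t := Complex.conj_ofReal _
      have expand : ∀ a, B (v + t • (N ^ (s + 1)) v) ((N ^ a) (v + t • (N ^ (s + 1)) v)) =
          B v ((N ^ a) v) + 2 * t * B v ((N ^ (a + (s + 1))) v) +
            t * t * B v ((N ^ (a + (s + 1) + (s + 1))) v) := by
        intro a
        simp only [map_add, map_smul, LinearMap.map_smulₛₗ, LinearMap.smul_apply, smul_eq_mul,
          LinearMap.add_apply, ht, form_pow_apply hN]
        simp only [← Module.End.mul_apply, ← pow_add]
        rw [add_comm (s + 1) a, show s + 1 + (a + (s + 1)) = a + (s + 1) + (s + 1) by omega]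
        ring
      refine ⟨v + t • (N ^ (s + 1)) v, U.add_mem hv (U.smul_mem _ (hUN' _ _ hv)), ?_, ?_⟩
      · rw [expand, hz (m + (s + 1)) (by omega) v hv, hz (m + (s + 1) + (s + 1)) (by omega) v hv, h1]
        simp
      · intro a ha hsa
        rw [expand]
        by_cases h : m - s ≤ a
        · rw [hz (a + (s + 1)) (by omega) v hv, hz (a + (s + 1) + (s + 1)) (by omega) v hv, h2 a ha h]
          simp
        · have ha' : a = m - s - 1 := by omega
          subst ha'
          rw [hz (m - s - 1 + (s + 1) + (s + 1)) (by omega) v hv,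
            show m - s - 1 + (s + 1) = m by omega, h1, hc]
          simp only [t, map_zero, mul_zero, add_zero]
          push_cast
          linear_combination (-(c : ℂ)) * unit_mul_self_complex ε
  obtain ⟨v, hv, h1, h2⟩ := main m le_rfl
  refine ⟨v, hv, fun a => ?_⟩
  split_ifs with h
  · rw [show a = m by omega, h1]
  · rcases lt_or_ge a m with h' | h'
    · exact h2 a h' (by omega)
    · rw [hz a (by omega) v hv, map_zero]

namespace JordanFamily

variable {ι : Type*} (J : JordanFamily B N ι) [FiniteDimensional ℂ V] [Fintype ι]

/-- Add a new generator to a Jordan family. -/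
def cons {W : Type*} [AddCommGroup W] [Module ℂ W] {B : W →ₗ⋆[ℂ] W →ₗ[ℂ] ℂ} {N : Module.End ℂ W}
    (J : JordanFamily B N ι) (v : W) (l : ℕ) (ε : ℤˣ) (hl : 0 < l)
    (hv : ∀ a, B v ((N ^ a) v) = if a + 1 = l then ((ε : ℤ) : ℂ) else 0)
    (h1 : ∀ i a, B v ((N ^ a) (J.vec i)) = 0) (h2 : ∀ i a, B (J.vec i) ((N ^ a) v) = 0) :
    JordanFamily B N (Option ι) where
  len i := i.elim l J.len
  sgn i := i.elim ε J.sgn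
  vec i := i.elim v J.vec
  len_pos i := by cases i <;> simp [hl, J.len_pos]
  pairing_self i a := by
    cases i
    · exact hv a
    · exact J.pairing_self _ a
  pairing_ne i j hij a := by
    cases i <;> cases j
    · exact absurd rfl hij
    · exact h1 _ a
    · exact h2 _ a
    · exact J.pairing_ne _ _ (fun h => hij (by rw [h])) a

/-- The strings span a nondegenerate N-stable subspace, so its orthogonal complement U is N-stable
and nonzero and carries a nondegenerate form. A vector of U on which the highest surviving power of
N pairs nontrivially with itself generates the next string. -/
theorem exists_extension (hS : B.IsSymm) (hB : B.Nondegenerate)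
    (hN : ∀ x y, B (N x) y = B x (N y)) (hnil : IsNilpotent N)
    (hz : ∀ i, (N ^ J.len i) (J.vec i) = 0) (hlt : ∑ i, J.len i < finrank ℂ V) :
    ∃ J' : JordanFamily B N (Option ι), (∀ i, (N ^ J'.len i) (J'.vec i) = 0) ∧
      ∑ i, J.len i < ∑ i, J'.len i := by
  classical
  let Φ : V →ₗ[ℂ] ((Σ i, Fin (J.len i)) → ℂ) := LinearMap.pi fun x => B (J.string x)
  have hz' : ∀ i a, J.len i ≤ a → (N ^ a) (J.vec i) = 0 := by
    intro i a h
    obtain ⟨c, rfl⟩ := Nat.exists_eq_add_of_le h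
    rw [add_comm, pow_add, Module.End.mul_apply, hz, map_zero]
  have hU : ∀ x, x ∈ LinearMap.ker Φ ↔ ∀ i a, B ((N ^ a) (J.vec i)) x = 0 := by
    intro x
    rw [LinearMap.mem_ker, funext_iff]
    constructor
    · intro h i a
      rcases lt_or_ge a (J.len i) with ha | ha
      · exact h ⟨i, a, ha⟩
      · rw [hz' i a ha]; simp
    · exact fun h x => h x.1 x.2
  have hUN : ∀ x ∈ LinearMap.ker Φ, N x ∈ LinearMap.ker Φ := by
    intro x hx
    rw [hU] at hx ⊢
    intro i a
    rw [← hN, ← Module.End.mul_apply, ← pow_succ']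
    exact hx i (a + 1)
  have hne : LinearMap.ker Φ ≠ ⊥ := by
    intro h
    have h1 := LinearMap.finrank_range_add_finrank_ker Φ
    have h2 : finrank ℂ (LinearMap.range Φ) ≤ ∑ i, J.len i := by
      simpa using Submodule.finrank_le (LinearMap.range Φ)
    rw [h, finrank_bot] at h1
    omega
  obtain ⟨x₀, hx₀, hx₀ne⟩ := Submodule.exists_mem_ne_zero_of_ne_bot hne
  obtain ⟨m, ⟨x, hx, hxm⟩, hm⟩ : ∃ m, (∃ x ∈ LinearMap.ker Φ, (N ^ m) x ≠ 0) ∧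
      ∀ x ∈ LinearMap.ker Φ, (N ^ (m + 1)) x = 0 := by
    have hex : ∃ k, ∀ x ∈ LinearMap.ker Φ, (N ^ k) x = 0 := by
      obtain ⟨k, hk⟩ := hnil
      exact ⟨k, fun x _ => by simp [hk]⟩
    have h0 : Nat.find hex ≠ 0 := fun h => hx₀ne (by
      have := Nat.find_spec hex x₀ hx₀
      rwa [h, pow_zero] at this)
    obtain ⟨m, hm⟩ := Nat.exists_eq_succ_of_ne_zero h0
    refine ⟨m, ?_, fun x hx => ?_⟩
    · have := Nat.find_min hex (show m < Nat.find hex by omega)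
      push Not at this
      exact this
    · rw [← Nat.succ_eq_add_one, ← hm]
      exact Nat.find_spec hex x hx
  have hxmU : (N ^ m) x ∈ LinearMap.ker Φ := by
    rw [hU] at hx ⊢
    intro i a
    rw [← form_pow_apply hN, ← Module.End.mul_apply, ← pow_add]
    exact hx _ _
  obtain ⟨y, hy⟩ : ∃ y, B y ((N ^ m) x) ≠ 0 := by
    by_contra! h
    exact hxm (hB.2 _ h)
  -- The component of y along the strings, expanded with the dual strings; subtracting it moves y
  -- into U without changing its pairing with N^m x.
  let w : V := ∑ z : (Σ i, Fin (J.len i)),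
    (((J.sgn z.1 : ℤ) : ℂ) * B ((N ^ (J.len z.1 - 1 - (z.2 : ℕ))) (J.vec z.1)) y) • J.string z
  have hyw : y - w ∈ LinearMap.ker Φ := by
    rw [LinearMap.mem_ker]
    funext ⟨j, b⟩
    have hb := b.2
    change B ((N ^ (b : ℕ)) (J.vec j)) (y - w) = 0
    simp only [w, map_sub, map_sum, map_smul, smul_eq_mul]
    rw [Finset.sum_eq_single ⟨j, ⟨J.len j - 1 - b, by omega⟩⟩]
    · simp only [string]
      rw [J.pairing_pow_self hN, if_pos (by omega),
        show J.len j - 1 - (J.len j - 1 - (b : ℕ)) = b by omega]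
      linear_combination -(B ((N ^ (b : ℕ)) (J.vec j)) y) * unit_mul_self_complex (J.sgn j)
    · rintro ⟨i, a⟩ - hne
      simp only [string]
      by_cases hij : j = i
      · subst hij
        rw [J.pairing_pow_self hN, if_neg, mul_zero]
        intro h
        apply hne
        have : a = ⟨J.len j - 1 - b, by omega⟩ := Fin.ext (by simp; omega)
        rw [this]
      · rw [J.pairing_pow_ne hN hij, mul_zero]
    · simp
  have hw : B w ((N ^ m) x) = 0 := by
    simp only [w, map_sum, LinearMap.sum_apply, LinearMap.map_smulₛₗ, LinearMap.smul_apply]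
    refine Finset.sum_eq_zero fun z _ => ?_
    rw [string, (hU _).1 hxmU, smul_zero]
  have hyw' : B (y - w) ((N ^ m) x) ≠ 0 := by
    rwa [map_sub, LinearMap.sub_apply, hw, sub_zero]
  obtain ⟨u, hu, ε, hε⟩ := exists_self_pairing_ne_zero hS hN hx hyw hyw'
  obtain ⟨v, hv, hvv⟩ := exists_normalized_generator hS hN hUN hm hu hε
  have h2 : ∀ i a, B (J.vec i) ((N ^ a) v) = 0 := fun i a => by
    rw [← form_pow_apply hN]; exact (hU v).1 hv i a
  have h1 : ∀ i a, B v ((N ^ a) (J.vec i)) = 0 := fun i a => by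
    rw [← hS.eq, form_pow_apply hN, h2, map_zero]
  refine ⟨J.cons v (m + 1) ε (Nat.succ_pos m) hvv h1 h2, ?_, ?_⟩
  · rintro (_ | i)
    · exact hm v hv
    · exact hz i
  · rw [Fintype.sum_option]
    simp [cons]

end JordanFamily

theorem exists_jordanFamily [FiniteDimensional ℂ V] (hS : B.IsSymm) (hB : B.Nondegenerate)
    (hN : ∀ x y, B (N x) y = B x (N y)) (hnil : IsNilpotent N) :
    ∃ (ι : Type) (_ : Fintype ι) (J : JordanFamily B N ι), ∑ i, J.len i = finrank ℂ V := by
  have main : ∀ d, d ≤ finrank ℂ V → ∃ (ι : Type) (_ : Fintype ι) (J : JordanFamily B N ι),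
      (∀ i, (N ^ J.len i) (J.vec i) = 0) ∧ d ≤ ∑ i, J.len i := by
    intro d
    induction d with
    | zero =>
      exact fun _ => ⟨Empty, inferInstance, ⟨Empty.elim, Empty.elim, Empty.elim,
        fun i => i.elim, fun i => i.elim, fun i => i.elim⟩, fun i => i.elim, Nat.zero_le _⟩
    | succ d ih =>
      intro hd
      obtain ⟨ι, hι, J, hz, hJ⟩ := ih (by omega)
      by_cases hlt : ∑ i, J.len i < finrank ℂ V
      · obtain ⟨J', hz', hJ'⟩ := J.exists_extension hS hB hN hnil hz hlt
        exact ⟨Option ι, inferInstance, J', hz', by omega⟩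
      · exact ⟨ι, hι, J, hz, by omega⟩
  obtain ⟨ι, hι, J, -, hJ⟩ := main _ le_rfl
  exact ⟨ι, hι, J, le_antisymm (J.sum_len_le hN) hJ⟩

end JordanExistence

theorem length_alternatingRow (ε : ℤˣ) (l : ℕ) : (alternatingRow ε l).length = l := by
  simp [alternatingRow]

theorem alternatingRow_inj {ε ε' : ℤˣ} {l l' : ℕ} (hl : 0 < l)
    (h : alternatingRow ε l = alternatingRow ε' l') : l = l' ∧ ε = ε' := by
  have h1 : l = l' := by
    rw [← length_alternatingRow ε l, h, length_alternatingRow]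
  subst h1
  obtain ⟨l, rfl⟩ := Nat.exists_eq_succ_of_ne_zero hl.ne'
  simp only [alternatingRow, List.iterate, List.cons.injEq] at h
  exact ⟨rfl, h.1⟩

/-! ### Tableaux and indices of inertia as complete invariants -/

section Classification

variable {V : Type*} [AddCommGroup V] [Module ℂ V] {B : V →ₗ⋆[ℂ] V →ₗ[ℂ] ℂ}

theorem smul_I_selfAdjoint {E : Module.End ℂ V} (hE : ∀ x y, B (E x) y + B x (E y) = 0) (x y : V) :
    B ((Complex.I • E) x) y = B x ((Complex.I • E) y) := by
  simp only [LinearMap.smul_apply, LinearMap.map_smulₛₗ, map_smul, smul_eq_mul, Complex.conj_I]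
  linear_combination (-Complex.I) * hE x y

theorem isNilpotent_I_smul {E : Module.End ℂ V} (h : IsNilpotent E) :
    IsNilpotent (Complex.I • E) := h.smul _

theorem ker_I_smul_pow (E : Module.End ℂ V) (k : ℕ) :
    LinearMap.ker ((Complex.I • E) ^ k) = LinearMap.ker (E ^ k) := by
  rw [smul_pow, LinearMap.ker_smul _ _ (pow_ne_zero k Complex.I_ne_zero)]

theorem range_I_smul_pow (E : Module.End ℂ V) (k : ℕ) :
    LinearMap.range ((Complex.I • E) ^ k) = LinearMap.range (E ^ k) := by
  rw [smul_pow, LinearMap.range_smul _ _ (pow_ne_zero k Complex.I_ne_zero)]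

variable [FiniteDimensional ℂ V]

/-- Matching strings have the same Gram matrix, so sending one string basis to the other is an
isometry, and it intertwines the endomorphisms since strings end at the same step. -/
theorem JordanFamily.exists_isometry {N N' : Module.End ℂ V} (hB : B.Nondegenerate)
    (hN : ∀ x y, B (N x) y = B x (N y)) (hN' : ∀ x y, B (N' x) y = B x (N' y))
    {ι ι' : Type*} [Fintype ι] [Fintype ι'] (J : JordanFamily B N ι) (J' : JordanFamily B N' ι')
    (hJ : ∑ i, J.len i = finrank ℂ V) (hJ' : ∑ i, J'.len i = finrank ℂ V)
    (σ : ι ≃ ι') (hlen : ∀ i, J'.len (σ i) = J.len i) (hsgn : ∀ i, J'.sgn (σ i) = J.sgn i) :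
    ∃ g : V ≃ₗ[ℂ] V, (∀ x y, B (g x) (g y) = B x y) ∧ ∀ x, g (N x) = N' (g x) := by
  let b := J.basis hN hJ
  let f : V →ₗ[ℂ] V := b.constr ℂ fun x => (N' ^ (x.2 : ℕ)) (J'.vec (σ x.1))
  have hf : ∀ i a, f ((N ^ a) (J.vec i)) = (N' ^ a) (J'.vec (σ i)) := by
    intro i a
    rcases lt_or_ge a (J.len i) with ha | ha
    · have := b.constr_basis ℂ (fun x => (N' ^ (x.2 : ℕ)) (J'.vec (σ x.1))) ⟨i, a, ha⟩
      rwa [J.basis_apply hN hJ] at this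
    · rw [J.pow_vec_eq_zero hN hJ hB i ha,
        J'.pow_vec_eq_zero hN' hJ' hB (σ i) (by rwa [hlen]), map_zero]
  have hpair : ∀ i j a c, B ((N' ^ a) (J'.vec (σ i))) ((N' ^ c) (J'.vec (σ j))) =
      B ((N ^ a) (J.vec i)) ((N ^ c) (J.vec j)) := by
    intro i j a c
    by_cases hij : i = j
    · rw [hij, J.pairing_pow_self hN, J'.pairing_pow_self hN', hlen, hsgn]
    · rw [J.pairing_pow_ne hN hij, J'.pairing_pow_ne hN' (fun h => hij (σ.injective h))]
  have hfB : ∀ x y, B (f x) (f y) = B x y := by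
    have : (B.compl₂ f).comp f = B := by
      refine b.ext fun x => b.ext fun y => ?_
      rw [LinearMap.comp_apply, LinearMap.compl₂_apply, J.basis_apply hN hJ, J.basis_apply hN hJ, hf, hf, hpair]
    intro x y
    exact LinearMap.congr_fun₂ this x y
  have hfN : ∀ x, f (N x) = N' (f x) := by
    have : f ∘ₗ N = N' ∘ₗ f := b.ext fun x => by
      have h : N ((N ^ (x.2 : ℕ)) (J.vec x.1)) = (N ^ ((x.2 : ℕ) + 1)) (J.vec x.1) := by
        rw [pow_succ', Module.End.mul_apply]
      rw [LinearMap.comp_apply, LinearMap.comp_apply, J.basis_apply hN hJ, h, hf, hf, pow_succ',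
        Module.End.mul_apply]
    exact LinearMap.congr_fun this
  have hinj : Function.Injective f := by
    rw [← LinearMap.ker_eq_bot, LinearMap.ker_eq_bot']
    intro x hx
    refine hB.1 x fun y => ?_
    rw [← hfB, hx]; simp
  exact ⟨LinearEquiv.ofInjectiveEndo f hinj, hfB, hfN⟩

theorem JordanFamily.signedTableau_rows {E : Module.End ℂ V} (hB : B.Nondegenerate)
    (hE : ∀ x y, B (E x) y + B x (E y) = 0)
    {ι : Type*} [Fintype ι] (J : JordanFamily B (Complex.I • E) ι)
    (hJ : ∑ i, J.len i = finrank ℂ V) :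
    (signedTableau B E).rows =
      (Finset.univ : Finset ι).val.map fun i => alternatingRow (J.sgn i) (J.len i) := by
  have hN := smul_I_selfAdjoint hE
  have h1 : ∀ r ε, rowCount B E r ε = ∑ i, if J.len i = r + 1 ∧ J.sgn i = ε then 1 else 0 := by
    intro r ε
    rw [rowCount_eq_inertia, ← ker_I_smul_pow, J.inertia_ker_pow hN hJ hB]
  have h2 : (signedTableau B E).rows = ∑ i, {alternatingRow (J.sgn i) (J.len i)} := by
    simp only [signedTableau, h1, ← Multiset.nsmul_singleton, Finset.sum_smul]
    -- After exchanging the sums, string i contributes only at r = len i - 1 and ε = sgn i; this r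
    -- is in range because len i ≤ dim V.
    rw [Finset.sum_congr rfl fun r _ => Finset.sum_comm, Finset.sum_comm]
    refine Finset.sum_congr rfl fun i _ => ?_
    have hpos := J.len_pos i
    have hle : J.len i ≤ finrank ℂ V := hJ ▸ Finset.single_le_sum (fun _ _ => Nat.zero_le _)
      (Finset.mem_univ i)
    rw [Finset.sum_eq_single (J.len i - 1), Finset.sum_eq_single (J.sgn i)]
    · rw [if_pos ⟨by omega, rfl⟩, one_smul, Nat.sub_add_cancel hpos]
    · intro ε _ hε
      rw [if_neg (fun h => hε h.2.symm), zero_smul]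
    · exact fun h => absurd (Finset.mem_univ _) h
    · intro r _ hr
      refine Finset.sum_eq_zero fun ε _ => ?_
      rw [if_neg (fun h => hr (by omega)), zero_smul]
    · intro h
      exact absurd (Finset.mem_range.2 (by omega)) h
  rw [h2, Finset.sum_eq_multiset_sum]
  conv_rhs => rw [← Multiset.sum_map_singleton (Multiset.map _ _), Multiset.map_map]
  rfl

theorem exists_equiv_of_map_eq {α β γ : Type*} [Fintype α] [Fintype β] {f : α → γ} {g : β → γ}
    (h : (Finset.univ : Finset α).val.map f = (Finset.univ : Finset β).val.map g) :
    ∃ σ : α ≃ β, ∀ a, g (σ a) = f a := by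
  classical
  have hcard : ∀ c, Fintype.card {a // f a = c} = Fintype.card {b // g b = c} := by
    intro c
    have := congrArg (Multiset.count c) h
    rw [Multiset.count_map, Multiset.count_map] at this
    rw [Fintype.card_subtype, Fintype.card_subtype]
    simp only [eq_comm (a := c)] at this
    exact this
  exact ⟨Equiv.ofFiberEquiv fun c => Fintype.equivOfCardEq (hcard c), Equiv.ofFiberEquiv_map _⟩

theorem exists_isometry_of_signedTableau_eq (hS : B.IsSymm) (hB : B.Nondegenerate)
    {E E' : Module.End ℂ V} (hE : ∀ x y, B (E x) y + B x (E y) = 0)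
    (hE' : ∀ x y, B (E' x) y + B x (E' y) = 0) (hnil : IsNilpotent E) (hnil' : IsNilpotent E')
    (h : signedTableau B E = signedTableau B E') :
    ∃ g : V ≃ₗ[ℂ] V, (∀ x y, B (g x) (g y) = B x y) ∧ ∀ x, g (E x) = E' (g x) := by
  have hN := smul_I_selfAdjoint hE
  have hN' := smul_I_selfAdjoint hE'
  obtain ⟨ι, _, J, hJ⟩ := exists_jordanFamily hS hB hN (isNilpotent_I_smul hnil)
  obtain ⟨ι', _, J', hJ'⟩ := exists_jordanFamily hS hB hN' (isNilpotent_I_smul hnil')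
  have hrows := J.signedTableau_rows hB hE hJ
  rw [h, J'.signedTableau_rows hB hE' hJ'] at hrows
  obtain ⟨σ, hσ⟩ := exists_equiv_of_map_eq hrows.symm
  have hσ' := fun i => alternatingRow_inj (J'.len_pos (σ i)) (hσ i)
  obtain ⟨g, hg, hgN⟩ := J.exists_isometry hB hN hN' J' hJ hJ' σ (fun i => (hσ' i).1)
    (fun i => (hσ' i).2)
  refine ⟨g, hg, fun x => ?_⟩
  have := hgN x
  simp only [LinearMap.smul_apply, map_smul] at this
  exact smul_right_injective V Complex.I_ne_zero this

/-- The `ε`-index of inertia of the hermitian form `(v, (i E) ^ k w)`. -/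
def powInertia (B : V →ₗ⋆[ℂ] V →ₗ[ℂ] ℂ) (E : Module.End ℂ V) (k : ℕ) (ε : ℤˣ) : ℕ :=
  inertia ⊤ (B.compl₂ ((Complex.I • E) ^ k)) ε

theorem JordanFamily.powInertia_eq {E : Module.End ℂ V} (hB : B.Nondegenerate)
    (hE : ∀ x y, B (E x) y + B x (E y) = 0) {ι : Type*} [Fintype ι]
    (J : JordanFamily B (Complex.I • E) ι) (hJ : ∑ i, J.len i = finrank ℂ V) (k : ℕ) (δ : ℤˣ) :
    powInertia B E k δ = ∑ i, stringIndex (J.len i) (J.sgn i) δ k :=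
  J.inertia_pow (smul_I_selfAdjoint hE) hJ hB δ k

theorem JordanFamily.finrank_range_pow_eq {E : Module.End ℂ V} (hB : B.Nondegenerate)
    (hE : ∀ x y, B (E x) y + B x (E y) = 0) {ι : Type*} [Fintype ι]
    (J : JordanFamily B (Complex.I • E) ι) (hJ : ∑ i, J.len i = finrank ℂ V) (k : ℕ) :
    finrank ℂ (LinearMap.range (E ^ k)) = ∑ i, (J.len i - k) := by
  rw [← range_I_smul_pow]
  exact J.finrank_range_pow (smul_I_selfAdjoint hE) hJ hB k

theorem powInertia_add_powInertia (hS : B.IsSymm) (hB : B.Nondegenerate) {E : Module.End ℂ V}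
    (hE : ∀ x y, B (E x) y + B x (E y) = 0) (hnil : IsNilpotent E) (k : ℕ) :
    powInertia B E k 1 + powInertia B E k (-1) = finrank ℂ (LinearMap.range (E ^ k)) := by
  have hN := smul_I_selfAdjoint hE
  obtain ⟨ι, _, J, hJ⟩ := exists_jordanFamily hS hB hN (isNilpotent_I_smul hnil)
  rw [← range_I_smul_pow]
  exact J.inertia_add_inertia_pow hN hJ hB k

/-- By `stringIndex_recovers` each row count is a combination of the indices at levels k, k + 1 and
k + 2, the ranks being sums of two indices. -/
theorem signedTableau_eq_of_powInertia_eq (hS : B.IsSymm) (hB : B.Nondegenerate)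
    {E E' : Module.End ℂ V} (hE : ∀ x y, B (E x) y + B x (E y) = 0)
    (hE' : ∀ x y, B (E' x) y + B x (E' y) = 0) (hnil : IsNilpotent E) (hnil' : IsNilpotent E')
    (h : ∀ k ε, powInertia B E k ε = powInertia B E' k ε) :
    signedTableau B E = signedTableau B E' := by
  have key : ∀ {F : Module.End ℂ V}, (∀ x y, B (F x) y + B x (F y) = 0) → IsNilpotent F →
      ∀ k δ, powInertia B F k δ + (powInertia B F (k + 2) 1 + powInertia B F (k + 2) (-1)) =
        powInertia B F (k + 2) δ + (powInertia B F (k + 1) 1 + powInertia B F (k + 1) (-1)) +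
          rowCount B F k δ := by
    intro F hF hFn k δ
    have hN := smul_I_selfAdjoint hF
    obtain ⟨ι, _, J, hJ⟩ := exists_jordanFamily hS hB hN (isNilpotent_I_smul hFn)
    rw [powInertia_add_powInertia hS hB hF hFn, powInertia_add_powInertia hS hB hF hFn,
      J.finrank_range_pow_eq hB hF hJ, J.finrank_range_pow_eq hB hF hJ, J.powInertia_eq hB hF hJ,
      J.powInertia_eq hB hF hJ, rowCount_eq_inertia, ← ker_I_smul_pow, J.inertia_ker_pow hN hJ hB]
    simp only [← Finset.sum_add_distrib]
    exact Finset.sum_congr rfl fun i _ => stringIndex_recovers _ _ _ _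
  have hrc : ∀ k δ, rowCount B E k δ = rowCount B E' k δ := by
    intro k δ
    have h1 := key hE hnil k δ
    have h2 := key hE' hnil' k δ
    simp only [h] at h1
    omega
  apply SignedTableau.ext
  simp only [signedTableau, hrc]

theorem powInertia_congr {V' : Type*} [AddCommGroup V'] [Module ℂ V'] [FiniteDimensional ℂ V']
    {B' : V' →ₗ⋆[ℂ] V' →ₗ[ℂ] ℂ} {E : Module.End ℂ V} {E' : Module.End ℂ V'} (g : V ≃ₗ[ℂ] V')
    (hg : ∀ x y, B' (g x) (g y) = B x y) (hE : ∀ x, g (E x) = E' (g x)) (k : ℕ) (ε : ℤˣ) :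
    powInertia B E k ε = powInertia B' E' k ε := by
  refine inertia_congr g (fun x => ?_) ε
  have : ∀ k x, ((Complex.I • E') ^ k) (g x) = g (((Complex.I • E) ^ k) x) := by
    intro k
    induction k with
    | zero => simp
    | succ k ih =>
      intro x
      have h : (Complex.I • E') (g x) = g ((Complex.I • E) x) := by simp [hE]
      rw [pow_succ, pow_succ, Module.End.mul_apply, Module.End.mul_apply, h, ih]
  rw [LinearMap.compl₂_apply, LinearMap.compl₂_apply, this, hg]

end Classification

/-! ### Adding two boxes, in terms of an indexing of the rows -/

section AddTwoBoxes

theorem alternatingRow_add_two (ε : ℤˣ) (l : ℕ) :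
    ∃ a : ℤˣ, alternatingRow ε (l + 2) = alternatingRow ε l ++ [a, -a] := by
  refine ⟨Neg.neg^[l] ε, ?_⟩
  rw [alternatingRow, List.iterate_add]
  rfl

theorem eq_alternatingRow_of_isChain {ε : ℤˣ} {l : List ℤˣ}
    (h : (ε :: l).IsChain (fun a b => b = -a)) : ε :: l = alternatingRow ε (l.length + 1) := by
  induction l generalizing ε with
  | nil => rfl
  | cons a l ih =>
    rw [List.isChain_cons_cons] at h
    rw [ih h.2, h.1, length_alternatingRow]
    rfl

theorem exists_add_of_map_eq_add {α β : Type*} {f : α → β} {s : Multiset α} {A C : Multiset β}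
    (h : s.map f = A + C) : ∃ s₁ s₂, s = s₁ + s₂ ∧ s₁.map f = A ∧ s₂.map f = C := by
  classical
  induction A using Multiset.induction_on generalizing s with
  | empty => exact ⟨0, s, by simp, by simp, by simpa using h⟩
  | cons a A ih =>
    rw [Multiset.cons_add, ← Multiset.map_eq_cons] at h
    obtain ⟨x, hx, rfl, h⟩ := h
    obtain ⟨s₁, s₂, h1, rfl, rfl⟩ := ih h
    exact ⟨x ::ₘ s₁, s₂, by rw [Multiset.cons_add, ← h1, Multiset.cons_erase hx], by simp, rfl⟩

/-- Turns a matching of multisets into a function; `Nodup` makes it well defined, and `Option`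
supplies a value off `s` when `β` may be empty. -/
theorem exists_map_eq_of_rel {α β : Type*} {r : α → β → Prop} {s : Multiset α} {t : Multiset β}
    (hs : s.Nodup) (h : Multiset.Rel r s t) : ∃ g : α → Option β, t.map some = s.map g ∧
      ∀ x ∈ s, ∃ y, g x = some y ∧ r x y := by
  classical
  induction s using Multiset.induction_on generalizing t with
  | empty =>
    rw [Multiset.rel_zero_left] at h
    exact ⟨fun _ => none, by simp [h], by simp⟩
  | cons a s ih =>
    rw [Multiset.rel_cons_left] at h
    obtain ⟨b, t', hab, h, rfl⟩ := h
    rw [Multiset.nodup_cons] at hs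
    obtain ⟨g, hg, hr⟩ := ih hs.2 h
    refine ⟨Function.update g a (some b), ?_, ?_⟩
    · rw [Multiset.map_cons, Multiset.map_cons, hg, Function.update_self]
      congr 1
      refine Multiset.map_congr rfl fun x hx => ?_
      rw [Function.update_of_ne]
      rintro rfl
      exact hs.1 hx
    · intro x hx
      by_cases hxa : x = a
      · subst hxa
        exact ⟨b, by simp, hab⟩
      · rw [Function.update_of_ne hxa]
        exact hr x ((Multiset.mem_cons.1 hx).resolve_left hxa)

theorem filter_map_alternatingRow {ι : Type*} {len : ι → ℕ} {sgn : ι → ℤˣ} (hlen : ∀ i, 0 < len i)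
    (s : Multiset ι) : (s.map fun i => alternatingRow (sgn i) (len i)).filter (fun r => r ≠ []) =
      s.map fun i => alternatingRow (sgn i) (len i) := by
  rw [Multiset.filter_eq_self]
  intro r hr hr'
  obtain ⟨i, -, rfl⟩ := Multiset.mem_map.1 hr
  have := length_alternatingRow (sgn i) (len i)
  rw [hr', List.length_nil] at this
  have := hlen i
  omega

variable {ι : Type*} [Fintype ι]

/-- Lengths of a family of rows completed by empty rows, `n` for each sign. -/
def rowLen (len : ι → ℕ) (n : ℕ) : ι ⊕ (Fin n × ℤˣ) → ℕ := Sum.elim len fun _ => 0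

/-- First signs of a family of rows completed by empty rows, `n` for each sign. -/
def rowSgn (sgn : ι → ℤˣ) (n : ℕ) : ι ⊕ (Fin n × ℤˣ) → ℤˣ := Sum.elim sgn Prod.snd

/-- `S` consists of `n` of the largest rows. -/
def IsLargestRows (len : ι → ℕ) (n : ℕ) (S : Finset (ι ⊕ (Fin n × ℤˣ))) : Prop :=
  S.card = n ∧ ∀ s ∈ S, ∀ i ∉ S, rowLen len n i ≤ rowLen len n s

open Classical in
/-- The rows that result from adding two boxes to each row in `S`. -/
def enlargedRows (len : ι → ℕ) (sgn : ι → ℤˣ) (n : ℕ) (S : Finset (ι ⊕ (Fin n × ℤˣ))) :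
    Multiset (List ℤˣ) :=
  (S.val.map fun s => alternatingRow (rowSgn sgn n s) (rowLen len n s + 2)) +
    (Finset.univ.filter fun i : ι => Sum.inl i ∉ S).val.map fun i => alternatingRow (sgn i) (len i)

theorem map_val_eq_toLeft_add_toRight {α β γ : Type*} (S : Finset (α ⊕ β)) (f : α ⊕ β → γ) :
    S.val.map f = S.toLeft.val.map (fun a => f (Sum.inl a)) +
      S.toRight.val.map (fun b => f (Sum.inr b)) := by
  conv_lhs => rw [← Finset.toLeft_disjSum_toRight (u := S)]
  change (S.toLeft.val.map Sum.inl + S.toRight.val.map Sum.inr).map f = _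
  rw [Multiset.map_add, Multiset.map_map, Multiset.map_map]
  rfl

/-- The index set has n empty rows of each sign, so that all first signs of new rows are available.
`S` uses at most n of these, and the unused part of the n empty rows in `AddTwoBoxes` goes to the
remainder. -/
theorem addTwoBoxes_of_isLargestRows {len : ι → ℕ} {sgn : ι → ℤˣ} (hlen : ∀ i, 0 < len i) {n : ℕ}
    {S : Finset (ι ⊕ (Fin n × ℤˣ))} (hS : IsLargestRows len n S) {T T' : SignedTableau}
    (hT : T.rows = (Finset.univ : Finset ι).val.map fun i => alternatingRow (sgn i) (len i))
    (hT' : T'.rows = enlargedRows len sgn n S) : AddTwoBoxes n T T' := by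
  classical
  refine ⟨S.val.map fun s => alternatingRow (rowSgn sgn n s) (rowLen len n s),
    (Finset.univ.filter fun i : ι => Sum.inl i ∉ S).val.map
      (fun i => alternatingRow (sgn i) (len i)) + Multiset.replicate (n - S.toRight.card) [],
    S.val.map fun s => alternatingRow (rowSgn sgn n s) (rowLen len n s + 2), ?_, ?_, ?_, ?_, ?_⟩
  · rw [map_val_eq_toLeft_add_toRight]
    have h1 : (S.toRight.val.map fun b => alternatingRow (rowSgn sgn n (Sum.inr b))
        (rowLen len n (Sum.inr b))) = Multiset.replicate S.toRight.card [] := by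
      rw [Multiset.eq_replicate]
      constructor
      · simp
      · intro b hb
        obtain ⟨b, -, rfl⟩ := Multiset.mem_map.1 hb
        rfl
    have h2 : n = S.toRight.card + (n - S.toRight.card) := by
      have := Finset.card_toLeft_add_card_toRight (u := S)
      have := hS.1
      omega
    have h3 : (Finset.univ : Finset ι).val = S.toLeft.val +
        (Finset.univ.filter fun i : ι => Sum.inl i ∉ S).val := by
      have hl : S.toLeft = Finset.univ.filter fun i : ι => Sum.inl i ∈ S := by
        ext i
        simp
      rw [hl]
      exact (Multiset.filter_add_not _ _).symm
    rw [h1, hT]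
    conv_lhs => rw [h2, h3, Multiset.map_add, Multiset.replicate_add]
    change _ = ((S.toLeft.val.map fun i => alternatingRow (sgn i) (len i)) + _) + _
    abel
  · rw [Multiset.card_map]; exact hS.1
  · intro s hs r hr
    obtain ⟨s, hs', rfl⟩ := Multiset.mem_map.1 hs
    rcases Multiset.mem_add.1 hr with hr | hr
    · obtain ⟨i, hi, rfl⟩ := Multiset.mem_map.1 hr
      rw [length_alternatingRow, length_alternatingRow]
      exact hS.2 s hs' (Sum.inl i) (Finset.mem_filter.1 hi).2
    · rw [Multiset.eq_of_mem_replicate hr]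
      exact Nat.zero_le _
  · rw [Multiset.rel_map]
    refine Multiset.rel_refl_of_refl_on fun s _ => ?_
    obtain ⟨a, ha⟩ := alternatingRow_add_two (rowSgn sgn n s) (rowLen len n s)
    exact ⟨a, -a, ha⟩
  · rw [hT', Multiset.filter_add, filter_map_alternatingRow hlen]
    have : (Multiset.replicate (n - S.toRight.card) ([] : List ℤˣ)).filter (fun r => r ≠ []) = 0 := by
      rw [Multiset.filter_eq_nil]
      intro r hr
      simp [Multiset.eq_of_mem_replicate hr]
    rw [this, add_zero]
    rfl

theorem exists_isLargestRows_of_addTwoBoxes {len : ι → ℕ} {sgn : ι → ℤˣ} (hlen : ∀ i, 0 < len i)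
    {n : ℕ} {T T' : SignedTableau}
    (hT : T.rows = (Finset.univ : Finset ι).val.map fun i => alternatingRow (sgn i) (len i))
    (h : AddTwoBoxes n T T') :
    ∃ S : Finset (ι ⊕ (Fin n × ℤˣ)), IsLargestRows len n S ∧ T'.rows = enlargedRows len sgn n S := by
  classical
  obtain ⟨S₀, R₀, S', h1, h2, h3, h4, h5⟩ := h
  let f : ι ⊕ Fin n → List ℤˣ := Sum.elim (fun i => alternatingRow (sgn i) (len i)) fun _ => []
  have hf : (Finset.univ : Finset (ι ⊕ Fin n)).val.map f = S₀ + R₀ := by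
    rw [← h1, hT, map_val_eq_toLeft_add_toRight]
    congr 1
    · simp [f]
    · rw [Multiset.eq_replicate]
      simp only [f, Sum.elim_inr, Multiset.map_const', Multiset.card_replicate]
      exact ⟨by simp, fun b hb => Multiset.eq_of_mem_replicate hb⟩
  obtain ⟨s₁, s₂, h12, rfl, rfl⟩ := exists_add_of_map_eq_add hf
  have hnd : (s₁ + s₂).Nodup := h12 ▸ Finset.univ.nodup
  rw [Multiset.nodup_add] at hnd
  obtain ⟨hnd1, hnd2, hdisj⟩ := hnd
  have hmem2 : ∀ x, x ∈ s₂ ↔ x ∉ s₁ := by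
    intro x
    constructor
    · exact fun h h' => Multiset.disjoint_left.1 hdisj h' h
    · intro h
      have : x ∈ s₁ + s₂ := h12 ▸ Finset.mem_univ x
      exact (Multiset.mem_add.1 this).resolve_left h
  rw [Multiset.rel_map_left] at h4
  obtain ⟨g, hg, hr⟩ := exists_map_eq_of_rel hnd1 h4
  -- Alternation forces the new boxes of a non-empty row; an empty row takes the first added box as
  -- its sign.
  have hchain : ∀ x ∈ s₁, ∃ ε : ℤˣ, (∀ i, x = Sum.inl i → ε = sgn i) ∧
      g x = some (alternatingRow ε ((f x).length + 2)) := by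
    intro x hx
    obtain ⟨y, hy, a, b, hab⟩ := hr x hx
    have hyS : y ∈ S' := by
      have : some y ∈ S'.map some := by
        rw [hg, ← hy]; exact Multiset.mem_map_of_mem g hx
      simpa using this
    have hyc := T'.alternating y (by rw [h5]; exact Multiset.mem_add.2 (Or.inl hyS))
    rcases x with i | k
    · refine ⟨sgn i, fun j hj => by rw [Sum.inl.inj hj], ?_⟩
      rw [hy]
      simp only [f, Sum.elim_inl, length_alternatingRow] at hab ⊢
      obtain ⟨l, hl⟩ := Nat.exists_eq_succ_of_ne_zero (hlen i).ne'
      have e : y = sgn i :: (alternatingRow (-sgn i) l ++ [a, b]) := by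
        rw [hab, hl]; rfl
      rw [e] at hyc ⊢
      rw [eq_alternatingRow_of_isChain hyc]
      congr 2
      simp [length_alternatingRow, hl]
    · refine ⟨a, fun j hj => by simp at hj, ?_⟩
      rw [hy]
      simp only [f, Sum.elim_inr, List.nil_append] at hab ⊢
      rw [hab] at hyc ⊢
      rw [eq_alternatingRow_of_isChain hyc]
      rfl
  choose! ε hε hgε using hchain
  -- Each selected empty row is relabelled by the first sign it acquires.
  let φ : ι ⊕ Fin n → ι ⊕ (Fin n × ℤˣ) :=
    fun x => Sum.elim (fun i => Sum.inl i) (fun k => Sum.inr (k, ε x)) x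
  have hφ : Function.Injective φ := by
    rintro (i | k) (j | l) h <;> simp_all [φ]
  let S : Finset (ι ⊕ (Fin n × ℤˣ)) := (⟨s₁, hnd1⟩ : Finset (ι ⊕ Fin n)).map ⟨φ, hφ⟩
  have hSval : S.val = s₁.map φ := rfl
  have hinl : ∀ i : ι, Sum.inl i ∈ S ↔ Sum.inl i ∈ s₁ := by
    intro i
    rw [← Finset.mem_val, hSval, Multiset.mem_map]
    constructor
    · rintro ⟨j | k, hx, h⟩
      · simp only [φ, Sum.elim_inl, Sum.inl.injEq] at h
        rwa [← h]
      · simp [φ] at h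
    · exact fun h => ⟨Sum.inl i, h, rfl⟩
  have hlenφ : ∀ x, rowLen len n (φ x) = (f x).length := by
    rintro (i | k) <;> simp [rowLen, φ, f, length_alternatingRow]
  refine ⟨S, ⟨?_, ?_⟩, ?_⟩
  · rw [Multiset.card_map] at h2
    change Multiset.card S.val = n
    rw [hSval, Multiset.card_map, h2]
  · intro s hs i hi
    rw [← Finset.mem_val, hSval, Multiset.mem_map] at hs
    obtain ⟨x, hx, rfl⟩ := hs
    rcases i with i | k
    · rw [hinl, ← hmem2] at hi
      rw [hlenφ]
      have := h3 _ (Multiset.mem_map_of_mem f hx) _ (Multiset.mem_map_of_mem f hi)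
      simpa [f, rowLen, length_alternatingRow] using this
    · exact Nat.zero_le _
  · rw [h5, enlargedRows]
    congr 1
    · apply Multiset.map_injective (Option.some_injective (List ℤˣ))
      rw [hg, hSval, Multiset.map_map, Multiset.map_map]
      refine Multiset.map_congr rfl fun x hx => ?_
      rw [hgε x hx, Function.comp_apply, Function.comp_apply, hlenφ]
      congr 2
      rcases x with i | k
      · exact hε _ hx i rfl
      · rfl
    · have e : s₂ = (⟨s₂, hnd2⟩ : Finset (ι ⊕ Fin n)).val := rfl
      rw [e, map_val_eq_toLeft_add_toRight, Multiset.filter_add]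
      have z : (Multiset.map (fun b => f (Sum.inr b))
          (Finset.toRight (⟨s₂, hnd2⟩ : Finset (ι ⊕ Fin n))).val).filter (fun r => r ≠ []) = 0 := by
        rw [Multiset.filter_eq_nil]
        intro r hr
        obtain ⟨b, -, rfl⟩ := Multiset.mem_map.1 hr
        simp [f]
      rw [z, add_zero]
      change ((Finset.toLeft _).val.map fun i => alternatingRow (sgn i) (len i)).filter _ = _
      rw [filter_map_alternatingRow hlen]
      congr 2
      ext i
      simp [hinl, hmem2]

end AddTwoBoxes

/-! ### Lengthening the largest rows: counting -/

section Counting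

/-- Here j is the critical length: longer rows must be lengthened, shorter ones need not be, and a
choice exists only among rows of length j. -/
theorem exists_threshold {K : Type*} [Fintype K] {n : ℕ} (L : K → ℕ) (hn : n ≤ Fintype.card K) :
    ∃ j, (Finset.univ.filter fun x => j < L x).card ≤ n ∧
      n ≤ (Finset.univ.filter fun x => j ≤ L x).card := by
  have hex : ∃ j, (Finset.univ.filter fun x => j < L x).card ≤ n := by
    refine ⟨∑ x, L x, ?_⟩
    rw [Finset.filter_false_of_mem]
    · simp
    · intro x hx
      have := Finset.single_le_sum (f := L) (fun _ _ => Nat.zero_le _) hx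
      omega
  refine ⟨Nat.find hex, Nat.find_spec hex, ?_⟩
  rcases Nat.eq_zero_or_pos (Nat.find hex) with h | h
  · rw [h]; simpa using hn
  · have := Nat.find_min hex (show Nat.find hex - 1 < Nat.find hex by omega)
    have e : (Finset.univ.filter fun x => Nat.find hex ≤ L x) =
        Finset.univ.filter fun x => Nat.find hex - 1 < L x := by
      ext x
      simp only [Finset.mem_filter, Finset.mem_univ, true_and]
      omega
    rw [e]
    omega

/-- Going from level j to j + 2 costs a row of length above j + 1 one box of each sign, and a row of
length j + 1 its only remaining box. -/
theorem sum_stringIndex_add_two_index {K : Type*} [Fintype K] {L : K → ℕ} {G : K → ℤˣ} {j : ℕ} (δ : ℤˣ) :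
    ∑ x, stringIndex (L x) (G x) δ j =
      ∑ x, stringIndex (L x) (G x) δ (j + 2) + (Finset.univ.filter fun x => j + 1 < L x).card +
        (Finset.univ.filter fun x => L x = j + 1 ∧ G x = δ).card := by
  rw [Finset.card_filter, Finset.card_filter, ← Finset.sum_add_distrib, ← Finset.sum_add_distrib]
  refine Finset.sum_congr rfl fun x _ => ?_
  unfold stringIndex
  by_cases hG : G x = δ <;> simp only [hG, if_true, if_false, and_true, and_false] <;>
    split_ifs <;> omega

variable {K : Type*} [Fintype K] [DecidableEq K] {L : K → ℕ} {G : K → ℤˣ} {n : ℕ} {S : Finset K}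

theorem stringIndex_zero (ε δ : ℤˣ) (k : ℕ) : stringIndex 0 ε δ k = 0 := by
  unfold stringIndex; split_ifs <;> simp

/-- This and the next two lemmas compute the ranks of the enlarged tableau when k is below, at and
above the critical length. The values are exactly the three upper bounds available for ranks of
lifts. -/
theorem sum_add_two_sub (hS : S.card = n) {k : ℕ} (h : ∀ s ∈ S, k ≤ L s) :
    ∑ x, ((L x + if x ∈ S then 2 else 0) - k) = 2 * n + ∑ x, (L x - k) := by
  have : ∑ x, (if x ∈ S then 2 else 0) = 2 * n := by simp [← hS, mul_comm]
  rw [← this, ← Finset.sum_add_distrib]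
  refine Finset.sum_congr rfl fun x _ => ?_
  split_ifs with hx
  · have := h x hx; omega
  · omega

theorem sum_add_two_sub_succ (hS : S.card = n) {k : ℕ} (h : ∀ s ∈ S, k ≤ L s)
    (h' : ∀ x ∉ S, L x ≤ k) :
    ∑ x, ((L x + if x ∈ S then 2 else 0) - (k + 1)) = n + ∑ x, (L x - k) := by
  have : ∑ x, (if x ∈ S then 1 else 0) = n := by simp [← hS]
  rw [← this, ← Finset.sum_add_distrib]
  refine Finset.sum_congr rfl fun x _ => ?_
  split_ifs with hx
  · have := h x hx; omega
  · have := h' x hx; omega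

theorem sum_add_two_sub_add_two {k : ℕ} (h' : ∀ x ∉ S, L x ≤ k) :
    ∑ x, ((L x + if x ∈ S then 2 else 0) - (k + 2)) = ∑ x, (L x - k) := by
  refine Finset.sum_congr rfl fun x _ => ?_
  split_ifs with hx
  · omega
  · have := h' x hx; omega

theorem sum_stringIndex_add_two (hS : S.card = n) {k : ℕ} (h : ∀ s ∈ S, k ≤ L s) (δ : ℤˣ) :
    ∑ x, stringIndex (L x + if x ∈ S then 2 else 0) (G x) δ k =
      ∑ x, stringIndex (L x) (G x) δ k + n := by
  have : ∑ x, (if x ∈ S then 1 else 0) = n := by simp [← hS]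
  rw [← this, ← Finset.sum_add_distrib]
  refine Finset.sum_congr rfl fun x _ => ?_
  unfold stringIndex
  split_ifs with hx
  · have := h x hx; omega
  · have := h x hx; omega
  · omega
  · omega

theorem sum_stringIndex_add_two_add_two {k : ℕ} (h' : ∀ x ∉ S, L x ≤ k) (δ : ℤˣ) :
    ∑ x, stringIndex (L x + if x ∈ S then 2 else 0) (G x) δ (k + 2) =
      ∑ x, stringIndex (L x) (G x) δ k := by
  refine Finset.sum_congr rfl fun x _ => ?_
  unfold stringIndex
  by_cases hx : x ∈ S
  · rw [if_pos hx]; congr 2; omega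
  · have := h' x hx
    rw [if_neg hx]; congr 2; omega

/-- A lengthened row of length j keeps a single box at level j + 1, carrying its first sign. A
longer row gains one box of each sign, so only the rows of length j make the choice of `S` visible
here. -/
theorem sum_stringIndex_threshold {j : ℕ} (h1 : ∀ x, j < L x → x ∈ S) (h2 : ∀ x ∈ S, j ≤ L x)
    (δ : ℤˣ) : ∑ x, stringIndex (L x + if x ∈ S then 2 else 0) (G x) δ (j + 1) =
      ∑ x, stringIndex (L x) (G x) δ (j + 1) + (Finset.univ.filter fun x => j < L x).card +
        (S.filter fun x => L x = j ∧ G x = δ).card := by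
  have e : (S.filter fun x => L x = j ∧ G x = δ).card =
      ∑ x, if x ∈ S ∧ L x = j ∧ G x = δ then 1 else 0 := by
    rw [← Finset.card_filter]
    congr 1
    ext x
    simp
  rw [e, Finset.card_filter, ← Finset.sum_add_distrib, ← Finset.sum_add_distrib]
  refine Finset.sum_congr rfl fun x _ => ?_
  unfold stringIndex
  by_cases hx : x ∈ S
  · have h2' := h2 x hx
    by_cases hG : G x = δ <;> simp only [hx, hG, if_true, if_false, true_and, and_true, and_false] <;>
      split_ifs <;> omega
  · have h1' : ¬ j < L x := fun h => hx (h1 x h)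
    simp only [hx, if_false, false_and]
    split_ifs <;> omega

theorem exists_subset_above_threshold {j : ℕ} (s : ℤˣ → ℕ)
    (hs : ∀ δ, s δ ≤ (Finset.univ.filter fun x => L x = j ∧ G x = δ).card)
    (hn : (Finset.univ.filter fun x => j < L x).card + (s 1 + s (-1)) = n) :
    ∃ S : Finset K, S.card = n ∧ (∀ x, j < L x → x ∈ S) ∧ (∀ x ∈ S, j ≤ L x) ∧
      ∀ δ, (S.filter fun x => L x = j ∧ G x = δ).card = s δ := by
  choose t ht htc using fun δ => Finset.exists_subset_card_eq (hs δ)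
  have ht' : ∀ δ x, x ∈ t δ → L x = j ∧ G x = δ := fun δ x hx => by simpa using ht δ hx
  refine ⟨(Finset.univ.filter fun x => j < L x) ∪ (t 1 ∪ t (-1)), ?_, ?_, ?_, ?_⟩
  · rw [Finset.card_union_of_disjoint, Finset.card_union_of_disjoint, htc, htc, hn]
    · rw [Finset.disjoint_left]
      intro x h1 h2
      have := (ht' _ x h1).2.symm.trans (ht' _ x h2).2
      exact absurd this (by decide)
    · rw [Finset.disjoint_left]
      intro x h1 h2
      have h1 := (Finset.mem_filter.1 h1).2
      rcases Finset.mem_union.1 h2 with h2 | h2 <;> have := (ht' _ x h2).1 <;> omega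
  · intro x hx
    simp [hx]
  · intro x hx
    rcases Finset.mem_union.1 hx with h | h
    · exact (Finset.mem_filter.1 h).2.le
    · rcases Finset.mem_union.1 h with h | h <;> exact (ht' _ x h).1.ge
  · intro δ
    rw [← htc δ]
    congr 1
    ext x
    simp only [Finset.mem_filter, Finset.mem_union, Finset.mem_univ, true_and]
    constructor
    · rintro ⟨h | h | h, h1, h2⟩
      · omega
      · rwa [← (ht' _ x h).2.symm.trans h2]
      · rwa [← (ht' _ x h).2.symm.trans h2]
    · intro h
      refine ⟨Or.inr ?_, ht' δ x h⟩
      rcases Int.units_eq_one_or δ with rfl | rfl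
      · exact Or.inl h
      · exact Or.inr h

end Counting

/-! ### Largest rows determined by rank and index bounds -/

section LargestRows

variable {ι : Type*} [Fintype ι] {len : ι → ℕ} {sgn : ι → ℤˣ} {n : ℕ}

open Classical in
/-- Row lengths after adding two boxes to the rows in `S`. -/
def enlargedLen (len : ι → ℕ) (n : ℕ) (S : Finset (ι ⊕ (Fin n × ℤˣ))) (x : ι ⊕ (Fin n × ℤˣ)) : ℕ :=
  rowLen len n x + if x ∈ S then 2 else 0

theorem sum_rowLen_sub (k : ℕ) : ∑ x, (rowLen len n x - k) = ∑ i, (len i - k) := by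
  rw [Fintype.sum_sum_type]
  simp [rowLen]

theorem sum_stringIndex_rowLen (δ : ℤˣ) (k : ℕ) :
    ∑ x, stringIndex (rowLen len n x) (rowSgn sgn n x) δ k =
      ∑ i, stringIndex (len i) (sgn i) δ k := by
  rw [Fintype.sum_sum_type]
  simp [rowLen, rowSgn, stringIndex_zero]

/-- Each k falls into one of three regimes, according to whether all rows in `S` have length at
least k, only at least k - 1, or not even that; in each regime one of the three bounds is the sum
itself. -/
theorem IsLargestRows.le_sum_enlargedLen_sub {S : Finset (ι ⊕ (Fin n × ℤˣ))}
    (hS : IsLargestRows len n S) (R : ℕ → ℕ) (h0 : ∀ k, R k ≤ 2 * n + ∑ i, (len i - k))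
    (h1 : ∀ k, R (k + 1) ≤ n + ∑ i, (len i - k)) (h2 : ∀ k, R (k + 2) ≤ ∑ i, (len i - k)) (k : ℕ) :
    R k ≤ ∑ x, (enlargedLen len n S x - k) := by
  classical
  replace h0 : ∀ k, R k ≤ 2 * n + ∑ x, (rowLen len n x - k) := fun k => by
    rw [sum_rowLen_sub]; exact h0 k
  replace h1 : ∀ k, R (k + 1) ≤ n + ∑ x, (rowLen len n x - k) := fun k => by
    rw [sum_rowLen_sub]; exact h1 k
  replace h2 : ∀ k, R (k + 2) ≤ ∑ x, (rowLen len n x - k) := fun k => by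
    rw [sum_rowLen_sub]; exact h2 k
  have e : ∀ k, ∑ x, (enlargedLen len n S x - k) =
      ∑ x, ((rowLen len n x + if x ∈ S then 2 else 0) - k) := by
    intro k
    simp only [enlargedLen]
  rw [e]
  by_cases c0 : ∀ s ∈ S, k ≤ rowLen len n s
  · rw [sum_add_two_sub hS.1 c0]; exact h0 k
  push Not at c0
  obtain ⟨s, hs, hsk⟩ := c0
  obtain ⟨k, rfl⟩ := Nat.exists_eq_succ_of_ne_zero (show k ≠ 0 by omega)
  have b : ∀ x ∉ S, rowLen len n x ≤ k := fun x hx => by have := hS.2 s hs x hx; omega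
  by_cases c1 : ∀ s ∈ S, k ≤ rowLen len n s
  · rw [Nat.succ_eq_add_one, sum_add_two_sub_succ hS.1 c1 b]; exact h1 k
  push Not at c1
  obtain ⟨s, hs, hsk⟩ := c1
  obtain ⟨k, rfl⟩ := Nat.exists_eq_succ_of_ne_zero (show k ≠ 0 by omega)
  have b : ∀ x ∉ S, rowLen len n x ≤ k := fun x hx => by have := hS.2 s hs x hx; omega
  change R (k + 2) ≤ ∑ x, ((rowLen len n x + if x ∈ S then 2 else 0) - (k + 2))
  rw [sum_add_two_sub_add_two b]
  exact h2 k

theorem card_filter_rowLen_eq_zero_le (δ : ℤˣ) :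
    n ≤ (Finset.univ.filter fun x : ι ⊕ (Fin n × ℤˣ) =>
      rowLen len n x = 0 ∧ rowSgn sgn n x = δ).card := by
  classical
  have : ((Finset.univ : Finset (Fin n)).image fun k => (Sum.inr (k, δ) : ι ⊕ (Fin n × ℤˣ))) ⊆
      Finset.univ.filter fun x => rowLen len n x = 0 ∧ rowSgn sgn n x = δ := by
    intro x hx
    obtain ⟨k, -, rfl⟩ := Finset.mem_image.1 hx
    exact Finset.mem_filter.2 ⟨Finset.mem_univ _, rfl, rfl⟩
  refine le_trans ?_ (Finset.card_le_card this)
  rw [Finset.card_image_of_injective _ (fun a b h => by simpa using h)]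
  simp

/-- With the sum over both signs prescribed, the bounds `u0` are equalities for k ≤ j and the bounds
`u2` for k ≥ j + 2, where j is the critical length. The values at k = j + 1 prescribe how many rows
of length j and of each sign to put into `S`. -/
theorem exists_isLargestRows_of_index_bounds (P : ℕ → ℤˣ → ℕ)
    (u0 : ∀ k δ, P k δ ≤ ∑ i, stringIndex (len i) (sgn i) δ k + n)
    (u2 : ∀ k δ, P (k + 2) δ ≤ ∑ i, stringIndex (len i) (sgn i) δ k)
    (hP : ∀ S, IsLargestRows len n S → ∀ k,
      P k 1 + P k (-1) = ∑ x, (enlargedLen len n S x - k)) :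
    ∃ S, IsLargestRows len n S ∧
      ∀ k δ, P k δ = ∑ x, stringIndex (enlargedLen len n S x) (rowSgn sgn n x) δ k := by
  classical
  replace u0 : ∀ k δ, P k δ ≤ ∑ x, stringIndex (rowLen len n x) (rowSgn sgn n x) δ k + n :=
    fun k δ => by rw [sum_stringIndex_rowLen]; exact u0 k δ
  replace u2 : ∀ k δ, P (k + 2) δ ≤ ∑ x, stringIndex (rowLen len n x) (rowSgn sgn n x) δ k :=
    fun k δ => by rw [sum_stringIndex_rowLen]; exact u2 k δ
  have he : ∀ S x, enlargedLen len n S x = rowLen len n x + if x ∈ S then 2 else 0 := by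
    intro S x
    simp only [enlargedLen]
  have hρ : ∀ k, ∑ x, (rowLen len n x - k) =
      ∑ x, stringIndex (rowLen len n x) (rowSgn sgn n x) 1 k +
        ∑ x, stringIndex (rowLen len n x) (rowSgn sgn n x) (-1) k := by
    intro k
    rw [← Finset.sum_add_distrib]
    exact Finset.sum_congr rfl fun x _ => (stringIndex_one_add_neg_one _ _ _).symm
  obtain ⟨j, hj1, hj2⟩ := exists_threshold (rowLen len n) (n := n) (by simp; omega)
  set A := (Finset.univ.filter fun x => j < rowLen len n x).card with hA
  have largest : ∀ S : Finset (ι ⊕ (Fin n × ℤˣ)), S.card = n →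
      (∀ x, j < rowLen len n x → x ∈ S) → (∀ x ∈ S, j ≤ rowLen len n x) →
      IsLargestRows len n S := by
    intro S hS h1 h2
    refine ⟨hS, fun s hs i hi => ?_⟩
    have := h2 s hs
    have : ¬ j < rowLen len n i := fun h => hi (h1 i h)
    omega
  obtain ⟨S₀, hS₀1, hS₀2, hS₀⟩ : ∃ S : Finset (ι ⊕ (Fin n × ℤˣ)),
      (Finset.univ.filter fun x => j < rowLen len n x) ⊆ S ∧
      S ⊆ (Finset.univ.filter fun x => j ≤ rowLen len n x) ∧ S.card = n :=
    Finset.exists_subsuperset_card_eq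
      (fun x hx => by simp only [Finset.mem_filter, Finset.mem_univ, true_and] at hx ⊢; omega) hj1 hj2
  have hS₀1' : ∀ x, j < rowLen len n x → x ∈ S₀ := fun x hx => hS₀1 (by simpa using hx)
  have hS₀2' : ∀ x ∈ S₀, j ≤ rowLen len n x := fun x hx => by simpa using hS₀2 hx
  have hsum : P (j + 1) 1 + P (j + 1) (-1) = n + ∑ x, (rowLen len n x - j) := by
    rw [hP S₀ (largest S₀ hS₀ hS₀1' hS₀2')]
    simp only [he]
    exact sum_add_two_sub_succ hS₀ hS₀2' fun x hx => not_lt.1 fun h => hx (hS₀1' x h)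
  have hstep : ∑ x, (rowLen len n x - j) = ∑ x, (rowLen len n x - (j + 1)) + A := by
    rw [hA, Finset.card_filter, ← Finset.sum_add_distrib]
    refine Finset.sum_congr rfl fun x _ => ?_
    split_ifs <;> omega
  have hρj := hρ (j + 1)
  set p : ℤˣ → ℕ := fun δ => ∑ x, stringIndex (rowLen len n x) (rowSgn sgn n x) δ (j + 1) with hp
  have hu0 : ∀ δ, P (j + 1) δ ≤ p δ + n := fun δ => u0 (j + 1) δ
  have hρj' : ∑ x, (rowLen len n x - (j + 1)) = p 1 + p (-1) := hρj
  -- The two indices add up to p 1 + p (-1) + A + n, and neither exceeds p + n, so the other is at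
  -- least p + A.
  have hge : ∀ δ, p δ + A ≤ P (j + 1) δ := by
    intro δ
    have h1 := hu0 1
    have h2 := hu0 (-1)
    rcases Int.units_eq_one_or δ with rfl | rfl <;> omega
  -- Enough rows of length j and sign δ exist: for j > 0 by `u2` at level j - 1, for j = 0 because
  -- there are n empty rows of each sign.
  have hle : ∀ δ, P (j + 1) δ - p δ - A ≤
      (Finset.univ.filter fun x => rowLen len n x = j ∧ rowSgn sgn n x = δ).card := by
    intro δ
    rcases Nat.eq_zero_or_pos j with rfl | hj
    · have := card_filter_rowLen_eq_zero_le (len := len) (sgn := sgn) (n := n) δ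
      have := hu0 δ
      omega
    · obtain ⟨i, rfl⟩ := Nat.exists_eq_succ_of_ne_zero hj.ne'
      have h1 := u2 i δ
      rw [sum_stringIndex_add_two_index] at h1
      simp only [Nat.succ_eq_add_one] at *
      have h2 : P (i + 1 + 1) δ ≤ p δ + A +
        (Finset.univ.filter fun x => rowLen len n x = i + 1 ∧ rowSgn sgn n x = δ).card := h1
      omega
  obtain ⟨S, hS, hS1, hS2, hS3⟩ := exists_subset_above_threshold (n := n)
    (fun δ => P (j + 1) δ - p δ - A) hle (by
      have h1 := hge 1
      have h2 := hge (-1)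
      change A + _ = n
      omega)
  have hlarge := largest S hS hS1 hS2
  have hS1' : ∀ x ∉ S, rowLen len n x ≤ j := fun x hx => not_lt.1 fun h => hx (hS1 x h)
  refine ⟨S, hlarge, fun k δ => ?_⟩
  have hPk := hP S hlarge k
  simp only [he] at hPk ⊢
  rcases lt_trichotomy k (j + 1) with hk | rfl | hk
  · have hk' : ∀ s ∈ S, k ≤ rowLen len n s := fun s hs => by have := hS2 s hs; omega
    rw [sum_add_two_sub hS hk', hρ] at hPk
    rw [sum_stringIndex_add_two hS hk']
    have h1 := u0 k 1
    have h2 := u0 k (-1)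
    rcases Int.units_eq_one_or δ with rfl | rfl <;> omega
  · rw [sum_stringIndex_threshold hS1 hS2, hS3]
    have := hge δ
    change P (j + 1) δ = p δ + A + (P (j + 1) δ - p δ - A)
    omega
  · obtain ⟨i, rfl⟩ : ∃ i, k = i + 2 := ⟨k - 2, by omega⟩
    have hi : ∀ x ∉ S, rowLen len n x ≤ i := fun x hx => by have := hS1' x hx; omega
    rw [sum_add_two_sub_add_two hi, hρ] at hPk
    rw [sum_stringIndex_add_two_add_two hi]
    have h1 := u2 i 1
    have h2 := u2 i (-1)
    rcases Int.units_eq_one_or δ with rfl | rfl <;> omega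

theorem exists_isLargestRows (len : ι → ℕ) (n : ℕ) : ∃ S, IsLargestRows len n S := by
  classical
  obtain ⟨j, hj1, hj2⟩ := exists_threshold (rowLen len n) (n := n) (by simp; omega)
  obtain ⟨S, hS1, hS2, hS⟩ := Finset.exists_subsuperset_card_eq
      (s := Finset.univ.filter fun x => j < rowLen len n x)
      (t := Finset.univ.filter fun x => j ≤ rowLen len n x)
      (fun x hx => by simp only [Finset.mem_filter, Finset.mem_univ, true_and] at hx ⊢; omega) hj1 hj2
  refine ⟨S, hS, fun s hs i hi => ?_⟩
  have h1 : j ≤ rowLen len n s := by simpa using hS2 hs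
  have h2 : ¬ j < rowLen len n i := fun h => hi (hS1 (by simpa using h))
  omega

end LargestRows

/-! ### The geometry of a real flag -/

section Flag

variable {V : Type*} [NormedAddCommGroup V] [NormedSpace ℂ V]
  {B : V →ₗ⋆[ℂ] V →ₗ[ℂ] ℂ}

namespace RealFlag

variable (D : RealFlag B)

/-- Exchange the two isotropic subspaces. -/
def swap : RealFlag B where
  V₁ := D.V₁'
  V₀ := D.V₀
  V₁' := D.V₁
  disjoint := D.disjoint.symm
  isCompl := by rw [sup_comm]; exact D.isCompl
  isotropic := D.isotropic'
  isotropic' := D.isotropic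
  orthogonal := by rw [sup_comm]; exact D.orthogonal

theorem exists_add_add (x : V) : ∃ x₁ ∈ D.V₁, ∃ x₀ ∈ D.V₀, ∃ x₂ ∈ D.V₁', x = x₁ + x₀ + x₂ := by
  have hx : x ∈ D.V₀ ⊔ (D.V₁ ⊔ D.V₁') := by rw [D.isCompl.sup_eq_top]; trivial
  obtain ⟨x₀, h₀, y, hy, rfl⟩ := Submodule.mem_sup.1 hx
  obtain ⟨x₁, h₁, x₂, h₂, rfl⟩ := Submodule.mem_sup.1 hy
  exact ⟨x₁, h₁, x₀, h₀, x₂, h₂, by abel⟩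

theorem form_V₀_V₁ {x y : V} (hx : x ∈ D.V₀) (hy : y ∈ D.V₁) : B x y = 0 :=
  D.orthogonal x hx y (Submodule.mem_sup_left hy)

theorem form_V₀_V₁' {x y : V} (hx : x ∈ D.V₀) (hy : y ∈ D.V₁') : B x y = 0 :=
  D.orthogonal x hx y (Submodule.mem_sup_right hy)

theorem eq_zero_of_mem_V₁' (hB : B.Nondegenerate) {y : V} (hy : y ∈ D.V₁')
    (h : ∀ x ∈ D.V₁, B x y = 0) : y = 0 := by
  refine hB.2 y fun x => ?_
  obtain ⟨x₁, h₁, x₀, h₀, x₂, h₂, rfl⟩ := D.exists_add_add x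
  rw [map_add, map_add, LinearMap.add_apply, LinearMap.add_apply, h x₁ h₁, D.form_V₀_V₁' h₀ hy,
    D.isotropic' x₂ h₂ y hy]
  simp

section Symm

variable (hS : B.IsSymm)
include hS

theorem form_V₁_V₀ {x y : V} (hx : x ∈ D.V₁) (hy : y ∈ D.V₀) : B x y = 0 := by
  rw [← hS.eq, D.form_V₀_V₁ hy hx, map_zero]

theorem form_V₁'_V₀ {x y : V} (hx : x ∈ D.V₁') (hy : y ∈ D.V₀) : B x y = 0 :=
  D.swap.form_V₁_V₀ hS hx hy

theorem nondegenerate_V₀ (hB : B.Nondegenerate) : (B.domRestrict₁₂ D.V₀ D.V₀).Nondegenerate := by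
  constructor
  · intro x hx
    refine Subtype.ext (hB.1 x fun y => ?_)
    obtain ⟨y₁, h₁, y₀, h₀, y₂, h₂, rfl⟩ := D.exists_add_add y
    have := hx ⟨y₀, h₀⟩
    rw [LinearMap.domRestrict₁₂_apply] at this
    rw [map_add, map_add, D.form_V₀_V₁ x.2 h₁, D.form_V₀_V₁' x.2 h₂, this]
    simp
  · intro x hx
    refine Subtype.ext (hB.2 x fun y => ?_)
    obtain ⟨y₁, h₁, y₀, h₀, y₂, h₂, rfl⟩ := D.exists_add_add y
    have := hx ⟨y₀, h₀⟩
    rw [LinearMap.domRestrict₁₂_apply] at this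
    rw [map_add, map_add, LinearMap.add_apply, LinearMap.add_apply, D.form_V₁_V₀ hS h₁ x.2,
      D.form_V₁'_V₀ hS h₂ x.2, this]
    simp

end Symm

/-- The projection to `V₀` along `V₁ ⊕ V₁'`. -/
def proj : V →ₗ[ℂ] D.V₀ := D.V₀.projectionOnto (D.V₁ ⊔ D.V₁') D.isCompl

theorem proj_of_mem_V₀ {x : V} (hx : x ∈ D.V₀) : D.proj x = ⟨x, hx⟩ :=
  Submodule.projectionOnto_apply_of_mem_left D.isCompl hx

theorem proj_of_mem_V₁ {x : V} (hx : x ∈ D.V₁) : D.proj x = 0 :=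
  (Submodule.projectionOnto_apply_eq_zero_iff D.isCompl).2 (Submodule.mem_sup_left hx)

theorem form_eq_form_proj (hS : B.IsSymm) {x y : V} (hx : x ∈ D.V₁ ⊔ D.V₀)
    (hy : y ∈ D.V₁ ⊔ D.V₀) : B x y = B.domRestrict₁₂ D.V₀ D.V₀ (D.proj x) (D.proj y) := by
  obtain ⟨x₁, hx₁, x₀, hx₀, rfl⟩ := Submodule.mem_sup.1 hx
  obtain ⟨y₁, hy₁, y₀, hy₀, rfl⟩ := Submodule.mem_sup.1 hy
  rw [map_add D.proj, map_add D.proj, D.proj_of_mem_V₁ hx₁, D.proj_of_mem_V₁ hy₁,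
    D.proj_of_mem_V₀ hx₀, D.proj_of_mem_V₀ hy₀]
  simp [D.isotropic _ hx₁ _ hy₁, D.form_V₁_V₀ hS hx₁ hy₀, D.form_V₀_V₁ hx₀ hy₁,
    LinearMap.domRestrict₁₂_apply]

section FiniteDimensional

variable [FiniteDimensional ℂ V]

/-- The pairing of `V₁'` with a basis of `V₁`. -/
def pairing : D.V₁' →ₗ[ℂ] (Fin (finrank ℂ D.V₁) → ℂ) :=
  LinearMap.pi fun k => (B (finBasis ℂ D.V₁ k : V)).domRestrict D.V₁'

theorem pairing_injective (hB : B.Nondegenerate) :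
    Function.Injective D.pairing := by
  rw [← LinearMap.ker_eq_bot, LinearMap.ker_eq_bot']
  intro y hy
  refine Subtype.ext (D.eq_zero_of_mem_V₁' hB y.2 fun x hx => ?_)
  have : (B.flip (y : V)).comp D.V₁.subtype = 0 := (finBasis ℂ D.V₁).ext fun k => congrFun hy k
  exact LinearMap.congr_fun this ⟨x, hx⟩

/-- Each of the two isotropic subspaces embeds into the dual of the other. -/
theorem finrank_V₁' (hB : B.Nondegenerate) :
    finrank ℂ D.V₁' = finrank ℂ D.V₁ := by
  have h1 := LinearMap.finrank_le_finrank_of_injective (D.pairing_injective hB)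
  have h2 := LinearMap.finrank_le_finrank_of_injective (D.swap.pairing_injective hB)
  rw [finrank_fin_fun] at h1 h2
  exact le_antisymm h1 h2

theorem exists_dual_bases (hB : B.Nondegenerate) :
    ∃ f f' : Fin (finrank ℂ D.V₁) → V, (∀ k, f k ∈ D.V₁) ∧ (∀ k, f' k ∈ D.V₁') ∧
      ∀ k l, B (f k) (f' l) = if k = l then 1 else 0 := by
  have hs : Function.Surjective D.pairing :=
    (LinearMap.injective_iff_surjective_of_finrank_eq_finrank
      (by rw [finrank_fin_fun, D.finrank_V₁' hB])).1 (D.pairing_injective hB)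
  choose f' hf' using fun l => hs (Pi.single l 1)
  refine ⟨fun k => finBasis ℂ D.V₁ k, fun l => f' l, fun k => (finBasis ℂ D.V₁ k).2,
    fun l => (f' l).2, fun k l => ?_⟩
  have := congrFun (hf' l) k
  rw [Pi.single_apply] at this
  exact this

theorem finrank_V₁_sup_V₀ : finrank ℂ ↥(D.V₁ ⊔ D.V₀) = finrank ℂ D.V₁ + finrank ℂ D.V₀ := by
  have h := Submodule.finrank_sup_add_finrank_inf_eq D.V₁ D.V₀
  have : D.V₁ ⊓ D.V₀ = ⊥ := by
    rw [inf_comm]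
    exact (D.isCompl.disjoint.mono_right le_sup_left).eq_bot
  rwa [this, finrank_bot, add_zero] at h

theorem finrank_eq (hB : B.Nondegenerate) :
    finrank ℂ V = 2 * finrank ℂ D.V₁ + finrank ℂ D.V₀ := by
  have h1 := Submodule.finrank_add_eq_of_isCompl D.isCompl
  have h2 := Submodule.finrank_sup_add_finrank_inf_eq D.V₁ D.V₁'
  rw [D.disjoint.eq_bot, finrank_bot, D.finrank_V₁' hB] at h2
  omega

end FiniteDimensional

/-- `F` is a skew-hermitian endomorphism in the preimage of `e` in the parabolic subalgebra. -/
structure IsLift (e : Module.End ℂ D.V₀) (F : Module.End ℂ V) : Prop where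
  skew : ∀ x y, B (F x) y + B x (F y) = 0
  map_V₁ : ∀ x ∈ D.V₁, F x = 0
  map_V₀ : ∀ x : D.V₀, F x - e x ∈ D.V₁
  map_top : ∀ x, F x ∈ D.V₁ ⊔ D.V₀

namespace IsLift

variable {D} {e : Module.End ℂ D.V₀} {F : Module.End ℂ V} (hF : D.IsLift e F)
include hF

theorem proj_apply {x : V} (hx : x ∈ D.V₁ ⊔ D.V₀) : D.proj (F x) = e (D.proj x) := by
  obtain ⟨x₁, hx₁, x₀, hx₀, rfl⟩ := Submodule.mem_sup.1 hx
  have h := hF.map_V₀ ⟨x₀, hx₀⟩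
  rw [map_add F, map_add D.proj x₁, hF.map_V₁ _ hx₁, D.proj_of_mem_V₁ hx₁, zero_add, zero_add,
    D.proj_of_mem_V₀ hx₀, ← sub_add_cancel (F x₀) (e ⟨x₀, hx₀⟩ : V), map_add,
    D.proj_of_mem_V₁ h, zero_add, D.proj_of_mem_V₀ (e ⟨x₀, hx₀⟩).2]

theorem proj_pow_apply {x : V} (hx : x ∈ D.V₁ ⊔ D.V₀) (k : ℕ) :
    (F ^ k) x ∈ D.V₁ ⊔ D.V₀ ∧ D.proj ((F ^ k) x) = (e ^ k) (D.proj x) := by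
  induction k with
  | zero => simpa
  | succ k ih =>
    rw [pow_succ', pow_succ', Module.End.mul_apply, Module.End.mul_apply, ← ih.2,
      hF.proj_apply ih.1]
    exact ⟨hF.map_top _, rfl⟩

theorem form_smul_pow (hS : B.IsSymm) {x y : V} (hx : x ∈ D.V₁ ⊔ D.V₀) (hy : y ∈ D.V₁ ⊔ D.V₀)
    (k : ℕ) : B x (((Complex.I • F) ^ k) y) =
      B.domRestrict₁₂ D.V₀ D.V₀ (D.proj x) (((Complex.I • e) ^ k) (D.proj y)) := by
  rw [smul_pow, smul_pow, LinearMap.smul_apply, LinearMap.smul_apply, map_smul, map_smul,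
    D.form_eq_form_proj hS hx (hF.proj_pow_apply hy k).1, (hF.proj_pow_apply hy k).2]

/-- Moving one factor iF to the left argument puts both arguments into V₁ + V₀, where the form and F
descend to V₀. -/
theorem form_smul_pow_add_two (hS : B.IsSymm) (x y : V) (k : ℕ) :
    B x (((Complex.I • F) ^ (k + 2)) y) = B.domRestrict₁₂ D.V₀ D.V₀ (D.proj ((Complex.I • F) x))
      (((Complex.I • e) ^ k) (D.proj ((Complex.I • F) y))) := by
  have hmem : ∀ x, (Complex.I • F) x ∈ D.V₁ ⊔ D.V₀ := fun x => Submodule.smul_mem _ _ (hF.map_top x)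
  rw [← hF.form_smul_pow hS (hmem x) (hmem y), smul_I_selfAdjoint hF.skew, pow_succ', pow_succ,
    Module.End.mul_apply, Module.End.mul_apply]

theorem isNilpotent (hS : B.IsSymm) (hB : B.Nondegenerate) (he : IsNilpotent e) :
    IsNilpotent F := by
  obtain ⟨m, hm⟩ := he
  refine ⟨m + 2, ?_⟩
  have h : (Complex.I • F) ^ (m + 2) = 0 := by
    ext y
    refine hB.2 _ fun x => ?_
    rw [hF.form_smul_pow_add_two hS, smul_pow, hm]
    simp
  rw [smul_pow] at h
  exact (smul_eq_zero.1 h).resolve_left (pow_ne_zero _ Complex.I_ne_zero)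

variable [FiniteDimensional ℂ V]

/-- Restriction to V₁ + V₀, of codimension dim V₁, makes the form a pullback from V₀. -/
theorem powInertia_le_add (hS : B.IsSymm) (hB : B.Nondegenerate) (k : ℕ) (δ : ℤˣ) :
    powInertia B F k δ ≤ powInertia (B.domRestrict₁₂ D.V₀ D.V₀) e k δ + finrank ℂ D.V₁ := by
  have h := inertia_top_add_finrank_le (H := B.compl₂ ((Complex.I • F) ^ k))
    (H' := (B.domRestrict₁₂ D.V₀ D.V₀).compl₂ ((Complex.I • e) ^ k)) (D.V₁ ⊔ D.V₀) D.proj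
    (fun x hx => hF.form_smul_pow hS hx hx k) δ
  have h1 := D.finrank_eq hB
  have h2 := D.finrank_V₁_sup_V₀
  unfold powInertia
  omega

theorem powInertia_add_two_le (hS : B.IsSymm) (k : ℕ) (δ : ℤˣ) :
    powInertia B F (k + 2) δ ≤ powInertia (B.domRestrict₁₂ D.V₀ D.V₀) e k δ := by
  have h := inertia_top_add_finrank_le (H := B.compl₂ ((Complex.I • F) ^ (k + 2)))
    (H' := (B.domRestrict₁₂ D.V₀ D.V₀).compl₂ ((Complex.I • e) ^ k)) ⊤ (D.proj ∘ₗ (Complex.I • F))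
    (fun x _ => hF.form_smul_pow_add_two hS x x k) δ
  rw [finrank_top] at h
  unfold powInertia
  omega

/-- The range of F^(k+1) lies in V₁ + V₀ and projects into the range of e^k with kernel inside V₁.
This is the rank bound at the critical level, proved without the indices. -/
theorem finrank_range_pow_succ_le (k : ℕ) : finrank ℂ (LinearMap.range (F ^ (k + 1))) ≤
    finrank ℂ D.V₁ + finrank ℂ (LinearMap.range (e ^ k)) := by
  let W := LinearMap.range (F ^ (k + 1))
  let ψ := D.proj.domRestrict W
  have hW : ∀ w ∈ W, w ∈ D.V₁ ⊔ D.V₀ := by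
    rintro _ ⟨x, rfl⟩
    rw [pow_succ', Module.End.mul_apply]
    exact hF.map_top _
  have h1 : finrank ℂ (LinearMap.range ψ) ≤ finrank ℂ (LinearMap.range (e ^ k)) := by
    refine Submodule.finrank_mono ?_
    rintro _ ⟨⟨_, x, rfl⟩, rfl⟩
    refine ⟨D.proj (F x), ?_⟩
    rw [← (hF.proj_pow_apply (hF.map_top x) k).2, ← Module.End.mul_apply, ← pow_succ]
    rfl
  have h2 : finrank ℂ (LinearMap.ker ψ) ≤ finrank ℂ D.V₁ := by
    rw [← Submodule.finrank_map_subtype_eq W (LinearMap.ker ψ)]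
    refine Submodule.finrank_mono ?_
    rintro _ ⟨w, hw, rfl⟩
    obtain ⟨x₁, h₁, x₀, h₀, h⟩ := Submodule.mem_sup.1 (hW w w.2)
    have hw' : D.proj (w : V) = 0 := hw
    rw [← h, map_add, D.proj_of_mem_V₁ h₁, zero_add, D.proj_of_mem_V₀ h₀] at hw'
    have : x₀ = 0 := congrArg Subtype.val hw'
    rw [this, add_zero] at h
    rw [Submodule.subtype_apply, ← h]
    exact h₁
  have h3 := LinearMap.finrank_range_add_finrank_ker ψ
  change finrank ℂ W ≤ _
  omega

end IsLift
end RealFlag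
end Flag

/-! ### Lifts with a prescribed tableau -/

section Lift

variable {V : Type*} [NormedAddCommGroup V] [NormedSpace ℂ V]
  {B : V →ₗ⋆[ℂ] V →ₗ[ℂ] ℂ}

namespace RealFlag

variable (D : RealFlag B) {σ : Type*} [Fintype σ]

theorem form_coe_left (x : D.V₀) (y : V) :
    B (x : V) y = B.domRestrict₁₂ D.V₀ D.V₀ x (D.proj y) := by
  obtain ⟨y₁, h₁, y₀, h₀, y₂, h₂, rfl⟩ := D.exists_add_add y
  have h : D.proj y₂ = 0 :=
    (Submodule.projectionOnto_apply_eq_zero_iff D.isCompl).2 (Submodule.mem_sup_right h₂)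
  rw [map_add D.proj, map_add D.proj, D.proj_of_mem_V₁ h₁, D.proj_of_mem_V₀ h₀, h, map_add, map_add,
    D.form_V₀_V₁ x.2 h₁, D.form_V₀_V₁' x.2 h₂]
  simp [LinearMap.domRestrict₁₂_apply]

theorem form_coe_right (hS : B.IsSymm) (x : V) (y : D.V₀) :
    B x (y : V) = B.domRestrict₁₂ D.V₀ D.V₀ (D.proj x) y := by
  rw [← hS.eq, D.form_coe_left, (hS.domRestrict D.V₀).eq]

theorem form_eq_zero_of_mem_V₁ {x y : V} (hx : x ∈ D.V₁ ⊔ D.V₀) (hy : y ∈ D.V₁) : B x y = 0 := by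
  obtain ⟨x₁, h₁, x₀, h₀, rfl⟩ := Submodule.mem_sup.1 hx
  rw [map_add, LinearMap.add_apply, D.isotropic _ h₁ _ hy, D.form_V₀_V₁ h₀ hy, add_zero]

/-- The self-adjoint endomorphism `x ↦ ∑ s, (u s, x) f s + (f s, x) u s`. -/
def rankTwoSum (B : V →ₗ⋆[ℂ] V →ₗ[ℂ] ℂ) (u f : σ → V) : Module.End ℂ V :=
  ∑ s, ((B (u s)).smulRight (f s) + (B (f s)).smulRight (u s))

theorem rankTwoSum_apply (u f : σ → V) (x : V) :
    rankTwoSum B u f x = ∑ s, (B (u s) x • f s + B (f s) x • u s) := by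
  simp [rankTwoSum]

theorem rankTwoSum_selfAdjoint (hS : B.IsSymm) (u f : σ → V) (x y : V) :
    B (rankTwoSum B u f x) y = B x (rankTwoSum B u f y) := by
  rw [rankTwoSum_apply, rankTwoSum_apply, map_sum, LinearMap.sum_apply, map_sum]
  refine Finset.sum_congr rfl fun s _ => ?_
  simp only [map_add, LinearMap.map_smulₛₗ, LinearMap.add_apply, LinearMap.smul_apply, smul_eq_mul,
    hS.eq, RingHom.id_apply]
  ring

/-- The lift of `e` given by vectors `u s` and `f s`. -/
def liftOf (e : Module.End ℂ D.V₀) (u f : σ → V) : Module.End ℂ V :=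
  D.V₀.subtype ∘ₗ e ∘ₗ D.proj - Complex.I • rankTwoSum B u f

theorem I_smul_liftOf_apply (e : Module.End ℂ D.V₀) (u f : σ → V) (x : V) :
    (Complex.I • D.liftOf e u f) x =
      ((Complex.I • e) (D.proj x) : V) + ∑ s, (B (u s) x • f s + B (f s) x • u s) := by
  rw [← rankTwoSum_apply]
  simp only [liftOf, smul_sub, smul_smul, Complex.I_mul_I, neg_smul, one_smul, sub_neg_eq_add]
  rfl

theorem isLift_liftOf (hS : B.IsSymm) {e : Module.End ℂ D.V₀}
    (he : ∀ x y, B.domRestrict₁₂ D.V₀ D.V₀ (e x) y + B.domRestrict₁₂ D.V₀ D.V₀ x (e y) = 0)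
    {u f : σ → V} (hu : ∀ s, u s ∈ D.V₁ ⊔ D.V₀) (hf : ∀ s, f s ∈ D.V₁) :
    D.IsLift e (D.liftOf e u f) := by
  have hfQ : ∀ s, f s ∈ D.V₁ ⊔ D.V₀ := fun s => Submodule.mem_sup_left (hf s)
  have apply : ∀ x, D.liftOf e u f x =
      (e (D.proj x) : V) - Complex.I • ∑ s, (B (u s) x • f s + B (f s) x • u s) := fun x => by
    rw [← rankTwoSum_apply]; rfl
  refine ⟨fun x y => ?_, fun x hx => ?_, fun x => ?_, fun x => ?_⟩
  · have h1 := he (D.proj x) (D.proj y)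
    have h2 := rankTwoSum_selfAdjoint hS u f x y
    rw [← D.form_coe_left, ← D.form_coe_right hS] at h1
    simp only [apply, ← rankTwoSum_apply, map_sub, LinearMap.sub_apply, LinearMap.map_smulₛₗ,
      LinearMap.smul_apply, smul_eq_mul, Complex.conj_I, RingHom.id_apply]
    linear_combination h1 + Complex.I * h2
  · rw [apply, D.proj_of_mem_V₁ hx, map_zero, Finset.sum_eq_zero]
    · simp
    · intro s _
      rw [D.form_eq_zero_of_mem_V₁ (hu s) hx, D.form_eq_zero_of_mem_V₁ (hfQ s) hx]
      simp
  · rw [apply, D.proj_of_mem_V₀ x.2]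
    have : ∀ s, B (f s) x = 0 := fun s => D.form_V₁_V₀ hS (hf s) x.2
    simp only [this, zero_smul, add_zero, sub_sub_cancel_left]
    exact neg_mem (Submodule.smul_mem _ _ (Submodule.sum_mem _ fun s _ =>
      Submodule.smul_mem _ _ (hf s)))
  · rw [apply]
    exact sub_mem (Submodule.mem_sup_right (e _).2) (Submodule.smul_mem _ _
      (Submodule.sum_mem _ fun s _ => add_mem (Submodule.smul_mem _ _ (hfQ s))
        (Submodule.smul_mem _ _ (hu s))))

/-- Up to a multiple of f t, the lift sends f' t to u t. This prepends f' t to the string generated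
by u t, and the adjoint term appends a vector at its end. -/
theorem I_smul_liftOf_apply_dual (e : Module.End ℂ D.V₀) {u f f' : σ → V}
    (hu : ∀ s t, B (u s) (f' t) = 0 ∨ s = t) (hf' : ∀ s, f' s ∈ D.V₁')
    (hff' : ∀ s, B (f s) (f' s) = 1) (hne : ∀ s t, s ≠ t → B (f s) (f' t) = 0) (t : σ) :
    (Complex.I • D.liftOf e u f) (f' t) = B (u t) (f' t) • f t + u t := by
  have h : D.proj (f' t) = 0 :=
    (Submodule.projectionOnto_apply_eq_zero_iff D.isCompl).2 (Submodule.mem_sup_right (hf' t))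
  rw [I_smul_liftOf_apply, h, Finset.sum_eq_single t]
  · simp [hff']
  · intro s _ hs
    rw [(hu s t).resolve_right hs, hne s t hs]
    simp
  · simp

section Enlarge

variable {ι : Type*} {e : Module.End ℂ D.V₀}
  (J : JordanFamily (B.domRestrict₁₂ D.V₀ D.V₀) (Complex.I • e) ι) (n : ℕ)
  {S : Finset (ι ⊕ (Fin n × ℤˣ))}

/-- The vectors of `V₁ ⊕ V₀` used for the lift: generators of Jordan strings that are to be
lengthened, and multiples of vectors in `V₁` to create strings of length two. -/
def liftVec (f : {s // s ∈ S} → V) (s : {s // s ∈ S}) : V :=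
  Sum.elim (fun i => (J.vec i : V)) (fun k => (((k.2 : ℤ) : ℂ) / 2) • f s) s.1

/-- The image of a vector in `V₁'` under the lift. -/
def liftImage (f : {s // s ∈ S} → V) (s : {s // s ∈ S}) : V :=
  Sum.elim (fun i => (J.vec i : V)) (fun k => ((k.2 : ℤ) : ℂ) • f s) s.1

-- The vectors f' s generate the lengthened strings: the image of f' s is the old generator or, for
-- an empty row, ±f s. Strings outside `S` are orthogonal to every vector of the rank-two terms and
-- stay unchanged.
open Classical in
theorem exists_jordanFamily_liftOf [FiniteDimensional ℂ V] [Fintype ι] (hS : B.IsSymm)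
    (he : ∀ x y, B.domRestrict₁₂ D.V₀ D.V₀ (e x) y + B.domRestrict₁₂ D.V₀ D.V₀ x (e y) = 0)
    {f f' : {s // s ∈ S} → V} (hf : ∀ s, f s ∈ D.V₁) (hf' : ∀ s, f' s ∈ D.V₁')
    (hff' : ∀ s, B (f s) (f' s) = 1) (hne : ∀ s t, s ≠ t → B (f s) (f' t) = 0) :
    ∃ J' : JordanFamily B (Complex.I • D.liftOf e (D.liftVec J n f) f)
        ({s // s ∈ S} ⊕ {i : ι // i ∈ Finset.univ.filter fun i : ι => Sum.inl i ∉ S}),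
      (∀ s, J'.len (Sum.inl s) = rowLen J.len n s + 2) ∧ (∀ i, J'.len (Sum.inr i) = J.len i) ∧
      (∀ s, J'.sgn (Sum.inl s) = rowSgn J.sgn n s) ∧ (∀ i, J'.sgn (Sum.inr i) = J.sgn i) := by
  have huQ : ∀ s, D.liftVec J n f s ∈ D.V₁ ⊔ D.V₀ := by
    rintro ⟨i | k, hs⟩
    · exact Submodule.mem_sup_right (J.vec i).2
    · exact Submodule.mem_sup_left (Submodule.smul_mem _ _ (hf _))
  have hlift := D.isLift_liftOf hS he huQ hf
  have hN := smul_I_selfAdjoint hlift.skew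
  set N := Complex.I • D.liftOf e (D.liftVec J n f) f with hNdef
  have hf'f : ∀ s t, s ≠ t → B (f' s) (f t) = 0 := fun s t h => by
    rw [← hS.eq, hne t s h.symm, map_zero]
  have hf'fs : ∀ s, B (f' s) (f s) = 1 := fun s => by rw [← hS.eq, hff', map_one]
  have hN1 : ∀ s, N (f' s) = D.liftImage J n f s := by
    intro t
    rw [hNdef, D.I_smul_liftOf_apply_dual e ?_ hf' hff' hne]
    · obtain ⟨i | k, hs⟩ := t
      · change B (J.vec i : V) _ • _ + (J.vec i : V) = (J.vec i : V)
        rw [D.form_V₀_V₁' (J.vec i).2 (hf' _), zero_smul, zero_add]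
      -- With u = (ε/2) f both rank-two terms contribute (ε/2) f, which is the reason for the factor
      -- 1/2.
      · change B ((((k.2 : ℤ) : ℂ) / 2) • f _) _ • _ + (((k.2 : ℤ) : ℂ) / 2) • f _ =
          ((k.2 : ℤ) : ℂ) • f _
        rw [LinearMap.map_smulₛₗ, LinearMap.smul_apply, hff', ← add_smul]
        congr 1
        simp [Complex.conj_ofNat]
    · rintro ⟨i | k, hs⟩ t
      · exact Or.inl (D.form_V₀_V₁' (J.vec i).2 (hf' t))
      · by_cases h : ⟨Sum.inr k, hs⟩ = t
        · exact Or.inr h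
        · left
          change B ((((k.2 : ℤ) : ℂ) / 2) • f _) _ = 0
          rw [LinearMap.map_smulₛₗ, LinearMap.smul_apply, hne _ _ h, smul_zero]
  have hN0 : ∀ i : ι, Sum.inl i ∉ S → ∀ a,
      (N ^ a) (J.vec i : V) = (((Complex.I • e) ^ a) (J.vec i) : V) := by
    intro i hi a
    induction a with
    | zero => rfl
    | succ a ih =>
      rw [pow_succ', Module.End.mul_apply, ih, hNdef, D.I_smul_liftOf_apply,
        D.proj_of_mem_V₀ (Subtype.prop _), pow_succ', Module.End.mul_apply, Finset.sum_eq_zero]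
      · simp
      · rintro ⟨j | k, hs⟩ -
        · change B (J.vec j : V) _ • _ + B (f _) _ • (J.vec j : V) = 0
          have hij : j ≠ i := by rintro rfl; exact hi hs
          have := J.pairing_ne j i hij a
          rw [LinearMap.domRestrict₁₂_apply] at this
          rw [this, D.form_V₁_V₀ hS (hf _) (Subtype.prop _)]
          simp
        · change B ((((k.2 : ℤ) : ℂ) / 2) • f _) _ • _ + B (f _) _ • _ = 0
          rw [LinearMap.map_smulₛₗ, LinearMap.smul_apply,
            D.form_V₁_V₀ hS (hf _) (Subtype.prop _)]
          simp
  -- From the second power on, pairings of the new generators are pairings of old strings at a power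
  -- lower by two; hence length + 2 with the same sign.
  have pair2 : ∀ s t b, B (f' s) ((N ^ (b + 2)) (f' t)) =
      B.domRestrict₁₂ D.V₀ D.V₀ (D.proj (D.liftImage J n f s))
        (((Complex.I • e) ^ b) (D.proj (D.liftImage J n f t))) := by
    intro s t b
    rw [← hN1, ← hN1]
    exact hlift.form_smul_pow_add_two hS _ _ b
  have projl : ∀ i hs, D.proj (D.liftImage J n f ⟨Sum.inl i, hs⟩) = J.vec i := fun i hs =>
    D.proj_of_mem_V₀ (J.vec i).2
  have projr : ∀ k hs, D.proj (D.liftImage J n f ⟨Sum.inr k, hs⟩) = 0 := fun k hs =>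
    D.proj_of_mem_V₁ (Submodule.smul_mem _ _ (hf _))
  have pair1 : ∀ s i hs, B (f' s) (D.liftImage J n f ⟨Sum.inl i, hs⟩) = 0 := fun s i hs =>
    D.form_V₁'_V₀ hS (hf' s) (J.vec i).2
  have cross : ∀ (s : {s // s ∈ S}) (i : ι), Sum.inl i ∉ S → ∀ a,
      B (f' s) ((N ^ a) (J.vec i : V)) = 0 := by
    intro s i hi a
    rw [hN0 i hi]
    exact D.form_V₁'_V₀ hS (hf' s) (Subtype.prop _)
  have self : ∀ s a, B (f' s) ((N ^ a) (f' s)) =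
      if a + 1 = rowLen J.len n s + 2 then ((rowSgn J.sgn n s : ℤ) : ℂ) else 0 := by
    intro s a
    rcases a with _ | _ | b
    · rw [pow_zero, Module.End.one_apply, D.isotropic' _ (hf' s) _ (hf' s), if_neg (by omega)]
    · rw [zero_add, pow_one, hN1]
      obtain ⟨i | k, hs⟩ := s
      · rw [pair1, if_neg]
        have := J.len_pos i
        simp only [rowLen, Sum.elim_inl]
        omega
      · change B _ (((k.2 : ℤ) : ℂ) • f _) = _
        rw [map_smul, hf'fs, if_pos (by simp [rowLen])]
        simp [rowSgn]
    · rw [add_assoc, pair2]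
      obtain ⟨i | k, hs⟩ := s
      · rw [projl, J.pairing_self]
        simp only [rowLen, rowSgn, Sum.elim_inl]
        congr 1
        rw [eq_iff_iff]
        omega
      · rw [projr, if_neg]
        · simp
        · simp [rowLen]
  refine ⟨{
    len := Sum.elim (fun s => rowLen J.len n s + 2) fun i => J.len i
    sgn := Sum.elim (fun s => rowSgn J.sgn n s) fun i => J.sgn i
    vec := Sum.elim f' fun i => (J.vec i : V)
    len_pos := ?_
    pairing_self := ?_
    pairing_ne := ?_ }, fun _ => rfl, fun _ => rfl, fun _ => rfl, fun _ => rfl⟩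
  · rintro (s | i)
    · exact Nat.succ_pos _
    · exact J.len_pos i
  · rintro (s | ⟨i, hi⟩) a
    · exact self s a
    · simp only [Sum.elim_inr]
      have hi' := (Finset.mem_filter.1 hi).2
      rw [hN0 i hi']
      exact J.pairing_self i a
  · rintro (s | ⟨i, hi⟩) (t | ⟨j, hj⟩) hst a
    · have hst' : s ≠ t := fun h => hst (by rw [h])
      simp only [Sum.elim_inl]
      rcases a with _ | _ | b
      · exact D.isotropic' _ (hf' s) _ (hf' t)
      · rw [zero_add, pow_one, hN1]
        obtain ⟨i | k, ht⟩ := t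
        · exact pair1 _ _ _
        · change B _ (((k.2 : ℤ) : ℂ) • f _) = _
          rw [map_smul, hf'f _ _ hst', smul_zero]
      · rw [add_assoc, pair2]
        obtain ⟨i | k, hs⟩ := s
        · obtain ⟨j | k, ht⟩ := t
          · rw [projl, projl]
            exact J.pairing_ne i j (fun h => hst' (by subst h; rfl)) b
          · rw [projr, map_zero, map_zero]
        · rw [projr, map_zero, LinearMap.zero_apply]
    · exact cross s j (Finset.mem_filter.1 hj).2 a
    · change B (J.vec i : V) ((N ^ a) (f' t)) = 0
      rw [← form_pow_apply hN, ← hS.eq, cross t i (Finset.mem_filter.1 hi).2 a, map_zero]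
    · change B (J.vec i : V) ((N ^ a) (J.vec j : V)) = 0
      rw [hN0 j (Finset.mem_filter.1 hj).2]
      exact J.pairing_ne i j (fun h => hst (by subst h; rfl)) a

end Enlarge

end RealFlag
end Lift

/-! ### Semicontinuity -/

section Semicontinuity

variable {V : Type*} [NormedAddCommGroup V] [NormedSpace ℂ V]

theorem I_smul_pow_apply (E : V →L[ℂ] V) (k : ℕ) (x : V) :
    ((Complex.I • (E : V →ₗ[ℂ] V)) ^ k) x = Complex.I ^ k • (E ^ k) x := by
  rw [smul_pow, LinearMap.smul_apply, ← ContinuousLinearMap.toLinearMap_pow]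
  rfl

variable [FiniteDimensional ℂ V]

theorem continuous_form (B : V →ₗ⋆[ℂ] V →ₗ[ℂ] ℂ) : Continuous fun z : V × V => B z.1 z.2 := by
  let L : V →ₗ[ℝ] (V →L[ℂ] ℂ) :=
    { toFun := fun x => LinearMap.toContinuousLinearMap (B x)
      map_add' := fun x y => by rw [map_add, map_add]
      map_smul' := fun r x => by
        ext y
        have : B (r • x) = r • B x := by
          rw [← Complex.coe_smul, LinearMap.map_smulₛₗ, Complex.conj_ofReal, Complex.coe_smul]
        simp [this] }
  have hL : Continuous L := L.continuous_of_finiteDimensional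
  exact (hL.comp continuous_fst).clm_apply continuous_snd

/-- A subspace that is definite for E₀ stays definite nearby, since positivity on its compact unit
sphere is an open condition. -/
theorem eventually_powInertia_le (B : V →ₗ⋆[ℂ] V →ₗ[ℂ] ℂ) (E₀ : V →L[ℂ] V) (k : ℕ) (ε : ℤˣ) :
    ∀ᶠ E : V →L[ℂ] V in 𝓝 E₀,
      powInertia B (E₀ : V →ₗ[ℂ] V) k ε ≤ powInertia B (E : V →ₗ[ℂ] V) k ε := by
  obtain ⟨W, -, hW, hWd⟩ := exists_finrank_eq_inertia ⊤
    (B.compl₂ ((Complex.I • (E₀ : V →ₗ[ℂ] V)) ^ k)) ε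
  have hcont : Continuous fun z : (V →L[ℂ] V) × V =>
      ((ε : ℤ) : ℝ) * (B z.2 (Complex.I ^ k • (z.1 ^ k) z.2)).re := by
    refine continuous_const.mul (Complex.continuous_re.comp ((continuous_form B).comp
      (continuous_snd.prodMk (Continuous.const_smul ?_ _))))
    exact (continuous_fst.pow k).clm_apply continuous_snd
  have hcomp : IsCompact ((W : Set V) ∩ Metric.sphere 0 1) := by
    have : ProperSpace V := FiniteDimensional.proper ℂ V
    exact (isCompact_sphere 0 1).inter_left W.closed_of_finiteDimensional
  have h := hcomp.eventually_forall_of_forall_eventually (x₀ := E₀)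
    (P := fun E w => 0 < ((ε : ℤ) : ℝ) * (B w (Complex.I ^ k • (E ^ k) w)).re) (by
      rintro w ⟨hw, hw1⟩
      refine hcont.continuousAt.eventually (lt_mem_nhds ?_)
      have := hW w hw (by rintro rfl; simp at hw1)
      rwa [LinearMap.compl₂_apply, I_smul_pow_apply] at this)
  filter_upwards [h] with E hE
  unfold powInertia
  rw [← hWd]
  refine finrank_le_inertia le_top fun w hw hw0 => ?_
  have hn : ‖w‖ ≠ 0 := norm_ne_zero_iff.2 hw0
  have h1 := hE (((‖w‖⁻¹ : ℝ) : ℂ) • w) ⟨W.smul_mem _ hw, by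
    simp [norm_smul, hn]⟩
  rw [LinearMap.compl₂_apply, I_smul_pow_apply]
  have e : ∀ (c : ℝ) (v : V), B ((c : ℂ) • w) ((c : ℂ) • v) = ((c * c : ℝ) : ℂ) * B w v := by
    intro c v
    rw [map_smul (B _), LinearMap.map_smulₛₗ, LinearMap.smul_apply, Complex.conj_ofReal,
      smul_eq_mul, smul_eq_mul, ← mul_assoc, Complex.ofReal_mul]
  rw [map_smul (E ^ k), smul_comm (Complex.I ^ k), e, Complex.re_ofReal_mul, mul_left_comm] at h1
  exact (mul_pos_iff_of_pos_left (mul_pos (by positivity) (by positivity))).1 h1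

/-- An r × r minor of the k-th power that is nonzero at t = 1 is analytic in t, so its zeros cannot
accumulate at 0. -/
theorem eventually_rank_line_ge (X Y : V →L[ℂ] V) (k r : ℕ)
    (hr : finrank ℂ (LinearMap.range (((X + Y : V →L[ℂ] V) : V →ₗ[ℂ] V) ^ k)) = r) :
    ∀ᶠ t : ℝ in 𝓝[≠] 0,
      r ≤ finrank ℂ (LinearMap.range (((X + t • Y : V →L[ℂ] V) : V →ₗ[ℂ] V) ^ k)) := by
  let A : ℝ → V →L[ℂ] V := fun t => (X + t • Y) ^ k
  have hA : ∀ t, ((X + t • Y : V →L[ℂ] V) : V →ₗ[ℂ] V) ^ k = (A t : V →ₗ[ℂ] V) := fun t =>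
    (ContinuousLinearMap.toLinearMap_pow _ _).symm
  have hA1 : ((X + Y : V →L[ℂ] V) : V →ₗ[ℂ] V) ^ k = (A 1 : V →ₗ[ℂ] V) := by
    rw [← hA, one_smul]
  rw [hA1] at hr
  let R := LinearMap.range (A 1 : V →ₗ[ℂ] V)
  let b : Basis (Fin r) ℂ R := finBasisOfFinrankEq ℂ R hr
  choose p hp using fun i => (b i).2
  obtain ⟨π, hπ⟩ := R.subtype.exists_leftInverse_of_injective R.ker_subtype
  let q : Fin r → V →L[ℂ] ℂ := fun i =>
    LinearMap.toContinuousLinearMap ((b.coord i) ∘ₗ π)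
  -- The columns are the images of preimages p j, in coordinates of the range at t = 1; hence M 1 is
  -- the identity.
  let M : ℝ → Matrix (Fin r) (Fin r) ℂ := fun t i j => q i (A t (p j))
  have hM1 : M 1 = 1 := by
    ext i j
    have h1 : A 1 (p j) = R.subtype (b j) := hp j
    have h2 : π (R.subtype (b j)) = b j := LinearMap.congr_fun hπ (b j)
    change b.coord i (π (A 1 (p j))) = _
    rw [h1, h2, Basis.coord_apply, Basis.repr_self, Matrix.one_apply, Finsupp.single_apply]
    simp [eq_comm]
  have hentry : ∀ i j, AnalyticOnNhd ℝ (fun t => M t i j) Set.univ := by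
    intro i j
    have h1 : AnalyticOnNhd ℝ A Set.univ := by
      intro t _
      exact (analyticAt_const.add (analyticAt_id.smul analyticAt_const)).pow k
    let ℓ : (V →L[ℂ] V) →L[ℝ] ℂ :=
      ((q i).comp (ContinuousLinearMap.apply ℂ V (p j))).restrictScalars ℝ
    exact fun t ht => (ℓ.analyticAt _).comp (h1 t ht)
  have hdet : AnalyticOnNhd ℝ (fun t => (M t).det) Set.univ := by
    intro t _
    simp only [Matrix.det_apply]
    refine Finset.analyticAt_fun_sum _ fun σ _ => ?_
    have : AnalyticAt ℝ (fun t => ∏ i, M t (σ i) i) t :=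
      Finset.analyticAt_fun_prod _ fun i _ => hentry (σ i) i t trivial
    simp only [Units.smul_def, zsmul_eq_mul]
    exact analyticAt_const.mul this
  have hne : ∀ᶠ t : ℝ in 𝓝[≠] 0, (M t).det ≠ 0 := by
    by_contra hcon
    have hfreq : ∃ᶠ t : ℝ in 𝓝[≠] 0, (M t).det = 0 := by
      rw [Filter.Frequently]; exact hcon
    have := hdet.eqOn_zero_of_preconnected_of_frequently_eq_zero isPreconnected_univ
      (Set.mem_univ (0 : ℝ)) hfreq (Set.mem_univ (1 : ℝ))
    simp [hM1] at this
  filter_upwards [hne] with t ht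
  rw [hA]
  have hli : LinearIndependent ℂ fun j => A t (p j) := by
    rw [Fintype.linearIndependent_iff]
    intro c hc
    have : (M t).mulVec c = 0 := by
      ext i
      have := congrArg (q i) hc
      simp only [map_sum, map_smul, map_zero, smul_eq_mul] at this
      simp only [Matrix.mulVec, dotProduct, Pi.zero_apply, M]
      rw [← this]
      exact Finset.sum_congr rfl fun j _ => mul_comm _ _
    exact congrFun (Matrix.eq_zero_of_mulVec_eq_zero ht this)
  have := card_le_finrank_of_mem hli (U := LinearMap.range (A t : V →ₗ[ℂ] V)) fun j => ⟨p j, rfl⟩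
  simpa using this

end Semicontinuity

/-! ### Tableaux and ranks of lifts -/

section LiftTableau

theorem sum_enlargedLen {ι M : Type*} [Fintype ι] [AddCommMonoid M] {len : ι → ℕ} {sgn : ι → ℤˣ}
    {n : ℕ} (S : Finset (ι ⊕ (Fin n × ℤˣ))) (F : ℕ → ℤˣ → M) (hF : ∀ ε, F 0 ε = 0)
    (S' : Finset ι) (hS' : ∀ i, i ∈ S' ↔ Sum.inl i ∉ S) :
    ∑ s : {s // s ∈ S}, F (rowLen len n s + 2) (rowSgn sgn n s) +
      ∑ i : {i // i ∈ S'}, F (len i) (sgn i) =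
        ∑ x, F (enlargedLen len n S x) (rowSgn sgn n x) := by
  classical
  have h : ∀ x, F (enlargedLen len n S x) (rowSgn sgn n x) =
      (if x ∈ S then F (rowLen len n x + 2) (rowSgn sgn n x) else 0) +
        if x ∈ S then 0 else F (rowLen len n x) (rowSgn sgn n x) := by
    intro x
    unfold enlargedLen
    split_ifs <;> simp
  rw [Finset.sum_congr rfl fun x _ => h x, Finset.sum_add_distrib]
  congr 1
  · rw [Finset.sum_coe_sort S fun s => F (rowLen len n s + 2) (rowSgn sgn n s), Finset.sum_ite_mem,
      Finset.univ_inter]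
  · rw [Finset.sum_coe_sort S' fun i => F (len i) (sgn i), Fintype.sum_sum_type]
    simp only [rowLen, rowSgn, Sum.elim_inl, Sum.elim_inr, hF, ite_self, Finset.sum_const_zero,
      add_zero]
    rw [← Finset.sum_filter_add_sum_filter_not Finset.univ fun i => Sum.inl i ∈ S,
      Finset.sum_eq_zero fun i hi => if_pos (Finset.mem_filter.1 hi).2, zero_add]
    refine Finset.sum_congr (by ext i; simp [hS']) fun i hi => ?_
    rw [if_neg (Finset.mem_filter.1 hi).2]

variable {V : Type*} [NormedAddCommGroup V] [NormedSpace ℂ V] [FiniteDimensional ℂ V]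
  {B : V →ₗ⋆[ℂ] V →ₗ[ℂ] ℂ} (hS : B.IsSymm) (hB : B.Nondegenerate) {D : RealFlag B}
  {e : Module.End ℂ D.V₀} {ι : Type*} [Fintype ι]

namespace RealFlag

include hS hB

/-- Any dim V₁ rows may be lengthened by a lift; that they are the largest matters only for the
maximality of the ranks. -/
theorem exists_isLift_of_card (he : ∀ x y, B.domRestrict₁₂ D.V₀ D.V₀ (e x) y +
      B.domRestrict₁₂ D.V₀ D.V₀ x (e y) = 0)
    (J : JordanFamily (B.domRestrict₁₂ D.V₀ D.V₀) (Complex.I • e) ι)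
    (hJ : ∑ i, J.len i = finrank ℂ D.V₀)
    {S : Finset (ι ⊕ (Fin (finrank ℂ D.V₁) × ℤˣ))} (hcard : S.card = finrank ℂ D.V₁) :
    ∃ X, D.IsLift e X ∧
      (signedTableau B X).rows = enlargedRows J.len J.sgn (finrank ℂ D.V₁) S ∧
      (∀ k, finrank ℂ (LinearMap.range (X ^ k)) =
        ∑ x, (enlargedLen J.len (finrank ℂ D.V₁) S x - k)) ∧
      ∀ k δ, powInertia B X k δ = ∑ x, stringIndex (enlargedLen J.len (finrank ℂ D.V₁) S x)
        (rowSgn J.sgn (finrank ℂ D.V₁) x) δ k := by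
  classical
  obtain ⟨g, g', hg, hg', hgg'⟩ := D.exists_dual_bases hB
  let φ := S.equivFinOfCardEq hcard
  obtain ⟨J', hl1, hl2, hs1, hs2⟩ := D.exists_jordanFamily_liftOf J (finrank ℂ D.V₁) hS he
    (f := fun s => g (φ s)) (f' := fun s => g' (φ s)) (fun s => hg _) (fun s => hg' _)
    (fun s => by rw [hgg', if_pos rfl])
    (fun s t h => by rw [hgg', if_neg fun h' => h (φ.injective h')])
  have hlift : D.IsLift e
      (D.liftOf e (D.liftVec J (finrank ℂ D.V₁) fun s => g (φ s)) fun s => g (φ s)) := by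
    refine D.isLift_liftOf hS he ?_ (fun s => hg _)
    rintro ⟨i | k, hs⟩
    · exact Submodule.mem_sup_right (J.vec i).2
    · exact Submodule.mem_sup_left (Submodule.smul_mem _ _ (hg _))
  have hsum : ∀ {M : Type} [AddCommMonoid M] (F : ℕ → ℤˣ → M), (∀ ε, F 0 ε = 0) →
      ∑ i, F (J'.len i) (J'.sgn i) = ∑ x, F (enlargedLen J.len (finrank ℂ D.V₁) S x)
        (rowSgn J.sgn (finrank ℂ D.V₁) x) := by
    intro M _ F hF
    rw [Fintype.sum_sum_type]
    simp only [hl1, hl2, hs1, hs2]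
    exact sum_enlargedLen S F hF _ (by simp)
  have hJ' : ∑ i, J'.len i = finrank ℂ V := by
    rw [hsum (fun l _ => l) fun _ => rfl, D.finrank_eq hB, ← hJ]
    have := sum_add_two_sub (L := rowLen J.len (finrank ℂ D.V₁)) hcard (k := 0)
      fun s _ => Nat.zero_le _
    rw [sum_rowLen_sub] at this
    simp only [Nat.sub_zero] at this
    rw [← this]
    exact Finset.sum_congr rfl fun x _ => by simp only [enlargedLen]
  refine ⟨_, hlift, ?_, fun k => ?_, fun k δ => ?_⟩
  · rw [J'.signedTableau_rows hB hlift.skew hJ', map_val_eq_toLeft_add_toRight, enlargedRows]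
    simp only [hl1, hl2, hs1, hs2, Finset.toLeft_univ, Finset.toRight_univ]
    congr 1
    · exact Multiset.attach_map_val' S.val fun s => alternatingRow
        (rowSgn J.sgn (finrank ℂ D.V₁) s) (rowLen J.len (finrank ℂ D.V₁) s + 2)
    · exact Multiset.attach_map_val' _ fun i => alternatingRow (J.sgn i) (J.len i)
  · rw [J'.finrank_range_pow_eq hB hlift.skew hJ']
    exact hsum (fun l _ => l - k) fun _ => Nat.zero_sub k
  · rw [J'.powInertia_eq hB hlift.skew hJ']
    exact hsum (fun l ε => stringIndex l ε δ k) fun _ => stringIndex_zero _ _ _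

theorem IsLift.finrank_range_pow_le {F : Module.End ℂ V} (hF : D.IsLift e F)
    (henil : IsNilpotent e) (he : ∀ x y, B.domRestrict₁₂ D.V₀ D.V₀ (e x) y +
      B.domRestrict₁₂ D.V₀ D.V₀ x (e y) = 0)
    (J : JordanFamily (B.domRestrict₁₂ D.V₀ D.V₀) (Complex.I • e) ι)
    (hJ : ∑ i, J.len i = finrank ℂ D.V₀)
    {S : Finset (ι ⊕ (Fin (finrank ℂ D.V₁) × ℤˣ))}
    (hlarge : IsLargestRows J.len (finrank ℂ D.V₁) S) (k : ℕ) :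
    finrank ℂ (LinearMap.range (F ^ k)) ≤ ∑ x, (enlargedLen J.len (finrank ℂ D.V₁) S x - k) := by
  have hB0 := D.nondegenerate_V₀ hS hB
  have hsum := fun k => powInertia_add_powInertia (hS.domRestrict D.V₀) hB0 he henil k
  have hsumF := fun k => powInertia_add_powInertia hS hB hF.skew (hF.isNilpotent hS hB henil) k
  refine hlarge.le_sum_enlargedLen_sub (fun k => finrank ℂ (LinearMap.range (F ^ k)))
    (fun k => ?_) (fun k => ?_) (fun k => ?_) k
  · have h1 := hF.powInertia_le_add hS hB k 1
    have h2 := hF.powInertia_le_add hS hB k (-1)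
    have h3 := hsum k
    have h4 := hsumF k
    rw [← J.finrank_range_pow_eq hB0 he hJ]
    omega
  · rw [← J.finrank_range_pow_eq hB0 he hJ]
    exact hF.finrank_range_pow_succ_le k
  · have h1 := hF.powInertia_add_two_le hS k 1
    have h2 := hF.powInertia_add_two_le hS k (-1)
    have h3 := hsum k
    have h4 := hsumF (k + 2)
    rw [← J.finrank_range_pow_eq hB0 he hJ]
    omega

theorem exists_isLift_of_addTwoBoxes (henil : IsNilpotent e)
    (he : ∀ x y, B.domRestrict₁₂ D.V₀ D.V₀ (e x) y + B.domRestrict₁₂ D.V₀ D.V₀ x (e y) = 0)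
    {T' : SignedTableau} (h : AddTwoBoxes (finrank ℂ D.V₁)
      (signedTableau (B.domRestrict₁₂ D.V₀ D.V₀) e) T') :
    ∃ X, D.IsLift e X ∧ signedTableau B X = T' ∧ ∀ F, D.IsLift e F → ∀ k,
      finrank ℂ (LinearMap.range (F ^ k)) ≤ finrank ℂ (LinearMap.range (X ^ k)) := by
  have hB0 := D.nondegenerate_V₀ hS hB
  obtain ⟨ι, _, J, hJ⟩ := exists_jordanFamily (hS.domRestrict D.V₀) hB0 (smul_I_selfAdjoint he)
    (isNilpotent_I_smul henil)
  obtain ⟨S, hlarge, hT'⟩ := exists_isLargestRows_of_addTwoBoxes J.len_pos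
    (J.signedTableau_rows hB0 he hJ) h
  obtain ⟨X, hX, hXT, hXr, -⟩ := exists_isLift_of_card hS hB he J hJ hlarge.1
  refine ⟨X, hX, SignedTableau.ext (hXT.trans hT'.symm), fun F hF k => ?_⟩
  rw [hXr]
  exact hF.finrank_range_pow_le hS hB henil he J hJ hlarge k

/-- Comparison with explicit lifts shows that the ranks attain their bounds, so the index
inequalities single out some `S`. The lift built from this `S` has the same indices as X, hence the
same tableau. -/
theorem IsLift.addTwoBoxes_of_forall_finrank_range_le {X : Module.End ℂ V} (hX : D.IsLift e X)
    (henil : IsNilpotent e)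
    (he : ∀ x y, B.domRestrict₁₂ D.V₀ D.V₀ (e x) y + B.domRestrict₁₂ D.V₀ D.V₀ x (e y) = 0)
    (hmax : ∀ F, D.IsLift e F → ∀ k,
      finrank ℂ (LinearMap.range (F ^ k)) ≤ finrank ℂ (LinearMap.range (X ^ k))) :
    AddTwoBoxes (finrank ℂ D.V₁) (signedTableau (B.domRestrict₁₂ D.V₀ D.V₀) e)
      (signedTableau B X) := by
  have hB0 := D.nondegenerate_V₀ hS hB
  obtain ⟨ι, _, J, hJ⟩ := exists_jordanFamily (hS.domRestrict D.V₀) hB0 (smul_I_selfAdjoint he)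
    (isNilpotent_I_smul henil)
  have hXnil := hX.isNilpotent hS hB henil
  obtain ⟨S, hlarge, hS'⟩ := exists_isLargestRows_of_index_bounds (len := J.len) (sgn := J.sgn)
    (n := finrank ℂ D.V₁) (fun k δ => powInertia B X k δ)
    (fun k δ => by
      rw [← J.powInertia_eq hB0 he hJ]; exact hX.powInertia_le_add hS hB k δ)
    (fun k δ => by
      rw [← J.powInertia_eq hB0 he hJ]; exact hX.powInertia_add_two_le hS k δ)
    (fun S hlarge k => by
      rw [powInertia_add_powInertia hS hB hX.skew hXnil]
      obtain ⟨Y, hY, -, hYr, -⟩ := exists_isLift_of_card hS hB he J hJ hlarge.1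
      exact le_antisymm (hX.finrank_range_pow_le hS hB henil he J hJ hlarge k)
        (hYr k ▸ hmax Y hY k))
  obtain ⟨Y, hY, hYT, -, hYp⟩ := exists_isLift_of_card hS hB he J hJ hlarge.1
  have hXY : signedTableau B X = signedTableau B Y :=
    signedTableau_eq_of_powInertia_eq hS hB hX.skew hY.skew hXnil (hY.isNilpotent hS hB henil)
      fun k δ => (hS' k δ).trans (hYp k δ).symm
  rw [hXY]
  exact addTwoBoxes_of_isLargestRows J.len_pos hlarge (J.signedTableau_rows hB0 he hJ) hYT

theorem finite_setOf_addTwoBoxes (henil : IsNilpotent e)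
    (he : ∀ x y, B.domRestrict₁₂ D.V₀ D.V₀ (e x) y + B.domRestrict₁₂ D.V₀ D.V₀ x (e y) = 0) :
    {T' | AddTwoBoxes (finrank ℂ D.V₁)
      (signedTableau (B.domRestrict₁₂ D.V₀ D.V₀) e) T'}.Finite := by
  have hB0 := D.nondegenerate_V₀ hS hB
  obtain ⟨ι, _, J, hJ⟩ := exists_jordanFamily (hS.domRestrict D.V₀) hB0 (smul_I_selfAdjoint he)
    (isNilpotent_I_smul henil)
  refine Set.Finite.of_finite_image ((Set.finite_range
    (enlargedRows J.len J.sgn (finrank ℂ D.V₁))).subset ?_)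
    (f := SignedTableau.rows) fun T _ T' _ h => SignedTableau.ext h
  rintro _ ⟨T', hT', rfl⟩
  obtain ⟨S, -, h⟩ := exists_isLargestRows_of_addTwoBoxes J.len_pos
    (J.signedTableau_rows hB0 he hJ) hT'
  exact ⟨S, h.symm⟩

theorem exists_isLift_forall_finrank_range_le (henil : IsNilpotent e)
    (he : ∀ x y, B.domRestrict₁₂ D.V₀ D.V₀ (e x) y + B.domRestrict₁₂ D.V₀ D.V₀ x (e y) = 0) :
    ∃ X, D.IsLift e X ∧ ∀ F, D.IsLift e F → ∀ k,
      finrank ℂ (LinearMap.range (F ^ k)) ≤ finrank ℂ (LinearMap.range (X ^ k)) := by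
  have hB0 := D.nondegenerate_V₀ hS hB
  obtain ⟨ι, _, J, hJ⟩ := exists_jordanFamily (hS.domRestrict D.V₀) hB0 (smul_I_selfAdjoint he)
    (isNilpotent_I_smul henil)
  obtain ⟨S, hlarge⟩ := exists_isLargestRows J.len (finrank ℂ D.V₁)
  obtain ⟨X, hX, -, hXr, -⟩ := exists_isLift_of_card hS hB he J hJ hlarge.1
  refine ⟨X, hX, fun F hF k => ?_⟩
  rw [hXr]
  exact hF.finrank_range_pow_le hS hB henil he J hJ hlarge k

end RealFlag
end LiftTableau

/-! ### Adjoint orbits -/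

section Orbits

variable {V : Type*} [NormedAddCommGroup V] [NormedSpace ℂ V]

/-- Conjugation of an endomorphism by an automorphism. -/
def adConj (g : V ≃L[ℂ] V) (X : V →L[ℂ] V) : V →L[ℂ] V :=
  (g : V →L[ℂ] V).comp (X.comp (g.symm : V →L[ℂ] V))

theorem adConj_apply (g : V ≃L[ℂ] V) (X : V →L[ℂ] V) (x : V) : adConj g X x = g (X (g.symm x)) :=
  rfl

theorem adConj_mul (g h : V ≃L[ℂ] V) (X : V →L[ℂ] V) :
    adConj (g * h) X = adConj g (adConj h X) := rfl

theorem adConj_one (X : V →L[ℂ] V) : adConj 1 X = X := rfl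

theorem adConj_add (g : V ≃L[ℂ] V) (X Y : V →L[ℂ] V) :
    adConj g (X + Y) = adConj g X + adConj g Y := by
  ext x; simp [adConj_apply]

theorem adConj_inv_adConj (g : V ≃L[ℂ] V) (X : V →L[ℂ] V) : adConj g⁻¹ (adConj g X) = X := by
  rw [← adConj_mul, inv_mul_cancel, adConj_one]

theorem adConj_adConj_inv (g : V ≃L[ℂ] V) (X : V →L[ℂ] V) : adConj g (adConj g⁻¹ X) = X := by
  rw [← adConj_mul, mul_inv_cancel, adConj_one]

theorem mem_adOrbit_iff {H : Subgroup (V ≃L[ℂ] V)} {X Y : V →L[ℂ] V} :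
    Y ∈ adOrbit H X ↔ ∃ g ∈ H, Y = adConj g X := Iff.rfl

theorem mem_adOrbit_self (H : Subgroup (V ≃L[ℂ] V)) (X : V →L[ℂ] V) : X ∈ adOrbit H X :=
  ⟨1, one_mem H, rfl⟩

theorem adOrbit_eq_of_mem {H : Subgroup (V ≃L[ℂ] V)} {X Y : V →L[ℂ] V} (h : Y ∈ adOrbit H X) :
    adOrbit H Y = adOrbit H X := by
  obtain ⟨g, hg, rfl⟩ := mem_adOrbit_iff.1 h
  ext Z
  rw [mem_adOrbit_iff, mem_adOrbit_iff]
  constructor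
  · rintro ⟨k, hk, rfl⟩
    exact ⟨k * g, mul_mem hk hg, rfl⟩
  · rintro ⟨k, hk, rfl⟩
    refine ⟨k * g⁻¹, mul_mem hk (inv_mem hg), ?_⟩
    rw [adConj_mul]
    rw [adConj_inv_adConj]

theorem isNilpotent_toLinearMap_iff {E : V →L[ℂ] V} :
    IsNilpotent (E : V →ₗ[ℂ] V) ↔ IsNilpotent E := by
  constructor
  · rintro ⟨k, hk⟩
    refine ⟨k, ContinuousLinearMap.coe_injective ?_⟩
    rw [ContinuousLinearMap.toLinearMap_pow, hk]
    rfl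
  · rintro ⟨k, hk⟩
    refine ⟨k, ?_⟩
    rw [← ContinuousLinearMap.toLinearMap_pow, hk]
    rfl

variable {B : V →ₗ⋆[ℂ] V →ₗ[ℂ] ℂ}

theorem form_symm_left {g : V ≃L[ℂ] V} (hg : g ∈ unitaryGroupOf B) (x y : V) :
    B (g x) y = B x (g.symm y) := by
  have := hg x (g.symm y)
  rwa [g.apply_symm_apply] at this

theorem adConj_mem_skewHermitian {g : V ≃L[ℂ] V} (hg : g ∈ unitaryGroupOf B) {X : V →L[ℂ] V}
    (hX : X ∈ skewHermitian B) : adConj g X ∈ skewHermitian B := by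
  intro x y
  have h2 : B x (g (X (g.symm y))) = B (g.symm x) (X (g.symm y)) := by
    rw [← hg (g.symm x), g.apply_symm_apply]
  rw [adConj_apply, adConj_apply, form_symm_left hg, h2]
  exact hX _ _

theorem isNilpotent_adConj {g : V ≃L[ℂ] V} {X : V →L[ℂ] V} (hX : IsNilpotent X) :
    IsNilpotent (adConj g X) := by
  obtain ⟨k, hk⟩ := hX
  have : ∀ k, (adConj g X) ^ k = adConj g (X ^ k) := by
    intro k
    induction k with
    | zero =>
      ext x
      change x = g (g.symm x)
      rw [g.apply_symm_apply]
    | succ k ih =>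
      rw [pow_succ, pow_succ, ih]
      ext x
      change g ((X ^ k) (g.symm (g (X (g.symm x))))) = g ((X ^ k) (X (g.symm x)))
      rw [g.symm_apply_apply]
  refine ⟨k, ?_⟩
  rw [this, hk]
  ext x
  exact map_zero g

variable [FiniteDimensional ℂ V]

theorem powInertia_adConj {g : V ≃L[ℂ] V} (hg : g ∈ unitaryGroupOf B) (X : V →L[ℂ] V) (k : ℕ)
    (ε : ℤˣ) : powInertia B (adConj g X : V →ₗ[ℂ] V) k ε = powInertia B (X : V →ₗ[ℂ] V) k ε := by
  refine (powInertia_congr g.toLinearEquiv hg (fun x => ?_) k ε).symm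
  change g (X x) = g (X (g.symm (g x)))
  rw [g.symm_apply_apply]

variable (hS : B.IsSymm) (hB : B.Nondegenerate)
include hS hB

theorem signedTableau_adConj {g : V ≃L[ℂ] V} (hg : g ∈ unitaryGroupOf B) {X : V →L[ℂ] V}
    (hX : X ∈ skewHermitian B) (hXn : IsNilpotent X) :
    signedTableau B (adConj g X : V →ₗ[ℂ] V) = signedTableau B (X : V →ₗ[ℂ] V) :=
  signedTableau_eq_of_powInertia_eq hS hB (adConj_mem_skewHermitian hg hX) hX
    (isNilpotent_toLinearMap_iff.2 (isNilpotent_adConj hXn)) (isNilpotent_toLinearMap_iff.2 hXn)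
    (powInertia_adConj hg X)

theorem adOrbit_unitaryGroupOf_eq {X : V →L[ℂ] V} (hX : X ∈ skewHermitian B)
    (hXn : IsNilpotent X) : adOrbit (unitaryGroupOf B) X = {Y | Y ∈ skewHermitian B ∧
      IsNilpotent Y ∧ signedTableau B (Y : V →ₗ[ℂ] V) = signedTableau B (X : V →ₗ[ℂ] V)} := by
  ext Y
  constructor
  · rintro ⟨g, hg, rfl⟩
    exact ⟨adConj_mem_skewHermitian hg hX, isNilpotent_adConj hXn,
      signedTableau_adConj hS hB hg hX hXn⟩
  · rintro ⟨hY, hYn, hT⟩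
    obtain ⟨g, hg, hgX⟩ := exists_isometry_of_signedTableau_eq hS hB hX hY
      (isNilpotent_toLinearMap_iff.2 hXn) (isNilpotent_toLinearMap_iff.2 hYn) hT.symm
    refine mem_adOrbit_iff.2 ⟨g.toContinuousLinearEquiv, hg, ?_⟩
    ext x
    have := hgX (g.symm x)
    rw [g.apply_symm_apply] at this
    exact this.symm

theorem finrank_range_pow_adConj {g : V ≃L[ℂ] V} (hg : g ∈ unitaryGroupOf B) {X : V →L[ℂ] V}
    (hX : X ∈ skewHermitian B) (hXn : IsNilpotent X) (k : ℕ) :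
    finrank ℂ (LinearMap.range ((adConj g X : V →ₗ[ℂ] V) ^ k)) =
      finrank ℂ (LinearMap.range ((X : V →ₗ[ℂ] V) ^ k)) := by
  rw [← powInertia_add_powInertia hS hB (adConj_mem_skewHermitian hg hX)
      (isNilpotent_toLinearMap_iff.2 (isNilpotent_adConj hXn)),
    ← powInertia_add_powInertia hS hB hX (isNilpotent_toLinearMap_iff.2 hXn),
    powInertia_adConj hg, powInertia_adConj hg]

/-- Near E no index drops, while the sum of the two, a rank, does not exceed its value at E; so no
index changes. -/
theorem eventually_signedTableau_eq {C : Set (V →L[ℂ] V)}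
    (hC : ∀ X ∈ C, X ∈ skewHermitian B ∧ IsNilpotent X) {E : V →L[ℂ] V} (hE : E ∈ C)
    (hmax : ∀ F ∈ C, ∀ k, finrank ℂ (LinearMap.range ((F : V →ₗ[ℂ] V) ^ k)) ≤
      finrank ℂ (LinearMap.range ((E : V →ₗ[ℂ] V) ^ k))) :
    ∀ᶠ F : V →L[ℂ] V in 𝓝[C] E, signedTableau B (F : V →ₗ[ℂ] V) = signedTableau B (E : V →ₗ[ℂ] V) := by
  obtain ⟨m, hm⟩ := isNilpotent_toLinearMap_iff.2 (hC E hE).2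
  have hEsum := powInertia_add_powInertia hS hB (hC E hE).1
    (isNilpotent_toLinearMap_iff.2 (hC E hE).2)
  -- Only finitely many conditions are needed: for k ≥ m the indices at E vanish.
  have hsmall : ∀ᶠ F : V →L[ℂ] V in 𝓝 E, ∀ k ∈ Finset.range m, ∀ ε ∈ (Finset.univ : Finset ℤˣ),
      powInertia B (E : V →ₗ[ℂ] V) k ε ≤ powInertia B (F : V →ₗ[ℂ] V) k ε := by
    rw [Filter.eventually_all_finset]
    intro k _
    rw [Filter.eventually_all_finset]
    intro ε _
    exact eventually_powInertia_le B E k ε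
  filter_upwards [nhdsWithin_le_nhds hsmall, self_mem_nhdsWithin] with F hF hFC
  have hge : ∀ k ε, powInertia B (E : V →ₗ[ℂ] V) k ε ≤ powInertia B (F : V →ₗ[ℂ] V) k ε := by
    intro k ε
    rcases lt_or_ge k m with hk | hk
    · exact hF k (Finset.mem_range.2 hk) ε (Finset.mem_univ ε)
    · have h := hEsum k
      rw [pow_eq_zero_of_le hk hm, LinearMap.range_zero, finrank_bot] at h
      rcases Int.units_eq_one_or ε with rfl | rfl <;> omega
  refine signedTableau_eq_of_powInertia_eq hS hB (hC F hFC).1 (hC E hE).1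
    (isNilpotent_toLinearMap_iff.2 (hC F hFC).2) (isNilpotent_toLinearMap_iff.2 (hC E hE).2)
    fun k ε => ?_
  have h1 := powInertia_add_powInertia hS hB (hC F hFC).1
    (isNilpotent_toLinearMap_iff.2 (hC F hFC).2) k
  have h2 := hEsum k
  have h3 := hmax F hFC k
  have h4 := hge k 1
  have h5 := hge k (-1)
  rcases Int.units_eq_one_or ε with rfl | rfl <;> omega

end Orbits

/-! ### The set `c + n` -/

section Induction

variable {V : Type*} [NormedAddCommGroup V] [NormedSpace ℂ V] {B : V →ₗ⋆[ℂ] V →ₗ[ℂ] ℂ}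

namespace RealFlag

variable {D : RealFlag B}

theorem levi_map_sup {g : V ≃L[ℂ] V} (hg : g ∈ D.levi) {x : V} (hx : x ∈ D.V₁ ⊔ D.V₀) :
    g x ∈ D.V₁ ⊔ D.V₀ := by
  obtain ⟨x₁, h₁, x₀, h₀, rfl⟩ := Submodule.mem_sup.1 hx
  rw [map_add]
  exact add_mem (Submodule.mem_sup_left ((hg.2.1 _).2 h₁))
    (Submodule.mem_sup_right ((hg.2.2.1 _).2 h₀))

theorem adConj_mem_nilradical {g : V ≃L[ℂ] V} (hg : g ∈ D.levi) {X : V →L[ℂ] V}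
    (hX : X ∈ D.nilradical) : adConj g X ∈ D.nilradical := by
  have hg' : g⁻¹ ∈ D.levi := inv_mem hg
  refine ⟨adConj_mem_skewHermitian hg.1 hX.1, fun x hx => ?_, fun x hx => ?_, fun x => ?_⟩
  · have h : X (g.symm x) = 0 := hX.2.1 _ ((hg'.2.1 x).2 hx)
    rw [adConj_apply, h, map_zero]
  · exact (hg.2.1 _).2 (hX.2.2.1 _ (levi_map_sup hg' hx))
  · exact levi_map_sup hg (hX.2.2.2 _)

variable {e : V →L[ℂ] V} (he : e ∈ skewHermitian B)
  (he₀ : ∀ x ∈ D.V₀, (e : V →ₗ[ℂ] V) x ∈ D.V₀)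
  (he₁ : ∀ x ∈ D.V₁, e x = 0) (he₁' : ∀ x ∈ D.V₁', e x = 0)
include he he₁ he₁'

theorem sub_mem_nilradical_iff (X : V →L[ℂ] V) :
    X - e ∈ D.nilradical ↔ D.IsLift ((e : V →ₗ[ℂ] V).restrict he₀) (X : V →ₗ[ℂ] V) := by
  have heV : ∀ x, e x ∈ D.V₀ := by
    intro x
    obtain ⟨x₁, h₁, x₀, h₀, x₂, h₂, rfl⟩ := D.exists_add_add x
    rw [map_add, map_add, he₁ _ h₁, he₁' _ h₂, zero_add, add_zero]
    exact he₀ x₀ h₀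
  constructor
  · rintro ⟨h1, h2, h3, h4⟩
    refine ⟨fun x y => ?_, fun x hx => ?_, fun x => ?_, fun x => ?_⟩
    · have := h1 x y
      have h := he x y
      simp only [sub_apply, map_sub, LinearMap.sub_apply] at this
      change B (X x) y + B x (X y) = 0
      linear_combination this + h
    · have := h2 x hx
      rwa [sub_apply, he₁ x hx, sub_zero] at this
    · exact h3 x (Submodule.mem_sup_right x.2)
    · have := add_mem (h4 x) (Submodule.mem_sup_right (S := D.V₁) (heV x))
      rwa [sub_apply, sub_add_cancel] at this
  · rintro ⟨h1, h2, h3, h4⟩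
    refine ⟨fun x y => ?_, fun x hx => ?_, fun x hx => ?_, fun x => ?_⟩
    · have h := he x y
      have h' : B (X x) y + B x (X y) = 0 := h1 x y
      simp only [sub_apply, map_sub, LinearMap.sub_apply]
      linear_combination h' - h
    · have : X x = 0 := h2 x hx
      rw [sub_apply, he₁ x hx, this, sub_zero]
    · obtain ⟨x₁, hx₁, x₀, hx₀, rfl⟩ := Submodule.mem_sup.1 hx
      have : X x₁ = 0 := h2 x₁ hx₁
      rw [map_add, sub_apply, sub_apply, he₁ _ hx₁, this,
        sub_zero, zero_add]
      exact h3 ⟨x₀, hx₀⟩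
    · exact sub_mem (h4 x) (Submodule.mem_sup_right (heV x))

/-- The Levi group normalizes the nilradical, so questions about c + n reduce to lifts of the fixed
e. -/
theorem mem_orbitAddNilradical_iff (Y : V →L[ℂ] V) : Y ∈ D.orbitAddNilradical e ↔
    ∃ g ∈ D.levi, ∃ X : V →L[ℂ] V,
      D.IsLift ((e : V →ₗ[ℂ] V).restrict he₀) (X : V →ₗ[ℂ] V) ∧ Y = adConj g X := by
  constructor
  · rintro ⟨a, ⟨g, hg, rfl⟩, b, hb, rfl⟩
    refine ⟨g, hg, e + adConj g⁻¹ b, ?_, ?_⟩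
    · rw [← sub_mem_nilradical_iff he he₀ he₁ he₁', add_sub_cancel_left]
      exact adConj_mem_nilradical (inv_mem hg) hb
    · rw [adConj_add, adConj_adConj_inv]
      rfl
  · rintro ⟨g, hg, X, hX, rfl⟩
    rw [← sub_mem_nilradical_iff he he₀ he₁ he₁'] at hX
    refine ⟨adConj g e, ⟨g, hg, rfl⟩, adConj g (X - e), adConj_mem_nilradical hg hX, ?_⟩
    rw [← adConj_add, add_sub_cancel]

end RealFlag

namespace RealFlag

variable {D : RealFlag B}

theorem IsLift.line {e : Module.End ℂ D.V₀} {X Y : V →L[ℂ] V}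
    (hX : D.IsLift e (X : V →ₗ[ℂ] V)) (hY : D.IsLift e (Y : V →ₗ[ℂ] V)) (t : ℝ) :
    D.IsLift e ((X + t • (Y - X) : V →L[ℂ] V) : V →ₗ[ℂ] V) := by
  have happ : ∀ x, ((X + t • (Y - X) : V →L[ℂ] V) : V →ₗ[ℂ] V) x =
      X x + (t : ℂ) • (Y x - X x) := by
    intro x
    change X x + t • (Y x - X x) = _
    rw [Complex.coe_smul]
  refine ⟨fun x y => ?_, fun x hx => ?_, fun x => ?_, fun x => ?_⟩
  · have h1 : B (X x) y + B x (X y) = 0 := hX.skew x y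
    have h2 : B (Y x) y + B x (Y y) = 0 := hY.skew x y
    rw [happ, happ]
    simp only [map_add, map_sub, LinearMap.map_smulₛₗ, LinearMap.add_apply, LinearMap.sub_apply,
      LinearMap.smul_apply, smul_eq_mul, Complex.conj_ofReal, RingHom.id_apply]
    linear_combination (1 - (t : ℂ)) * h1 + (t : ℂ) * h2
  · have h1 : X x = 0 := hX.map_V₁ x hx
    have h2 : Y x = 0 := hY.map_V₁ x hx
    rw [happ, h1, h2]
    simp
  · have h1 : X x - e x ∈ D.V₁ := hX.map_V₀ x
    have h2 : Y x - e x ∈ D.V₁ := hY.map_V₀ x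
    rw [happ]
    have := add_mem h1 (D.V₁.smul_mem (t : ℂ) (sub_mem h2 h1))
    rw [sub_sub_sub_cancel_right] at this
    rwa [add_sub_right_comm]
  · rw [happ]
    exact add_mem (hX.map_top x) (Submodule.smul_mem _ _ (sub_mem (hY.map_top x) (hX.map_top x)))

/-- An orbit that is non-empty and relatively open in c + n meets the dense union of the other
collection, hence equals one of its orbits. -/
theorem IsRhoInduced.subset {e : V →L[ℂ] V} {𝒪 𝒪' : Set (Set (V →L[ℂ] V))}
    (h : D.IsRhoInduced e 𝒪) (h' : D.IsRhoInduced e 𝒪') : 𝒪 ⊆ 𝒪' := by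
  intro O hO
  obtain ⟨⟨E, -, rfl⟩, ⟨x, hx⟩, U, hU, hOU⟩ := h.2.1 O hO
  have hxU : x ∈ U := by rw [hOU] at hx; exact hx.1
  obtain ⟨y, hyU, hy⟩ := mem_closure_iff.1 (h'.2.2 hx.2) U hU hxU
  simp only [Set.mem_iUnion] at hy
  obtain ⟨O', hO', hyO', hyC⟩ := hy
  obtain ⟨⟨E', -, rfl⟩, -⟩ := h'.2.1 O' hO'
  have hyO : y ∈ adOrbit (unitaryGroupOf B) E := by
    have : y ∈ U ∩ D.orbitAddNilradical e := ⟨hyU, hyC⟩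
    rw [← hOU] at this
    exact this.1
  rwa [← adOrbit_eq_of_mem hyO, adOrbit_eq_of_mem hyO']

theorem exists_isOpen_inter_eq {α : Type*} [TopologicalSpace α] {O C : Set α}
    (h : ∀ x ∈ O ∩ C, O ∈ 𝓝[C] x) : ∃ U, IsOpen U ∧ O ∩ C = U ∩ C := by
  refine ⟨interior (O ∪ Cᶜ), isOpen_interior, Set.Subset.antisymm ?_ ?_⟩
  · intro x hx
    refine ⟨?_, hx.2⟩
    rw [mem_interior_iff_mem_nhds, Set.union_comm]
    have := h x hx
    rw [mem_nhdsWithin_iff_eventually] at this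
    filter_upwards [this] with y hy
    by_cases hyC : y ∈ C
    · exact Or.inr (hy hyC)
    · exact Or.inl hyC
  · rintro x ⟨hx, hxC⟩
    exact ⟨(interior_subset hx).resolve_right fun h => h hxC, hxC⟩

end RealFlag
end Induction
end

/-! ### The theorem -/

theorem theorem8p13 {V : Type*} [NormedAddCommGroup V] [NormedSpace ℂ V] [FiniteDimensional ℂ V]
    (B : V →ₗ⋆[ℂ] V →ₗ[ℂ] ℂ) (hB : B.IsSymm) (hB' : B.Nondegenerate)
    (D : RealFlag B)
    (e : V →L[ℂ] V) (he : e ∈ skewHermitian B) (henil : IsNilpotent e)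
    (he₀ : ∀ x ∈ D.V₀, (e : V →ₗ[ℂ] V) x ∈ D.V₀)
    (he₁ : ∀ x ∈ D.V₁, e x = 0) (he₁' : ∀ x ∈ D.V₁', e x = 0)
    (T : SignedTableau)
    (hT : T = signedTableau (B.domRestrict₁₂ D.V₀ D.V₀) ((e : V →ₗ[ℂ] V).restrict he₀)) :
    (∃! 𝒪 : Set (Set (V →L[ℂ] V)), D.IsRhoInduced e 𝒪) ∧
    ∀ 𝒪 : Set (Set (V →L[ℂ] V)), D.IsRhoInduced e 𝒪 →
      (∀ E ∈ skewHermitian B,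
        adOrbit (unitaryGroupOf B) E ∈ 𝒪 ↔
          IsNilpotent E ∧
            AddTwoBoxes (Module.finrank ℂ D.V₁) T (signedTableau B (E : V →ₗ[ℂ] V))) ∧
      (∀ T' : SignedTableau, AddTwoBoxes (Module.finrank ℂ D.V₁) T T' →
        ∃! O : Set (V →L[ℂ] V), O ∈ 𝒪 ∧ ∀ E ∈ O, signedTableau B (E : V →ₗ[ℂ] V) = T') := by
  set e₀ := (e : V →ₗ[ℂ] V).restrict he₀ with he₀def
  have heskew : ∀ x y, B.domRestrict₁₂ D.V₀ D.V₀ (e₀ x) y + B.domRestrict₁₂ D.V₀ D.V₀ x (e₀ y) = 0 :=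
    fun x y => he x y
  have he₀nil : IsNilpotent e₀ := by
    obtain ⟨k, hk⟩ := isNilpotent_toLinearMap_iff.2 henil
    refine ⟨k, ?_⟩
    ext x
    rw [he₀def, Module.End.pow_restrict]
    simp [hk, LinearMap.restrict_apply]
  have hmem := RealFlag.mem_orbitAddNilradical_iff he he₀ he₁ he₁'
  have hliftnil : ∀ {X : V →L[ℂ] V}, D.IsLift e₀ (X : V →ₗ[ℂ] V) → IsNilpotent X := fun h =>
    isNilpotent_toLinearMap_iff.1 (h.isNilpotent hB hB' he₀nil)
  have hC : ∀ Y ∈ D.orbitAddNilradical e, Y ∈ skewHermitian B ∧ IsNilpotent Y := by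
    intro Y hY
    obtain ⟨g, hg, X, hX, rfl⟩ := (hmem Y).1 hY
    exact ⟨adConj_mem_skewHermitian hg.1 hX.skew, isNilpotent_adConj (hliftnil hX)⟩
  have hlift_mem : ∀ X : Module.End ℂ V, D.IsLift e₀ X →
      (LinearMap.toContinuousLinearMap X) ∈ D.orbitAddNilradical e := fun X hX =>
    (hmem _).2 ⟨1, one_mem _, LinearMap.toContinuousLinearMap X, hX, rfl⟩
  -- An element with an admissible tableau is conjugate to an explicit lift of maximal ranks, and
  -- ranks are invariant under conjugation.
  have hrank : ∀ E ∈ D.orbitAddNilradical e,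
      AddTwoBoxes (Module.finrank ℂ D.V₁) T (signedTableau B (E : V →ₗ[ℂ] V)) →
      ∀ F ∈ D.orbitAddNilradical e, ∀ k,
        Module.finrank ℂ (LinearMap.range ((F : V →ₗ[ℂ] V) ^ k)) ≤
          Module.finrank ℂ (LinearMap.range ((E : V →ₗ[ℂ] V) ^ k)) := by
    intro E hE hET F hF k
    rw [hT] at hET
    obtain ⟨X, hX, hXT, hXmax⟩ := RealFlag.exists_isLift_of_addTwoBoxes hB hB' he₀nil heskew hET
    have hXC := hC _ (hlift_mem X hX)
    have hEX : E ∈ adOrbit (unitaryGroupOf B) (LinearMap.toContinuousLinearMap X) := by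
      rw [adOrbit_unitaryGroupOf_eq hB hB' hXC.1 hXC.2]
      exact ⟨(hC E hE).1, (hC E hE).2, hXT.symm⟩
    obtain ⟨g, hg, rfl⟩ := mem_adOrbit_iff.1 hEX
    obtain ⟨h, hh, Y, hY, rfl⟩ := (hmem F).1 hF
    rw [finrank_range_pow_adConj hB hB' hg hXC.1 hXC.2,
      finrank_range_pow_adConj hB hB' hh.1 hY.skew (hliftnil hY)]
    exact hXmax _ hY k
  have hreal : ∀ T' : SignedTableau, AddTwoBoxes (Module.finrank ℂ D.V₁) T T' →
      ∃ E ∈ D.orbitAddNilradical e, signedTableau B (E : V →ₗ[ℂ] V) = T' := by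
    intro T' hT'
    rw [hT] at hT'
    obtain ⟨X, hX, hXT, -⟩ := RealFlag.exists_isLift_of_addTwoBoxes hB hB' he₀nil heskew hT'
    exact ⟨_, hlift_mem X hX, hXT⟩
  have hdense : ∀ Y ∈ D.orbitAddNilradical e, Y ∈ closure {E | E ∈ D.orbitAddNilradical e ∧
      AddTwoBoxes (Module.finrank ℂ D.V₁) T (signedTableau B (E : V →ₗ[ℂ] V))} := by
    intro Y hY
    obtain ⟨g, hg, X, hX, rfl⟩ := (hmem Y).1 hY
    -- Z has maximal ranks for all powers at once, so X is approached along the line towards Z by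
    -- lifts of maximal ranks.
    obtain ⟨Z', hZ', hZmax⟩ := RealFlag.exists_isLift_forall_finrank_range_le hB hB' he₀nil heskew
    obtain ⟨Z, rfl⟩ : ∃ Z : V →L[ℂ] V, (Z : V →ₗ[ℂ] V) = Z' :=
      ⟨LinearMap.toContinuousLinearMap Z', rfl⟩
    obtain ⟨m, hm⟩ := hZ'.isNilpotent hB hB' he₀nil
    have hev : ∀ᶠ t : ℝ in 𝓝[≠] 0, ∀ k ∈ Finset.range m,
        Module.finrank ℂ (LinearMap.range ((Z : V →ₗ[ℂ] V) ^ k)) ≤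
          Module.finrank ℂ
            (LinearMap.range (((X + t • (Z - X) : V →L[ℂ] V) : V →ₗ[ℂ] V) ^ k)) := by
      rw [Filter.eventually_all_finset]
      intro k _
      refine eventually_rank_line_ge X (Z - X) k _ ?_
      rw [add_sub_cancel]
    have htend : Tendsto (fun t : ℝ => adConj g (X + t • (Z - X))) (𝓝[≠] 0) (𝓝 (adConj g X)) := by
      have hc : Continuous fun t : ℝ => adConj g (X + t • (Z - X)) := by
        unfold adConj
        fun_prop
      have := hc.tendsto 0
      rw [zero_smul, add_zero] at this
      exact this.mono_left nhdsWithin_le_nhds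
    refine mem_closure_of_tendsto htend ?_
    filter_upwards [hev] with t ht
    have hline := hX.line hZ' t
    refine ⟨(hmem _).2 ⟨g, hg, _, hline, rfl⟩, ?_⟩
    rw [signedTableau_adConj hB hB' hg.1 hline.skew (hliftnil hline), hT]
    refine hline.addTwoBoxes_of_forall_finrank_range_le hB hB' he₀nil heskew fun F hF k => ?_
    refine (hZmax F hF k).trans ?_
    rcases lt_or_ge k m with hk | hk
    · exact ht k (Finset.mem_range.2 hk)
    · rw [pow_eq_zero_of_le hk hm, LinearMap.range_zero, finrank_bot]
      exact Nat.zero_le _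
  let 𝒢 : Set (V →L[ℂ] V) := {E | E ∈ D.orbitAddNilradical e ∧
    AddTwoBoxes (Module.finrank ℂ D.V₁) T (signedTableau B (E : V →ₗ[ℂ] V))}
  let 𝒪₀ : Set (Set (V →L[ℂ] V)) := (fun E => adOrbit (unitaryGroupOf B) E) '' 𝒢
  have hrho : D.IsRhoInduced e 𝒪₀ := by
    refine ⟨?_, ?_, ?_⟩
    · have hfin := RealFlag.finite_setOf_addTwoBoxes hB hB' he₀nil heskew
      rw [← hT] at hfin
      refine (hfin.image fun τ : SignedTableau => {Y : V →L[ℂ] V | Y ∈ skewHermitian B ∧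
        IsNilpotent Y ∧ signedTableau B (Y : V →ₗ[ℂ] V) = τ}).subset ?_
      rintro _ ⟨E, hE, rfl⟩
      exact ⟨_, hE.2, (adOrbit_unitaryGroupOf_eq hB hB' (hC E hE.1).1 (hC E hE.1).2).symm⟩
    · rintro _ ⟨E, hE, rfl⟩
      refine ⟨⟨E, (hC E hE.1).1, rfl⟩, ⟨E, mem_adOrbit_self _ E, hE.1⟩, ?_⟩
      refine RealFlag.exists_isOpen_inter_eq ?_
      rintro F ⟨hFO, hFC⟩
      simp only [adOrbit_unitaryGroupOf_eq hB hB' (hC E hE.1).1 (hC E hE.1).2] at hFO ⊢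
      filter_upwards [eventually_signedTableau_eq hB hB' hC hFC
        (hrank F hFC (hFO.2.2 ▸ hE.2)), self_mem_nhdsWithin] with G hG hGC
      exact ⟨(hC G hGC).1, (hC G hGC).2, hG.trans hFO.2.2⟩
    · intro Y hY
      refine closure_mono ?_ (hdense Y hY)
      intro E hE
      simp only [Set.mem_iUnion]
      exact ⟨_, ⟨E, hE, rfl⟩, mem_adOrbit_self _ E, hE.1⟩
  have huniq : ∀ 𝒪, D.IsRhoInduced e 𝒪 → 𝒪 = 𝒪₀ := fun 𝒪 h =>
    Set.Subset.antisymm (h.subset hrho) (hrho.subset h)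
  refine ⟨⟨𝒪₀, hrho, huniq⟩, fun 𝒪 h𝒪 => ?_⟩
  obtain rfl := huniq 𝒪 h𝒪
  refine ⟨fun E hE => ⟨?_, ?_⟩, fun T' hT' => ?_⟩
  · rintro ⟨F, hF, hFE⟩
    have : E ∈ adOrbit (unitaryGroupOf B) F := by
      change adOrbit _ F = _ at hFE
      rw [hFE]
      exact mem_adOrbit_self _ E
    rw [adOrbit_unitaryGroupOf_eq hB hB' (hC F hF.1).1 (hC F hF.1).2] at this
    exact ⟨this.2.1, this.2.2 ▸ hF.2⟩
  · rintro ⟨hEn, hET⟩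
    -- E itself need not lie in c + n; the explicit lift with the same tableau does, and it lies in
    -- the same orbit.
    obtain ⟨F, hFC, hFT⟩ := hreal _ hET
    refine ⟨F, ⟨hFC, hFT ▸ hET⟩, ?_⟩
    change adOrbit _ F = _
    rw [adOrbit_unitaryGroupOf_eq hB hB' (hC F hFC).1 (hC F hFC).2,
      adOrbit_unitaryGroupOf_eq hB hB' hE hEn, hFT]
  · obtain ⟨F, hFC, hFT⟩ := hreal _ hT'
    refine ⟨adOrbit (unitaryGroupOf B) F, ⟨⟨F, ⟨hFC, hFT ▸ hT'⟩, rfl⟩, ?_⟩, ?_⟩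
    · intro E hE
      rw [adOrbit_unitaryGroupOf_eq hB hB' (hC F hFC).1 (hC F hFC).2] at hE
      exact hE.2.2.trans hFT
    · rintro _ ⟨⟨G, hG, rfl⟩, hGT⟩
      have := hGT G (mem_adOrbit_self _ G)
      change adOrbit _ G = _
      rw [adOrbit_unitaryGroupOf_eq hB hB' (hC F hFC).1 (hC F hFC).2,
        adOrbit_unitaryGroupOf_eq hB hB' (hC G hG.1).1 (hC G hG.1).2, hFT, this]
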